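/- Let $(\mathfrak g,\mathfrak q)$ be a CR algebra of hypersurface type: $\mathfrak g$ is a real Lie algebra, $\mathfrak q$ is a complex subalgebra of $\hat{\mathfrak g}=\mathfrak g\otimes\mathbb C$ with $\mathfrak g/(\mathfrak g\cap\mathfrak q)$ finite-dimensional, and $\mathfrak q+\bar{\mathfrak q}$ has codimension one in $\hat{\mathfrak g}$. (These are the algebraic data of a germ of a locally homogeneous CR manifold of hypersurface type.) Put $\widehat{\mathfrak{stab}}=\mathfrak q\cap\bar{\mathfrak q}$. The Freeman sequence is $\mathfrak q^{-1}=\mathfrak q$, $\mathfrak q^p=\{\xi\in\mathfrak q^{p-1}\mid[\xi,\bar{\mathfrak q}]\subset\mathfrak q^{p-1}+\bar{\mathfrak q}\}$ for $p\ge0$. Assume that $(\mathfrak g,\mathfrak q)$ is $k$-nondegenerate for some $k\ge1$, i.e. $\mathfrak q^p\ne\widehat{\mathfrak{stab}}$ for $-1\le p\le k-2$ and $\mathfrak q^{k-1}=\widehat{\mathfrak{stab}}$. The contact filtration of $\mathfrak g$ is $\mathfrak g^{-1}=\mathfrak g\cap(\mathfrak q+\bar{\mathfrak q})$, $\mathfrak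 g^{r}=\mathfrak g^{r+1}+[\mathfrak g^{-1},\mathfrak g^{r+1}]$ for $r\le-2$, $\mathfrak g^p=\{\xi\in\mathfrak g^{p-1}\mid[\xi,\mathfrak g^{-1}]\subset\mathfrak g^{p-1}\}$ for $p\ge0$; hats denote complexifications. Assume that $\mathfrak g$ is a trivial filtered deformation, with a fixed identification with its associated graded algebra, i.e. a Lie algebra grading $\mathfrak g=\bigoplus_{p\in\mathbb Z}\mathfrak g_p$ such that $\mathfrak g^p=\bigoplus_{j\ge p}\mathfrak g_j$ for all $p$. Let $\mathfrak c=\bigoplus_{p\ge-2}\mathfrak c_p$ denote the real contact algebra in dimension $2n+1$, that is, the polynomials in $t,x_1,\dots,x_n,y_1,\dots,y_n$ with the Lagrange bracket $[f,g]=\Delta f\,\partial_tg-\partial_tf\,\Delta g+\sum_i(\partial_{x_i}f\,\partial_{y_i}g-\partial_{y_i}f\,\partial_{x_i}g)$, $\Delta=2-\sum_i(x_i\partial_{x_i}+y_i\partial_{y_i})$, where $\mathfrak c_p$ is the space of weighted homogeneous polynomials of weight $p+2$ ($x_i,y_i$ of weight $1$, $t$ of weight $2$). Then, for some $n$, the graded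 Lie algebra $\mathfrak g$ embeds as a graded subalgebra of $\mathfrak c$ with $\mathfrak g_{-2}=\mathfrak c_{-2}$, $\mathfrak g_{-1}=\mathfrak c_{-1}$, in such a way that the complex structure on $\mathfrak g_{-1}$ whose $(1,0)$-part is the image of $\mathfrak q$ in $\hat{\mathfrak g}_{-1}=\hat{\mathfrak g}^{-1}/\hat{\mathfrak g}^0$ is given by $\operatorname{ad}(\mathfrak J)$ for some $\mathfrak J\in\mathfrak c_0$ acting trivially on $\mathfrak c_{-2}$. For any such embedding and $\mathfrak J$, let $\mathfrak u_p\subset\hat{\mathfrak c}_p$ be the sum of all $\operatorname{ad}(\mathfrak J)$-eigenspaces in $\hat{\mathfrak c}_p$ except the one of eigenvalue $-i(p+2)$, and $\mathfrak u=\bigoplus_{p\ge-1}\mathfrak u_p$. If the identification is aligned, i.e. $\mathfrak u_{-1}\subset\mathfrak q$, then: 1. $\widehat{\mathfrak{stab}}=\hat{\mathfrak g}\cap\mathfrak u\cap\bar{\mathfrak u}$, and it is $\mathbb Z$-graded: $\widehat{\mathfrak{stab}}=\bigoplus_p\widehat{\mathfrak{stab}}_p$ with $\widehat{\mathfrak{stab}}_p=\hat{\mathfrak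 g}_p\cap\widehat{\mathfrak{stab}}$; 2. $\mathfrak q^p+\bar{\mathfrak q}^p=\hat{\mathfrak g}^p+\widehat{\mathfrak{stab}}$ for all $p\ge-1$; 3. $\mathfrak q^q=\bigoplus_{0\le p\le q-1}\widehat{\mathfrak{stab}}_p\oplus\bigoplus_{p\ge q}(\hat{\mathfrak g}_p\cap\mathfrak u_p)$ for all $q\ge0$. -/

import Mathlib

open scoped TensorProduct

namespace CR

/-- Index set of the variables `t` (`none`), `x_i` (`some (inl i)`), `y_i` (`some (inr i)`). -/
abbrev Vars (n : ℕ) : Type := Option (Fin n ⊕ Fin n)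

/-- The (infinite-dimensional, real) contact algebra `𝔠 = ⨁_{p ≥ -2} 𝔠_p` in dimension `2n+1`,
realized by generating functions: polynomials in `t, x_1, …, x_n, y_1, …, y_n` with the Lagrange
(contact) bracket below. -/
def ContactAlgebra (n : ℕ) : Type := MvPolynomial (Vars n) ℝ

namespace ContactAlgebra

open MvPolynomial

variable {n : ℕ}

noncomputable instance : AddCommGroup (ContactAlgebra n) :=
  inferInstanceAs (AddCommGroup (MvPolynomial (Vars n) ℝ))

noncomputable instance : Module ℝ (ContactAlgebra n) :=
  inferInstanceAs (Module ℝ (MvPolynomial (Vars n) ℝ))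

/-- The operator `Δ = 2 - ∑ (x_i ∂_{x_i} + y_i ∂_{y_i})`. -/
noncomputable def lap (f : MvPolynomial (Vars n) ℝ) : MvPolynomial (Vars n) ℝ :=
  2 * f - ∑ i : Fin n ⊕ Fin n, X (some i) * pderiv (some i) f

/-- The Poisson bracket `∑ (∂_{x_i} f ∂_{y_i} g - ∂_{y_i} f ∂_{x_i} g)`. -/
noncomputable def poisson (f g : MvPolynomial (Vars n) ℝ) : MvPolynomial (Vars n) ℝ :=
  ∑ i : Fin n, (pderiv (some (Sum.inl i)) f * pderiv (some (Sum.inr i)) g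
    - pderiv (some (Sum.inr i)) f * pderiv (some (Sum.inl i)) g)

/-- The Lagrange bracket `[f, g] = Δf ∂_t g - ∂_t f Δg + {f, g}` of generating functions of
contact vector fields. -/
noncomputable def lagrange (f g : MvPolynomial (Vars n) ℝ) : MvPolynomial (Vars n) ℝ :=
  lap f * pderiv none g - pderiv none f * lap g + poisson f g

theorem pderiv_comm (i j : Vars n) (f : MvPolynomial (Vars n) ℝ) :
    pderiv i (pderiv j f) = pderiv j (pderiv i f) := by
  have h : ⁅(pderiv i : Derivation ℝ (MvPolynomial (Vars n) ℝ) (MvPolynomial (Vars n) ℝ)), (pderiv j : Derivation ℝ (MvPolynomial (Vars n) ℝ) (MvPolynomial (Vars n) ℝ))⁆ = 0 := by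
    apply MvPolynomial.derivation_ext
    intro k
    classical
    simp only [Derivation.commutator_apply, pderiv_X, Derivation.coe_zero, Pi.zero_apply,
      Pi.single_apply]
    split_ifs <;> simp
  have h2 := congrArg (fun D => D f) h
  simpa [Derivation.commutator_apply, sub_eq_zero] using h2

/-- The contact vector field with generating function `f`, as a derivation. -/
noncomputable def contactField (f : MvPolynomial (Vars n) ℝ) :
    Derivation ℝ (MvPolynomial (Vars n) ℝ) (MvPolynomial (Vars n) ℝ) :=
  lap f • pderiv none
    + ∑ i : Fin n ⊕ Fin n, (pderiv none f * X (some i)) • pderiv (some i)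
    + ∑ i : Fin n, (pderiv (some (Sum.inl i)) f • pderiv (some (Sum.inr i))
        - pderiv (some (Sum.inr i)) f • pderiv (some (Sum.inl i)))

theorem sum_derivation_apply {ι : Type*} (s : Finset ι)
    (D : ι → Derivation ℝ (MvPolynomial (Vars n) ℝ) (MvPolynomial (Vars n) ℝ))
    (g : MvPolynomial (Vars n) ℝ) : (∑ i ∈ s, D i) g = ∑ i ∈ s, D i g := by
  classical
  induction s using Finset.induction_on with
  | empty => simp
  | insert a s ha ih => rw [Finset.sum_insert ha, Finset.sum_insert ha, Derivation.add_apply, ih]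

theorem contactField_apply (f g : MvPolynomial (Vars n) ℝ) :
    contactField f g = lagrange f g + 2 * pderiv none f * g := by
  simp only [contactField, lagrange, lap, poisson, Derivation.add_apply, Derivation.smul_apply,
    Derivation.sub_apply, smul_eq_mul, sum_derivation_apply, mul_assoc, Finset.mul_sum, mul_sub]
  ring

theorem lagrange_add (f g h : MvPolynomial (Vars n) ℝ) :
    lagrange f (g + h) = lagrange f g + lagrange f h := by
  have := contactField_apply f (g + h)
  rw [map_add, contactField_apply, contactField_apply] at this
  linear_combination -this

theorem lagrange_smul (r : ℝ) (f g : MvPolynomial (Vars n) ℝ) :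
    lagrange f (r • g) = r • lagrange f g := by
  have := contactField_apply f (r • g)
  rw [Derivation.map_smul, contactField_apply, smul_add, mul_smul_comm] at this
  exact (add_right_cancel this).symm

theorem lagrange_skew (f g : MvPolynomial (Vars n) ℝ) : lagrange f g = - lagrange g f := by
  have : poisson f g = - poisson g f := by
    simp only [poisson, ← Finset.sum_neg_distrib]
    exact Finset.sum_congr rfl fun i _ => by ring
  simp only [lagrange, this]; ring

theorem pderiv_none_lap (f : MvPolynomial (Vars n) ℝ) :
    pderiv none (lap f) = lap (pderiv none f) := by
  have h2 : pderiv (none : Vars n) (2 : MvPolynomial (Vars n) ℝ) = 0 := by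
    simpa using Derivation.map_natCast (pderiv (R := ℝ) (none : Vars n)) 2
  simp [lap, Derivation.leibniz, h2, pderiv_comm none]

theorem pderiv_some_lap (j : Fin n ⊕ Fin n) (f : MvPolynomial (Vars n) ℝ) :
    pderiv (some j) (lap f) = lap (pderiv (some j) f) - pderiv (some j) f := by
  classical
  have h2 : pderiv (some j : Vars n) (2 : MvPolynomial (Vars n) ℝ) = 0 := by
    simpa using Derivation.map_natCast (pderiv (R := ℝ) (some j : Vars n)) 2
  simp only [lap, map_sub, map_sum, Derivation.leibniz, h2, smul_eq_mul, pderiv_X, Pi.single_apply,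
    Finset.sum_add_distrib, mul_ite, mul_one, mul_zero, Option.some.injEq, pderiv_comm (some j)]
  simp
  ring

theorem pderiv_none_lagrange (f g : MvPolynomial (Vars n) ℝ) :
    pderiv none (lagrange f g) = lagrange (pderiv none f) g + lagrange f (pderiv none g) := by
  simp only [lagrange, poisson, map_add, map_sub, map_sum, Derivation.leibniz, smul_eq_mul,
    pderiv_none_lap, pderiv_comm none (some _)]
  simp only [Finset.sum_add_distrib, Finset.sum_sub_distrib, mul_comm]
  ring

theorem pderiv_some_lagrange (j : Fin n ⊕ Fin n) (f g : MvPolynomial (Vars n) ℝ) :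
    pderiv (some j) (lagrange f g) = lagrange (pderiv (some j) f) g
      + lagrange f (pderiv (some j) g)
      - pderiv (some j) f * pderiv none g + pderiv none f * pderiv (some j) g := by
  simp only [lagrange, poisson, map_add, map_sub, map_sum, Derivation.leibniz, smul_eq_mul,
    pderiv_some_lap, pderiv_comm (some j) none, pderiv_comm (some j) (some _)]
  simp only [Finset.sum_add_distrib, Finset.sum_sub_distrib, mul_comm]
  ring

theorem lap_X (j : Fin n ⊕ Fin n) : lap (X (some j) : MvPolynomial (Vars n) ℝ) = X (some j) := by
  classical
  simp [lap, pderiv_X, Pi.single_apply]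
  ring

theorem lap_t : lap (X none : MvPolynomial (Vars n) ℝ) = 2 * X none := by
  classical
  simp [lap, pderiv_X]

theorem lagrange_X_inl (f : MvPolynomial (Vars n) ℝ) (j : Fin n) :
    lagrange f (X (some (Sum.inl j)))
      = - pderiv none f * X (some (Sum.inl j)) - pderiv (some (Sum.inr j)) f := by
  classical
  simp [lagrange, poisson, lap_X, pderiv_X, Pi.single_apply]
  ring

theorem lagrange_X_inr (f : MvPolynomial (Vars n) ℝ) (j : Fin n) :
    lagrange f (X (some (Sum.inr j)))
      = - pderiv none f * X (some (Sum.inr j)) + pderiv (some (Sum.inl j)) f := by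
  classical
  simp [lagrange, poisson, lap_X, pderiv_X, Pi.single_apply]

theorem lagrange_X_none (f : MvPolynomial (Vars n) ℝ) :
    lagrange f (X none) = lap f - 2 * pderiv none f * X none := by
  classical
  simp [lagrange, poisson, lap_t, pderiv_X]
  ring

theorem contactField_X_inl (f : MvPolynomial (Vars n) ℝ) (j : Fin n) :
    contactField f (X (some (Sum.inl j)))
      = pderiv none f * X (some (Sum.inl j)) - pderiv (some (Sum.inr j)) f := by
  rw [contactField_apply, lagrange_X_inl]; ring

theorem contactField_X_inr (f : MvPolynomial (Vars n) ℝ) (j : Fin n) :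
    contactField f (X (some (Sum.inr j)))
      = pderiv none f * X (some (Sum.inr j)) + pderiv (some (Sum.inl j)) f := by
  rw [contactField_apply, lagrange_X_inr]; ring

theorem contactField_X_none (f : MvPolynomial (Vars n) ℝ) :
    contactField f (X none) = lap f := by
  rw [contactField_apply, lagrange_X_none]; ring

theorem lap_mul (f g : MvPolynomial (Vars n) ℝ) :
    lap (f * g) = lap f * g + f * lap g - 2 * (f * g) := by
  simp only [lap, Derivation.leibniz, smul_eq_mul, mul_add, Finset.sum_add_distrib, sub_mul,
    mul_sub, Finset.sum_mul, Finset.mul_sum]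
  have h1 : ∑ i : Fin n ⊕ Fin n, X (some i) * (f * pderiv (some i) g)
      = ∑ i : Fin n ⊕ Fin n, f * (X (some i) * pderiv (some i) g) :=
    Finset.sum_congr rfl fun i _ => by ring
  have h2 : ∑ i : Fin n ⊕ Fin n, X (some i) * (g * pderiv (some i) f)
      = ∑ i : Fin n ⊕ Fin n, X (some i) * pderiv (some i) f * g :=
    Finset.sum_congr rfl fun i _ => by ring
  rw [h1, h2]; ring

theorem lap_add (f g : MvPolynomial (Vars n) ℝ) : lap (f + g) = lap f + lap g := by
  simp only [lap, map_add, mul_add, Finset.sum_add_distrib]; ring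

theorem lap_sub (f g : MvPolynomial (Vars n) ℝ) : lap (f - g) = lap f - lap g := by
  simp only [lap, map_sub, mul_sub, Finset.sum_sub_distrib]; ring

theorem lap_sum {ι : Type*} (s : Finset ι) (F : ι → MvPolynomial (Vars n) ℝ) :
    lap (∑ i ∈ s, F i) = ∑ i ∈ s, lap (F i) := by
  simp only [lap, map_sum, Finset.mul_sum, Finset.sum_sub_distrib]
  rw [Finset.sum_comm]

theorem lap_pderiv_some (j : Fin n ⊕ Fin n) (f : MvPolynomial (Vars n) ℝ) :
    lap (pderiv (some j) f) = pderiv (some j) (lap f) + pderiv (some j) f := by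
  rw [pderiv_some_lap]; ring

theorem lap_poisson (f g : MvPolynomial (Vars n) ℝ) :
    lap (poisson f g) = poisson (lap f) g + poisson f (lap g) := by
  simp only [poisson, lap_sum, lap_sub, lap_mul, lap_pderiv_some, ← Finset.sum_add_distrib]
  exact Finset.sum_congr rfl fun i _ => by ring

theorem lap_lagrange (f g : MvPolynomial (Vars n) ℝ) :
    lap (lagrange f g) = lagrange f (lap g) + 2 * pderiv none f * lap g
      - (lagrange g (lap f) + 2 * pderiv none g * lap f) := by
  rw [lagrange_skew g (lap f)]
  simp only [lagrange, lap_add, lap_sub, lap_mul, lap_poisson, pderiv_none_lap]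
  ring

theorem contactField_lagrange (f g : MvPolynomial (Vars n) ℝ) :
    contactField (lagrange f g) = ⁅contactField f, contactField g⁆ := by
  apply MvPolynomial.derivation_ext
  intro k
  rw [Derivation.commutator_apply]
  rcases k with _ | (j | j)
  · simp only [contactField_X_none]
    simp only [contactField_apply, lap_lagrange]
  · simp only [contactField_X_inl, map_sub, Derivation.leibniz, smul_eq_mul]
    simp only [contactField_apply, pderiv_none_lagrange, pderiv_some_lagrange]
    rw [lagrange_skew (pderiv none f) g, lagrange_skew (pderiv _ f) g]
    ring
  · simp only [contactField_X_inr, map_add, Derivation.leibniz, smul_eq_mul]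
    simp only [contactField_apply, pderiv_none_lagrange, pderiv_some_lagrange]
    rw [lagrange_skew (pderiv none f) g, lagrange_skew (pderiv _ f) g]
    ring

theorem lagrange_jacobi (f g h : MvPolynomial (Vars n) ℝ) :
    lagrange f (lagrange g h) = lagrange (lagrange f g) h + lagrange g (lagrange f h) := by
  have key := congrArg (fun D => D h) (contactField_lagrange f g)
  simp only [Derivation.commutator_apply, contactField_apply, lagrange_add, pderiv_none_lagrange] at key
  have l1 := contactField_apply f (2 * pderiv none g * h)
  have l2 := contactField_apply g (2 * pderiv none f * h)
  have h2 (f : MvPolynomial (Vars n) ℝ) : contactField f (2 : MvPolynomial (Vars n) ℝ) = 0 := by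
    simpa using Derivation.map_natCast (contactField f) 2
  simp only [Derivation.leibniz, h2, smul_eq_mul, contactField_apply] at l1 l2
  rw [lagrange_skew (pderiv none f) g] at key
  linear_combination -key + l1 - l2

theorem lagrange_self (f : MvPolynomial (Vars n) ℝ) : lagrange f f = 0 := by
  simp [lagrange, poisson, mul_comm]

theorem lagrange_add_left (f g h : MvPolynomial (Vars n) ℝ) :
    lagrange (f + g) h = lagrange f h + lagrange g h := by
  rw [lagrange_skew, lagrange_add, lagrange_skew h f, lagrange_skew h g]; ring

noncomputable instance : LieRing (ContactAlgebra n) where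
  bracket f g := lagrange f g
  add_lie f g h := lagrange_add_left f g h
  lie_add f g h := lagrange_add f g h
  lie_self f := lagrange_self f
  leibniz_lie f g h := lagrange_jacobi f g h

noncomputable instance : LieAlgebra ℝ (ContactAlgebra n) where
  lie_smul r f g := lagrange_smul r f g

/-- The grading of `𝔠`: with `x_i, y_i` of weight `1` and `t` of weight `2`, the component `𝔠_p`
consists of the weighted homogeneous polynomials of weight `p + 2`. So `𝔠_{-2}` is spanned by `1`,
`𝔠_{-1}` by the `x_i, y_i`, and `𝔠_p = S^{p+2}(𝔠_{-1}) ⊕ t S^p(𝔠_{-1}) ⊕ t² S^{p-2}(𝔠_{-1}) ⊕ ⋯`. -/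
noncomputable def component (n : ℕ) (p : ℤ) : Submodule ℝ (ContactAlgebra n) :=
  MvPolynomial.weightedHomogeneousSubmodule ℝ
    (fun v : Vars n => Option.elim v (2 : ℤ) (fun _ => 1)) (p + 2)

/-- `J` is a complex structure on `𝔠_{-1}` belonging to `𝔨_0`, i.e. an element of `𝔠_0` that acts
trivially on `𝔠_{-2}` and with square `-1` on `𝔠_{-1}`. -/
structure IsComplexStructure (J : ContactAlgebra n) : Prop where
  mem_component : J ∈ component n 0
  lie_eq_zero : ∀ v ∈ component n (-2), ⁅J, v⁆ = 0
  lie_lie_eq_neg : ∀ v ∈ component n (-1), ⁅J, ⁅J, v⁆⁆ = -v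

/-- The component `𝔲_p ⊆ ℂ ⊗ 𝔠_p`: the sum of all eigenspaces of `ad J` in `ℂ ⊗ 𝔠_p` except the one
of the minimal eigenvalue `-i(p+2)`. -/
noncomputable def univComponent (J : ContactAlgebra n) (p : ℤ) :
    Submodule ℂ (ℂ ⊗[ℝ] ContactAlgebra n) :=
  ⨆ (μ : ℂ) (_ : μ ≠ -((p : ℂ) + 2) * Complex.I),
    Module.End.eigenspace (LieAlgebra.ad ℂ (ℂ ⊗[ℝ] ContactAlgebra n) (1 ⊗ₜ[ℝ] J)) μ
      ⊓ (component n p).baseChange ℂ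

/-- `𝔲 = ⨁_{p ≥ -1} 𝔲_p`; the universal CR algebra is the pair `(𝔠, 𝔲)`. -/
noncomputable def univ (J : ContactAlgebra n) : Submodule ℂ (ℂ ⊗[ℝ] ContactAlgebra n) :=
  ⨆ (p : ℤ) (_ : -1 ≤ p), univComponent J p

end ContactAlgebra

/-- Complex conjugation on the complexification `ℂ ⊗ V` of a real vector space `V`. -/
noncomputable def conj (V : Type*) [AddCommGroup V] [Module ℝ V] :
    (ℂ ⊗[ℝ] V) →ₛₗ[starRingEnd ℂ] (ℂ ⊗[ℝ] V) where
  toFun := LinearMap.rTensor V Complex.conjAe.toLinearMap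
  map_add' := map_add _
  map_smul' c x := by
    induction x using TensorProduct.induction_on with
    | zero => simp
    | tmul a v => simp [TensorProduct.smul_tmul']
    | add x y hx hy => rw [smul_add, map_add, hx, hy, map_add, smul_add]

/-- The conjugate `{conj x | x ∈ W}` of a complex subspace `W` of `ℂ ⊗ V`. -/
noncomputable def conjSubmodule {V : Type*} [AddCommGroup V] [Module ℝ V]
    (W : Submodule ℂ (ℂ ⊗[ℝ] V)) : Submodule ℂ (ℂ ⊗[ℝ] V) :=
  W.map (conj V)

section CRAlgebra

variable {𝔤 : Type*} [LieRing 𝔤] [LieAlgebra ℝ 𝔤]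

/-- The real points `𝔤 ∩ W` of a complex subspace `W` of `ℂ ⊗ 𝔤`. -/
noncomputable def realPoints (W : Submodule ℂ (ℂ ⊗[ℝ] 𝔤)) : Submodule ℝ 𝔤 :=
  (W.restrictScalars ℝ).comap (TensorProduct.mk ℝ ℂ 𝔤 1)

/-- `𝔮 + conj 𝔮`. -/
noncomputable def qAddConj (𝔮 : LieSubalgebra ℂ (ℂ ⊗[ℝ] 𝔤)) : Submodule ℂ (ℂ ⊗[ℝ] 𝔤) :=
  𝔮.toSubmodule ⊔ conjSubmodule 𝔮.toSubmodule

/-- The complexified stabilizer `𝔮 ∩ conj 𝔮`. -/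
noncomputable def cstab (𝔮 : LieSubalgebra ℂ (ℂ ⊗[ℝ] 𝔤)) : Submodule ℂ (ℂ ⊗[ℝ] 𝔤) :=
  𝔮.toSubmodule ⊓ conjSubmodule 𝔮.toSubmodule

/-- `(𝔤, 𝔮)` is an (abstract) CR algebra of hypersurface type: `𝔤` is a real Lie algebra, `𝔮` is a
complex subalgebra of `ℂ ⊗ 𝔤`, the quotient of `𝔤` by the stabilizer `𝔤 ∩ 𝔮` is finite-dimensional
and `𝔮 + conj 𝔮` has codimension one in `ℂ ⊗ 𝔤`. -/
structure IsHypersurfaceCRAlgebra (𝔮 : LieSubalgebra ℂ (ℂ ⊗[ℝ] 𝔤)) : Prop where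
  finite_quotient : FiniteDimensional ℝ (𝔤 ⧸ realPoints 𝔮.toSubmodule)
  codim_one : Module.finrank ℂ ((ℂ ⊗[ℝ] 𝔤) ⧸ qAddConj 𝔮) = 1

/-- The Freeman sequence with the index shifted by one: `freemanAux 𝔮 m` is `𝔮^{m-1}`. -/
noncomputable def freemanAux (𝔮 : LieSubalgebra ℂ (ℂ ⊗[ℝ] 𝔤)) :
    ℕ → Submodule ℂ (ℂ ⊗[ℝ] 𝔤)
  | 0 => 𝔮.toSubmodule
  | m + 1 =>
    { carrier := {ξ | ξ ∈ freemanAux 𝔮 m ∧ ∀ η ∈ conjSubmodule 𝔮.toSubmodule,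
        ⁅ξ, η⁆ ∈ freemanAux 𝔮 m ⊔ conjSubmodule 𝔮.toSubmodule}
      add_mem' := fun ha hb => ⟨add_mem ha.1 hb.1, fun η hη => by
        rw [add_lie]; exact add_mem (ha.2 η hη) (hb.2 η hη)⟩
      zero_mem' := ⟨zero_mem _, fun η _ => by rw [zero_lie]; exact zero_mem _⟩
      smul_mem' := fun c _ ha => ⟨Submodule.smul_mem _ c ha.1, fun η hη => by
        rw [smul_lie]; exact Submodule.smul_mem _ c (ha.2 η hη)⟩ }

/-- The term `𝔮^p`, `p ≥ -1`, of the Freeman sequence: `𝔮^{-1} = 𝔮` and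
`𝔮^p = {ξ ∈ 𝔮^{p-1} | [ξ, conj 𝔮] ⊆ 𝔮^{p-1} + conj 𝔮}` for `p ≥ 0`. -/
noncomputable def freeman (𝔮 : LieSubalgebra ℂ (ℂ ⊗[ℝ] 𝔤)) (p : ℤ) :
    Submodule ℂ (ℂ ⊗[ℝ] 𝔤) :=
  freemanAux 𝔮 (p + 1).toNat

/-- `k`-nondegeneracy: `𝔮^p ≠ 𝔮 ∩ conj 𝔮` for `-1 ≤ p ≤ k - 2` and `𝔮^{k-1} = 𝔮 ∩ conj 𝔮`. -/
structure IsNondegenerate (𝔮 : LieSubalgebra ℂ (ℂ ⊗[ℝ] 𝔤)) (k : ℕ) : Prop where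
  one_le : 1 ≤ k
  freeman_ne : ∀ p : ℤ, -1 ≤ p → p ≤ (k : ℤ) - 2 → freeman 𝔮 p ≠ cstab 𝔮
  freeman_eq : freeman 𝔮 ((k : ℤ) - 1) = cstab 𝔮

/-- The upper part of the contact filtration: `filtrationUp 𝔮 m` is `𝔤^{m-1}`, where
`𝔤^{-1} = 𝔤 ∩ (𝔮 + conj 𝔮)` and `𝔤^p = {ξ ∈ 𝔤^{p-1} | [ξ, 𝔤^{-1}] ⊆ 𝔤^{p-1}}`. -/
noncomputable def filtrationUp (𝔮 : LieSubalgebra ℂ (ℂ ⊗[ℝ] 𝔤)) : ℕ → Submodule ℝ 𝔤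
  | 0 => realPoints (qAddConj 𝔮)
  | m + 1 =>
    { carrier := {ξ | ξ ∈ filtrationUp 𝔮 m ∧ ∀ η ∈ realPoints (qAddConj 𝔮),
        ⁅ξ, η⁆ ∈ filtrationUp 𝔮 m}
      add_mem' := fun ha hb => ⟨add_mem ha.1 hb.1, fun η hη => by
        rw [add_lie]; exact add_mem (ha.2 η hη) (hb.2 η hη)⟩
      zero_mem' := ⟨zero_mem _, fun η _ => by rw [zero_lie]; exact zero_mem _⟩
      smul_mem' := fun c _ ha => ⟨Submodule.smul_mem _ c ha.1, fun η hη => by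
        rw [smul_lie]; exact Submodule.smul_mem _ c (ha.2 η hη)⟩ }

/-- The lower part of the contact filtration: `filtrationDown 𝔮 m` is `𝔤^{-1-m}`, where
`𝔤^q = 𝔤^{q+1} + [𝔤^{-1}, 𝔤^{q+1}]` for `q ≤ -2`. -/
noncomputable def filtrationDown (𝔮 : LieSubalgebra ℂ (ℂ ⊗[ℝ] 𝔤)) : ℕ → Submodule ℝ 𝔤
  | 0 => realPoints (qAddConj 𝔮)
  | m + 1 => filtrationDown 𝔮 m ⊔ Submodule.span ℝ
      {ζ | ∃ ξ ∈ realPoints (qAddConj 𝔮), ∃ η ∈ filtrationDown 𝔮 m, ⁅ξ, η⁆ = ζ}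

/-- The contact filtration `𝔤^p`, `p ∈ ℤ`. -/
noncomputable def filtration (𝔮 : LieSubalgebra ℂ (ℂ ⊗[ℝ] 𝔤)) (p : ℤ) : Submodule ℝ 𝔤 :=
  if -1 ≤ p then filtrationUp 𝔮 (p + 1).toNat else filtrationDown 𝔮 (-1 - p).toNat

/-- An identification of `𝔤` with the graded Lie algebra `gr(𝔤)` of the contact filtration, as
filtered Lie algebras: a Lie algebra grading `𝔤 = ⨁ 𝔤_p` with `𝔤^p = ⨁_{j ≥ p} 𝔤_j` for all `p`. -/
structure IsTrivialFilteredDeformation (𝔮 : LieSubalgebra ℂ (ℂ ⊗[ℝ] 𝔤))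
    (𝒢 : ℤ → Submodule ℝ 𝔤) : Prop where
  isInternal : DirectSum.IsInternal 𝒢
  lie_mem : ∀ p q : ℤ, ∀ ξ ∈ 𝒢 p, ∀ η ∈ 𝒢 q, ⁅ξ, η⁆ ∈ 𝒢 (p + q)
  filtration_eq : ∀ p : ℤ, filtration 𝔮 p = ⨆ (j : ℤ) (_ : p ≤ j), 𝒢 j

/-- `ι` realizes the graded Lie algebra `𝔤 = ⨁ 𝔤_p` as a graded subalgebra of the contact algebra
with `𝔤_- = 𝔠_-`, and `J` is the complex structure on `𝔤_{-1} = 𝔠_{-1}` induced by the CR structure: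
under `ℂ ⊗ 𝔤_{-1} = (ℂ ⊗ 𝔤^{-1}) / (ℂ ⊗ 𝔤^0)`, the image of `𝔮` is the holomorphic part `𝔲_{-1}`. -/
structure IsContactRealization (𝔮 : LieSubalgebra ℂ (ℂ ⊗[ℝ] 𝔤)) (𝒢 : ℤ → Submodule ℝ 𝔤)
    {n : ℕ} (J : ContactAlgebra n) (ι : 𝔤 →ₗ⁅ℝ⁆ ContactAlgebra n) : Prop where
  injective : Function.Injective ι
  map_le : ∀ p : ℤ, (𝒢 p).map (ι : 𝔤 →ₗ[ℝ] ContactAlgebra n) ≤ ContactAlgebra.component n p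
  map_neg_two : (𝒢 (-2)).map (ι : 𝔤 →ₗ[ℝ] ContactAlgebra n) = ContactAlgebra.component n (-2)
  map_neg_one : (𝒢 (-1)).map (ι : 𝔤 →ₗ[ℝ] ContactAlgebra n) = ContactAlgebra.component n (-1)
  isComplexStructure : ContactAlgebra.IsComplexStructure J
  holomorphic : ∀ v ∈ (𝒢 (-1)).baseChange ℂ,
    (∃ η ∈ 𝔮, v - η ∈ (filtration 𝔮 0).baseChange ℂ) ↔
      (ι : 𝔤 →ₗ[ℝ] ContactAlgebra n).baseChange ℂ v ∈ ContactAlgebra.univComponent J (-1)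

/-- The subspace `(ℂ ⊗ 𝔤) ∩ W` for a subspace `W` of `ℂ ⊗ 𝔠`, where `𝔤 ⊆ 𝔠` by `ι`. -/
noncomputable def hatInter {n : ℕ} (ι : 𝔤 →ₗ⁅ℝ⁆ ContactAlgebra n)
    (W : Submodule ℂ (ℂ ⊗[ℝ] ContactAlgebra n)) : Submodule ℂ (ℂ ⊗[ℝ] 𝔤) :=
  W.comap ((ι : 𝔤 →ₗ[ℝ] ContactAlgebra n).baseChange ℂ)

/-- The identification is aligned: `𝔲_{-1} ⊆ 𝔮`. -/
def IsAligned (𝔮 : LieSubalgebra ℂ (ℂ ⊗[ℝ] 𝔤)) {n : ℕ} (J : ContactAlgebra n)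
    (ι : 𝔤 →ₗ⁅ℝ⁆ ContactAlgebra n) : Prop :=
  hatInter ι (ContactAlgebra.univComponent J (-1)) ≤ 𝔮.toSubmodule

/-- `W` is the (internal) direct sum of the family of subspaces `S p`. -/
def IsDirectSumOf {V : Type*} [AddCommGroup V] [Module ℂ V] (W : Submodule ℂ V)
    (S : ℤ → Submodule ℂ V) : Prop :=
  iSupIndep S ∧ W = ⨆ p, S p

/-- The summands of `⨁_{0 ≤ p ≤ q-1} stab_p ⊕ ⨁_{p ≥ q} (ℂ ⊗ 𝔤_p) ∩ 𝔲_p`, with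
`stab_p = (ℂ ⊗ 𝔤_p) ∩ stab`. -/
noncomputable def freemanSummand (𝔮 : LieSubalgebra ℂ (ℂ ⊗[ℝ] 𝔤)) (𝒢 : ℤ → Submodule ℝ 𝔤)
    {n : ℕ} (J : ContactAlgebra n) (ι : 𝔤 →ₗ⁅ℝ⁆ ContactAlgebra n) (q p : ℤ) :
    Submodule ℂ (ℂ ⊗[ℝ] 𝔤) :=
  if q ≤ p then (𝒢 p).baseChange ℂ ⊓ hatInter ι (ContactAlgebra.univComponent J p)
  else if 0 ≤ p then (𝒢 p).baseChange ℂ ⊓ cstab 𝔮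
  else ⊥

end CRAlgebra

end CR

/-!
Two independent facts are combined: a graded Lie algebra of this kind embeds into the contact
algebra, and the CR structure of an aligned realization is determined by its degree `-1` part.

*Existence of a realization.* The definition of the contact filtration makes `𝔤` transitive: an
element of degree `≥ -1` that commutes with `𝔤_{-1}` is zero. As `𝔮 + conj 𝔮` has codimension one,
`𝔤_{-2}` is a line, lower degrees vanish, and the bracket is a symplectic form on `𝔤_{-1}`, so that
the negative part is a Heisenberg algebra (`IsTrivialFilteredDeformation.exists_heisenberg`). The
bracket of a generating function with `1`, `x_i`, `y_i` prescribes its partial derivatives. Hence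
the generating function of `ξ ∈ 𝔤_p` is found from those of the brackets of `ξ` with the negative
part by integrating a closed system, and Euler's identity gives an explicit primitive
(`pderiv_primitive`, `genFun`). A polynomial of positive weight commuting with `1`, `x_i`, `y_i` is
zero, which shows by induction on the degree that the resulting map is a homomorphism
(`lagrange_genFun`), and transitivity of `𝔤` that it is injective (`eq_zero_of_genFun_eq_zero`). The
image of `𝔮` in degree `-1` is isotropic because `𝔮` is a subalgebra in `𝔮 + conj 𝔮`. It meets its
conjugate trivially by transitivity, and together they span the component. It thus defines a complex
structure that is skew for the symplectic form, and such an endomorphism is the adjoint action of a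
quadratic polynomial `J` (`exists_lagrange_dualVar_eq`).

*Aligned realizations.* In degree `p` the operator `ad J` is diagonalizable with eigenvalues among
`i(2k - (p + 2))`, `0 ≤ k ≤ p + 2`, and an element of degree `p ≥ -1` belongs to `𝔲_p` if and only
if its brackets with `𝔲_{-1}` belong to `𝔲_{p-1}` (`IsTransitiveGraded.mem_nonMinimal_iff`). This
property, transported to `U p = (ℂ ⊗ 𝔤_p) ∩ 𝔲_p` (`IsAdaptedFamily`), is all that is used of the
contact algebra. Since `U (-1) ⊆ 𝔮`, bracketing repeatedly with `U (-1)` shows that the components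
of elements of `𝔮` lie in the `U p` (`IsAdaptedFamily.cproj_mem`). Conversely, the elements of `𝔮`
that are conjugate to elements of `⨁ U p` belong to every term of the Freeman sequence, so to the
stabilizer by finite nondegeneracy, which forces `𝔮 = ⨁ U p` (`IsAdaptedFamily.toSubmodule_eq`).
Then `𝔮^q` consists of the elements of `𝔮` whose components of degree `< q` lie in the stabilizer
(`IsAdaptedFamily.mem_freemanAux_iff`), and the three assertions can be read off componentwise.
-/

/-! ### Internal gradings -/

namespace CR

section Grading

variable {R V κ : Type*} [CommRing R] [AddCommGroup V] [Module R V] [DecidableEq κ]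
  {A : κ → Submodule R V}

/-- The projection of `V = ⨁ A p` onto the summand `A p`, as an endomorphism of `V`. -/
noncomputable def gradedProj (h : DirectSum.IsInternal A) (p : κ) : V →ₗ[R] V :=
  (A p).subtype ∘ₗ DirectSum.component R κ (fun i => A i) p ∘ₗ
    (LinearEquiv.ofBijective (DirectSum.coeLinearMap A) h).symm.toLinearMap

theorem gradedProj_mem (h : DirectSum.IsInternal A) (p : κ) (x : V) : gradedProj h p x ∈ A p :=
  Submodule.coe_mem _

theorem gradedProj_of_mem (h : DirectSum.IsInternal A) {p : κ} {x : V} (hx : x ∈ A p) (q : κ) :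
    gradedProj h q x = if p = q then x else 0 := by
  have : (LinearEquiv.ofBijective (DirectSum.coeLinearMap A) h).symm x
      = DirectSum.lof R κ (fun i => A i) p ⟨x, hx⟩ := by
    rw [LinearEquiv.symm_apply_eq]
    exact (DirectSum.coeLinearMap_lof A p ⟨x, hx⟩).symm
  simp only [gradedProj, LinearMap.comp_apply, LinearEquiv.coe_coe, this]
  split_ifs with hpq
  · subst hpq; simp [DirectSum.component.lof_self]
  · rw [DirectSum.component.of]; simp [hpq]

theorem gradedProj_self (h : DirectSum.IsInternal A) {p : κ} {x : V} (hx : x ∈ A p) :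
    gradedProj h p x = x := by
  rw [gradedProj_of_mem h hx, if_pos rfl]

theorem gradedProj_ne (h : DirectSum.IsInternal A) {p q : κ} {x : V} (hx : x ∈ A p) (hpq : p ≠ q) :
    gradedProj h q x = 0 := by
  rw [gradedProj_of_mem h hx, if_neg hpq]

theorem exists_sum_gradedProj (h : DirectSum.IsInternal A) (x : V) :
    ∃ s : Finset κ, x = ∑ p ∈ s, gradedProj h p x := by
  classical
  have hx : x ∈ ⨆ p, A p := by rw [h.submodule_iSup_eq_top]; trivial
  obtain ⟨f, hf, rfl⟩ := (Submodule.mem_iSup_iff_exists_finsupp A x).1 hx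
  refine ⟨f.support, ?_⟩
  refine Finset.sum_congr rfl fun p hp => ?_
  rw [Finsupp.sum, map_sum, Finset.sum_eq_single p]
  · rw [gradedProj_self h (hf p)]
  · intro q _ hq
    exact gradedProj_ne h (hf q) hq
  · intro hp'; exact absurd hp hp'

/-- A subspace contains `x` as soon as it contains all homogeneous components of `x`. -/
theorem mem_of_gradedProj_mem (h : DirectSum.IsInternal A) (W : Submodule R V) {x : V}
    (hx : ∀ p, gradedProj h p x ∈ W) : x ∈ W := by
  obtain ⟨s, hs⟩ := exists_sum_gradedProj h x
  rw [hs]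
  exact Submodule.sum_mem _ fun p _ => hx p

theorem eq_zero_of_gradedProj_eq_zero (h : DirectSum.IsInternal A) {x : V}
    (hx : ∀ p, gradedProj h p x = 0) : x = 0 := by
  have := mem_of_gradedProj_mem h ⊥ (x := x) (fun p => by simp [hx p])
  simpa using this

theorem linearMap_ext_of_isInternal {W : Type*} [AddCommGroup W] [Module R W]
    (h : DirectSum.IsInternal A) {f g : V →ₗ[R] W} (hfg : ∀ p, ∀ x ∈ A p, f x = g x) : f = g := by
  ext x
  have := mem_of_gradedProj_mem h (LinearMap.eqLocus f g) (x := x)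
    (fun p => hfg p _ (gradedProj_mem h p x))
  exact this

theorem gradedProj_map {V' : Type*} [AddCommGroup V'] [Module R V'] {B : κ → Submodule R V'}
    (hA : DirectSum.IsInternal A) (hB : DirectSum.IsInternal B) {f : V →ₗ[R] V'}
    (hf : ∀ p, ∀ x ∈ A p, f x ∈ B p) (p : κ) (x : V) :
    gradedProj hB p (f x) = f (gradedProj hA p x) := by
  refine LinearMap.congr_fun (f := gradedProj hB p ∘ₗ f) (g := f ∘ₗ gradedProj hA p)
    (linearMap_ext_of_isInternal hA fun j x hx => ?_) x
  rw [LinearMap.comp_apply, LinearMap.comp_apply, gradedProj_of_mem hA hx,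
    gradedProj_of_mem hB (hf j x hx)]
  split_ifs <;> simp

/-- A sum of subspaces of the homogeneous components is described componentwise. -/
theorem mem_iSup_iff_gradedProj_mem (h : DirectSum.IsInternal A) {S : κ → Submodule R V}
    (hS : ∀ p, S p ≤ A p) {x : V} : x ∈ ⨆ p, S p ↔ ∀ p, gradedProj h p x ∈ S p := by
  constructor
  · intro hx q
    have : (⨆ p, S p) ≤ (S q).comap (gradedProj h q) := by
      refine iSup_le fun p y hy => ?_
      rw [Submodule.mem_comap, gradedProj_of_mem h (hS p hy)]
      split_ifs with hpq
      · exact hpq ▸ hy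
      · exact zero_mem _
    exact this hx
  · intro hx
    exact mem_of_gradedProj_mem h _ fun p => (le_iSup S p) (hx p)

theorem mem_iSup_ge_iff {A : ℤ → Submodule R V} (h : DirectSum.IsInternal A) {q : ℤ} {x : V} :
    x ∈ ⨆ (j : ℤ) (_ : q ≤ j), A j ↔ ∀ j, j < q → gradedProj h j x = 0 := by
  rw [mem_iSup_iff_gradedProj_mem h (fun p => iSup_le fun _ => le_rfl)]
  refine forall_congr' fun j => ?_
  by_cases hj : q ≤ j
  · simp [hj, gradedProj_mem, not_lt.2 hj]
  · simp [hj, not_le.1 hj]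

/-- A homogeneous element vanishes if its degree lies outside a set of degrees in whose sum it
lies. -/
theorem eq_zero_of_mem_iSup_ge {A : ℤ → Submodule R V} (h : DirectSum.IsInternal A) {p q : ℤ}
    (hpq : p < q) {x : V} (hx : x ∈ A p) (hx' : x ∈ ⨆ (j : ℤ) (_ : q ≤ j), A j) : x = 0 := by
  rw [← gradedProj_self h hx]
  exact (mem_iSup_ge_iff h).1 hx' p hpq

/-- In a graded Lie algebra, the bracket with a homogeneous element shifts components. -/
theorem gradedProj_lie {L : Type*} [LieRing L] [LieAlgebra R L] {A : ℤ → Submodule R L}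
    (h : DirectSum.IsInternal A)
    (hA : ∀ p q : ℤ, ∀ ξ ∈ A p, ∀ η ∈ A q, ⁅ξ, η⁆ ∈ A (p + q)) {r : ℤ} {y : L} (hy : y ∈ A r)
    (x : L) (p q : ℤ) (hpq : r + p = q) : gradedProj h q ⁅y, x⁆ = ⁅y, gradedProj h p x⁆ := by
  have : (gradedProj h q) ∘ₗ (LieAlgebra.ad R L y : L →ₗ[R] L)
      = (LieAlgebra.ad R L y : L →ₗ[R] L) ∘ₗ gradedProj h p := by
    refine linearMap_ext_of_isInternal h fun j z hz => ?_
    change gradedProj h q ⁅y, z⁆ = ⁅y, gradedProj h p z⁆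
    rw [gradedProj_of_mem h hz, gradedProj_of_mem h (hA r j y hy z hz)]
    by_cases hj : j = p
    · subst hj; simp [hpq]
    · rw [if_neg hj, if_neg (by omega), lie_zero]
  exact LinearMap.congr_fun this x

end Grading

/-! ### Complexification and conjugation -/

section Complexification

-- On `ℂ ⊗ L` the bracket is to be the one of the Lie ring `ℂ ⊗ L`; the two instances for
-- extensions of scalars of modules give the same bracket in another syntactic form.
-- brackets on `ℂ ⊗ L` are those of its Lie ring structure, not of `ℂ ⊗ L` as a module over itself
attribute [-instance] LieAlgebra.ExtendScalars.instBracketTensorProduct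
  LieAlgebra.ExtendScalars.instLieRingModule

variable {V W : Type*} [AddCommGroup V] [Module ℝ V] [AddCommGroup W] [Module ℝ W]

/-- The real part `ℂ ⊗ V → V`. -/
noncomputable def rePart (V : Type*) [AddCommGroup V] [Module ℝ V] : (ℂ ⊗[ℝ] V) →ₗ[ℝ] V :=
  (TensorProduct.lid ℝ V).toLinearMap ∘ₗ LinearMap.rTensor V Complex.reLm

/-- The imaginary part `ℂ ⊗ V → V`. -/
noncomputable def imPart (V : Type*) [AddCommGroup V] [Module ℝ V] : (ℂ ⊗[ℝ] V) →ₗ[ℝ] V :=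
  (TensorProduct.lid ℝ V).toLinearMap ∘ₗ LinearMap.rTensor V Complex.imLm

@[simp] theorem rePart_tmul (z : ℂ) (v : V) : rePart V (z ⊗ₜ v) = z.re • v := by simp [rePart]

@[simp] theorem imPart_tmul (z : ℂ) (v : V) : imPart V (z ⊗ₜ v) = z.im • v := by simp [imPart]

@[simp] theorem conj_tmul (z : ℂ) (v : V) : conj V (z ⊗ₜ v) = (starRingEnd ℂ z) ⊗ₜ v := rfl

theorem rePart_smul (z : ℂ) (x : ℂ ⊗[ℝ] V) :
    rePart V (z • x) = z.re • rePart V x - z.im • imPart V x := by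
  induction x using TensorProduct.induction_on with
  | zero => simp
  | tmul w v => simp [TensorProduct.smul_tmul', sub_smul, mul_smul]
  | add x y hx hy => rw [smul_add, map_add, hx, hy, map_add, map_add]; module

theorem imPart_smul (z : ℂ) (x : ℂ ⊗[ℝ] V) :
    imPart V (z • x) = z.re • imPart V x + z.im • rePart V x := by
  induction x using TensorProduct.induction_on with
  | zero => simp
  | tmul w v => simp [TensorProduct.smul_tmul', add_smul, mul_smul]
  | add x y hx hy => rw [smul_add, map_add, hx, hy, map_add, map_add]; module

theorem eq_rePart_add_imPart (x : ℂ ⊗[ℝ] V) :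
    x = (1 : ℂ) ⊗ₜ[ℝ] rePart V x + Complex.I • ((1 : ℂ) ⊗ₜ[ℝ] imPart V x) := by
  induction x using TensorProduct.induction_on with
  | zero => simp
  | tmul z v =>
    simp only [rePart_tmul, imPart_tmul, TensorProduct.smul_tmul', ← TensorProduct.smul_tmul,
      ← TensorProduct.add_tmul]
    congr 1
    apply Complex.ext <;> simp
  | add x y hx hy =>
    conv_lhs => rw [hx, hy]
    simp only [map_add, TensorProduct.tmul_add, smul_add]
    abel

@[simp] theorem conj_conj (x : ℂ ⊗[ℝ] V) : conj V (conj V x) = x := by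
  induction x using TensorProduct.induction_on with
  | zero => simp
  | tmul z v => simp
  | add x y hx hy => rw [map_add, map_add, hx, hy]

theorem add_conj (x : ℂ ⊗[ℝ] V) : x + conj V x = (2 : ℂ) • ((1 : ℂ) ⊗ₜ[ℝ] rePart V x) := by
  conv_lhs => rw [eq_rePart_add_imPart x]
  simp only [map_add, map_smulₛₗ, conj_tmul, map_one, Complex.conj_I]
  module

theorem sub_conj (x : ℂ ⊗[ℝ] V) :
    x - conj V x = (2 * Complex.I) • ((1 : ℂ) ⊗ₜ[ℝ] imPart V x) := by
  conv_lhs => rw [eq_rePart_add_imPart x]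
  simp only [map_add, map_smulₛₗ, conj_tmul, map_one, Complex.conj_I]
  module

theorem rePart_baseChange (f : V →ₗ[ℝ] W) (x : ℂ ⊗[ℝ] V) :
    rePart W (f.baseChange ℂ x) = f (rePart V x) := by
  induction x using TensorProduct.induction_on with
  | zero => simp
  | tmul z v => simp
  | add x y hx hy => simp [map_add, hx, hy]

theorem imPart_baseChange (f : V →ₗ[ℝ] W) (x : ℂ ⊗[ℝ] V) :
    imPart W (f.baseChange ℂ x) = f (imPart V x) := by
  induction x using TensorProduct.induction_on with
  | zero => simp
  | tmul z v => simp
  | add x y hx hy => simp [map_add, hx, hy]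

theorem eq_zero_iff_rePart_imPart {x : ℂ ⊗[ℝ] V} : x = 0 ↔ rePart V x = 0 ∧ imPart V x = 0 := by
  constructor
  · rintro rfl; simp
  · rintro ⟨h1, h2⟩
    rw [eq_rePart_add_imPart x, h1, h2]; simp

theorem baseChange_injective {f : V →ₗ[ℝ] W} (hf : Function.Injective f) :
    Function.Injective (f.baseChange ℂ) := by
  rw [injective_iff_map_eq_zero]
  intro x hx
  obtain ⟨h1, h2⟩ := eq_zero_iff_rePart_imPart.1 hx
  rw [rePart_baseChange] at h1
  rw [imPart_baseChange] at h2
  exact eq_zero_iff_rePart_imPart.2 ⟨(injective_iff_map_eq_zero f).1 hf _ h1,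
    (injective_iff_map_eq_zero f).1 hf _ h2⟩

theorem mem_baseChange_iff {N : Submodule ℝ V} {x : ℂ ⊗[ℝ] V} :
    x ∈ N.baseChange ℂ ↔ rePart V x ∈ N ∧ imPart V x ∈ N := by
  constructor
  · intro hx
    rw [Submodule.baseChange_eq_span] at hx
    induction hx using Submodule.span_induction with
    | mem x hx =>
      obtain ⟨v, hv, rfl⟩ := hx
      simpa using hv
    | zero => simp
    | add x y _ _ hx hy =>
      exact ⟨by rw [map_add]; exact add_mem hx.1 hy.1, by rw [map_add]; exact add_mem hx.2 hy.2⟩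
    | smul z x _ hx =>
      rw [rePart_smul, imPart_smul]
      exact ⟨sub_mem (N.smul_mem _ hx.1) (N.smul_mem _ hx.2),
        add_mem (N.smul_mem _ hx.2) (N.smul_mem _ hx.1)⟩
  · rintro ⟨h1, h2⟩
    rw [eq_rePart_add_imPart x]
    exact add_mem (Submodule.tmul_mem_baseChange_of_mem 1 h1)
      (Submodule.smul_mem _ _ (Submodule.tmul_mem_baseChange_of_mem 1 h2))

theorem conj_mem_baseChange {N : Submodule ℝ V} {x : ℂ ⊗[ℝ] V} (hx : x ∈ N.baseChange ℂ) :
    conj V x ∈ N.baseChange ℂ := by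
  have h1 := congrArg (rePart V) (add_conj x)
  have h2 := congrArg (imPart V) (add_conj x)
  rw [mem_baseChange_iff] at hx ⊢
  simp only [map_add, rePart_smul, imPart_smul, rePart_tmul, imPart_tmul, Complex.re_ofNat,
    Complex.im_ofNat, Complex.one_re, Complex.one_im, one_smul, zero_smul, smul_zero, sub_zero,
    add_zero] at h1 h2
  rw [eq_sub_of_add_eq' h1, eq_sub_of_add_eq' h2]
  exact ⟨sub_mem (N.smul_mem _ hx.1) hx.1, sub_mem (zero_mem _) hx.2⟩

theorem conj_baseChange (f : V →ₗ[ℝ] W) (x : ℂ ⊗[ℝ] V) :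
    conj W (f.baseChange ℂ x) = f.baseChange ℂ (conj V x) := by
  induction x using TensorProduct.induction_on with
  | zero => simp
  | tmul z v => simp
  | add x y hx hy => simp only [map_add, hx, hy]

theorem mem_conjSubmodule_iff {N : Submodule ℂ (ℂ ⊗[ℝ] V)} {x : ℂ ⊗[ℝ] V} :
    x ∈ conjSubmodule N ↔ conj V x ∈ N := by
  constructor
  · rintro ⟨y, hy, rfl⟩
    rwa [conj_conj]
  · intro hx
    exact ⟨_, hx, conj_conj x⟩

theorem conj_mem_conjSubmodule_iff {N : Submodule ℂ (ℂ ⊗[ℝ] V)} {x : ℂ ⊗[ℝ] V} :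
    conj V x ∈ conjSubmodule N ↔ x ∈ N := by
  rw [mem_conjSubmodule_iff, conj_conj]

theorem conj_lie {L : Type*} [LieRing L] [LieAlgebra ℝ L] (x y : ℂ ⊗[ℝ] L) :
    conj L ⁅x, y⁆ = ⁅conj L x, conj L y⁆ := by
  induction x using TensorProduct.induction_on with
  | zero => simp
  | tmul z v =>
    induction y using TensorProduct.induction_on with
    | zero => simp
    | tmul w u => simp
    | add x y hx hy => simp only [map_add, lie_add, hx, hy]
  | add x y hx hy => simp only [map_add, add_lie, hx, hy]

/-- A complex subspace of `ℂ ⊗ V` that is stable under conjugation is the complexification of its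
real points. -/
theorem baseChange_realPoints {L : Type*} [LieRing L] [LieAlgebra ℝ L]
    (N : Submodule ℂ (ℂ ⊗[ℝ] L)) (hN : ∀ x ∈ N, conj L x ∈ N) :
    (realPoints N).baseChange ℂ = N := by
  apply le_antisymm
  · rw [Submodule.baseChange_eq_span, Submodule.span_le]
    rintro _ ⟨v, hv, rfl⟩
    exact hv
  · intro x hx
    refine mem_baseChange_iff.2 ⟨?_, ?_⟩
    · have : (1 : ℂ) ⊗ₜ[ℝ] rePart L x = (2 : ℂ)⁻¹ • (x + conj L x) := by
        rw [add_conj, smul_smul]; simp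
      change (1 : ℂ) ⊗ₜ[ℝ] rePart L x ∈ N
      rw [this]
      exact N.smul_mem _ (add_mem hx (hN x hx))
    · have : (1 : ℂ) ⊗ₜ[ℝ] imPart L x = (2 * Complex.I)⁻¹ • (x - conj L x) := by
        rw [sub_conj, smul_smul, inv_mul_cancel₀ (by simp), one_smul]
      change (1 : ℂ) ⊗ₜ[ℝ] imPart L x ∈ N
      rw [this]
      exact N.smul_mem _ (sub_mem hx (hN x hx))

theorem conj_mem_sup_conjSubmodule {N : Submodule ℂ (ℂ ⊗[ℝ] V)} {x : ℂ ⊗[ℝ] V}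
    (hx : x ∈ N ⊔ conjSubmodule N) : conj V x ∈ N ⊔ conjSubmodule N := by
  obtain ⟨y, hy, z, hz, rfl⟩ := Submodule.mem_sup.1 hx
  rw [map_add, add_comm]
  exact Submodule.add_mem_sup (mem_conjSubmodule_iff.1 hz) (conj_mem_conjSubmodule_iff.2 hy)

theorem baseChange_lie {L M : Type*} [LieRing L] [LieAlgebra ℝ L] [LieRing M] [LieAlgebra ℝ M]
    (f : L →ₗ⁅ℝ⁆ M) (x y : ℂ ⊗[ℝ] L) :
    (f : L →ₗ[ℝ] M).baseChange ℂ ⁅x, y⁆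
      = ⁅(f : L →ₗ[ℝ] M).baseChange ℂ x, (f : L →ₗ[ℝ] M).baseChange ℂ y⁆ := by
  induction x using TensorProduct.induction_on with
  | zero => simp
  | tmul z v =>
    induction y using TensorProduct.induction_on with
    | zero => simp
    | tmul w u => simp
    | add x y hx hy => simp only [map_add, lie_add, hx, hy]
  | add x y hx hy => simp only [map_add, add_lie, hx, hy]

/-- The complexification of a graded Lie algebra is graded. -/
theorem lie_mem_baseChange {L : Type*} [LieRing L] [LieAlgebra ℝ L] {A B C : Submodule ℝ L}
    (h : ∀ ξ ∈ A, ∀ η ∈ B, ⁅ξ, η⁆ ∈ C) :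
    ∀ ξ ∈ A.baseChange ℂ, ∀ η ∈ B.baseChange ℂ, ⁅ξ, η⁆ ∈ C.baseChange ℂ := by
  intro ξ hξ η hη
  rw [mem_baseChange_iff] at hξ hη
  rw [eq_rePart_add_imPart ξ, eq_rePart_add_imPart η]
  have key : ∀ a ∈ A, ∀ b ∈ B, ⁅(1 : ℂ) ⊗ₜ[ℝ] a, (1 : ℂ) ⊗ₜ[ℝ] b⁆ ∈ C.baseChange ℂ := by
    intro a ha b hb
    rw [LieAlgebra.ExtendScalars.bracket_tmul]
    exact Submodule.tmul_mem_baseChange_of_mem _ (h a ha b hb)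
  simp only [add_lie, lie_add, lie_smul, smul_lie]
  exact add_mem (add_mem (key _ hξ.1 _ hη.1) (Submodule.smul_mem _ _ (key _ hξ.2 _ hη.1)))
    (Submodule.smul_mem _ _ (add_mem (key _ hξ.1 _ hη.2)
      (Submodule.smul_mem _ _ (key _ hξ.2 _ hη.2))))

/-- The complexification of a sum of members of a grading is the sum of the complexified
members. -/
theorem mem_baseChange_iSup_ge_iff {A : ℤ → Submodule ℝ V} (h : DirectSum.IsInternal A) {q : ℤ}
    {x : ℂ ⊗[ℝ] V} : x ∈ (⨆ (j : ℤ) (_ : q ≤ j), A j).baseChange ℂ ↔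
      ∀ j, j < q → gradedProj (DirectSum.IsInternal.baseChange (S := ℂ) A h) j x = 0 := by
  have hproj : ∀ j, gradedProj (DirectSum.IsInternal.baseChange (S := ℂ) A h) j
      = (gradedProj h j).baseChange ℂ := by
    intro j
    refine linearMap_ext_of_isInternal (DirectSum.IsInternal.baseChange (S := ℂ) A h)
      fun p y hy => ?_
    rw [Submodule.baseChange_eq_span] at hy
    induction hy using Submodule.span_induction with
    | mem y hy =>
      obtain ⟨v, hv, rfl⟩ := hy
      rw [TensorProduct.mk_apply, gradedProj_of_mem (DirectSum.IsInternal.baseChange (S := ℂ) A h)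
        (p := p) (Submodule.tmul_mem_baseChange_of_mem 1 hv)]
      simp only [ LinearMap.baseChange_tmul, gradedProj_of_mem h hv]
      split_ifs <;> simp
    | zero => simp
    | add x y _ _ hx hy => rw [map_add, map_add, hx, hy]
    | smul z x _ hx => rw [map_smul, map_smul, hx]
  rw [mem_baseChange_iff, mem_iSup_ge_iff h, mem_iSup_ge_iff h, ← forall₂_and]
  refine forall₂_congr fun j _ => ?_
  rw [hproj, eq_zero_iff_rePart_imPart, rePart_baseChange, imPart_baseChange]

end Complexification

/-! ### Eigenspaces of a complex structure on a transitive graded Lie algebra -/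

section Eigenspaces

variable {L : Type*} [LieRing L] [LieAlgebra ℂ L]

/-- The data used of the complexified contact algebra: a grading in degrees `≥ -2` which is
transitive (nothing of degree `≥ -1` commutes with the negative part), with an element `J` of
degree `0` that acts trivially in degree `-2` and with square `-1` in degree `-1`. -/
structure IsTransitiveGraded (W : ℤ → Submodule ℂ L) (J : L) : Prop where
  lie_mem : ∀ p q : ℤ, ∀ ξ ∈ W p, ∀ η ∈ W q, ⁅ξ, η⁆ ∈ W (p + q)
  eq_zero : ∀ p < -2, ∀ ξ ∈ W p, ξ = 0
  transitive : ∀ p ≥ -1, ∀ ξ ∈ W p, (∀ v ∈ W (-1), ⁅v, ξ⁆ = 0) → (∀ v ∈ W (-2), ⁅v, ξ⁆ = 0) → ξ = 0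
  mem_zero : J ∈ W 0
  lie_neg_two : ∀ v ∈ W (-2), ⁅J, v⁆ = 0
  lie_lie_neg_one : ∀ v ∈ W (-1), ⁅J, ⁅J, v⁆⁆ = -v

/-- The sum of the eigenspaces of `ad J` in `W p` except the one of eigenvalue `-i(p+2)`. -/
noncomputable def nonMinimal (W : ℤ → Submodule ℂ L) (J : L) (p : ℤ) : Submodule ℂ L :=
  ⨆ (μ : ℂ) (_ : μ ≠ -((p : ℂ) + 2) * Complex.I),
    Module.End.eigenspace (LieAlgebra.ad ℂ L J) μ ⊓ W p

theorem lie_lie_of_eigen {J h f : L} {a b : ℂ} (hh : ⁅J, h⁆ = a • h) (hf : ⁅J, f⁆ = b • f) :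
    ⁅J, ⁅h, f⁆⁆ = (a + b) • ⁅h, f⁆ := by
  rw [leibniz_lie, hh, hf, smul_lie, lie_smul, add_smul]

/-- Bracketing with an eigenvector of `ad J` shifts polynomials in `ad J`. -/
theorem lie_aeval_ad {J h : L} {a : ℂ} (hh : ⁅J, h⁆ = a • h) (q : Polynomial ℂ) (f : L) :
    ⁅h, Polynomial.aeval (LieAlgebra.ad ℂ L J) q f⁆
      = Polynomial.aeval (LieAlgebra.ad ℂ L J) (q.comp (Polynomial.X - Polynomial.C a)) ⁅h, f⁆ := by
  rw [Polynomial.aeval_comp]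
  have hs : ∀ g : L, ⁅h, ⁅J, g⁆⁆ = (Polynomial.aeval (LieAlgebra.ad ℂ L J)
      (Polynomial.X - Polynomial.C a)) ⁅h, g⁆ := by
    intro g
    simp only [map_sub, Polynomial.aeval_X, Polynomial.aeval_C, LinearMap.sub_apply,
      LieAlgebra.ad_apply, Module.algebraMap_end_apply]
    rw [leibniz_lie J h g, hh, smul_lie]
    abel
  generalize Polynomial.aeval (LieAlgebra.ad ℂ L J) (Polynomial.X - Polynomial.C a) = B at hs ⊢
  induction q using Polynomial.induction_on generalizing f with
  | C z => simp
  | add q r hq hr => simp only [map_add, LinearMap.add_apply, lie_add, hq, hr]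
  | monomial n z ih =>
    rw [pow_succ, ← mul_assoc, map_mul (Polynomial.aeval (LieAlgebra.ad ℂ L J)),
      map_mul (Polynomial.aeval B), Module.End.mul_apply, Module.End.mul_apply, ih]
    simp only [Polynomial.aeval_X, LieAlgebra.ad_apply, hs]

namespace IsTransitiveGraded

variable {W : ℤ → Submodule ℂ L} {J : L}

theorem exists_eq_add (h : IsTransitiveGraded W J) {v : L} (hv : v ∈ W (-1)) :
    ∃ v₁ ∈ W (-1), ∃ v₂ ∈ W (-1), v = v₁ + v₂ ∧ ⁅J, v₁⁆ = Complex.I • v₁ ∧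
      ⁅J, v₂⁆ = (-Complex.I) • v₂ := by
  have hJv : ⁅J, v⁆ ∈ W (-1) := by simpa using h.lie_mem 0 (-1) J h.mem_zero v hv
  have hI : (Complex.I : ℂ) * Complex.I = -1 := Complex.I_mul_I
  refine ⟨(1 / 2 : ℂ) • (v - Complex.I • ⁅J, v⁆),
    Submodule.smul_mem _ _ (sub_mem hv (Submodule.smul_mem _ _ hJv)),
    (1 / 2 : ℂ) • (v + Complex.I • ⁅J, v⁆),
    Submodule.smul_mem _ _ (add_mem hv (Submodule.smul_mem _ _ hJv)), by module, ?_, ?_⟩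
  · rw [lie_smul, lie_sub, lie_smul, h.lie_lie_neg_one v hv]
    match_scalars
    · linear_combination (1 / 2 : ℂ) * hI
    · ring
  · rw [lie_smul, lie_add, lie_smul, h.lie_lie_neg_one v hv]
    match_scalars
    · linear_combination (1 / 2 : ℂ) * hI
    · ring

/-- To see that an element of degree `≥ -1` is zero, it suffices to bracket it with the
eigenvectors of `ad J` in the negative part. -/
theorem eq_zero_of_eigen_lie (h : IsTransitiveGraded W J) {p : ℤ} (hp : -1 ≤ p) {f : L}
    (hf : f ∈ W p)
    (h₁ : ∀ v ∈ W (-1), ⁅J, v⁆ = Complex.I • v → ⁅v, f⁆ = 0)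
    (h₂ : ∀ v ∈ W (-1), ⁅J, v⁆ = (-Complex.I) • v → ⁅v, f⁆ = 0)
    (h₃ : ∀ v ∈ W (-2), ⁅J, v⁆ = (0 : ℂ) • v → ⁅v, f⁆ = 0) : f = 0 := by
  refine h.transitive p hp f hf (fun v hv => ?_)
    (fun v hv => h₃ v hv (by rw [h.lie_neg_two v hv, zero_smul]))
  obtain ⟨v₁, hv₁, v₂, hv₂, rfl, e₁, e₂⟩ := h.exists_eq_add hv
  rw [add_lie, h₁ v₁ hv₁ e₁, h₂ v₂ hv₂ e₂, add_zero]

/-- The numbers `-i(p+2+c)` with `c > 0` are not eigenvalues of `ad J` in degree `p`. Bracketing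
with the eigenvectors in the negative part leads to such numbers in lower degree. -/
theorem eq_zero_of_eigen_lt (h : IsTransitiveGraded W J) (m : ℕ) :
    ∀ f ∈ W ((m : ℤ) - 2), ∀ c : ℝ, 0 < c → ⁅J, f⁆ = (-((m : ℂ) + c) * Complex.I) • f → f = 0 := by
  induction m using Nat.strong_induction_on with
  | _ m ih =>
    intro f hf c hc hJf
    -- `a` is the eigenvalue of an eigenvector `v` of degree `-d`
    have hlow : ∀ d : ℕ, ∀ a : ℂ, ∀ c' : ℝ, 0 < c' → 1 ≤ d →
        a + -((m : ℂ) + c) * Complex.I = -(((m : ℂ) - d) + c') * Complex.I →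
        ∀ v ∈ W (-(d : ℤ)), ⁅J, v⁆ = a • v → ⁅v, f⁆ = 0 := by
      intro d a c' hc' hd hac v hv hJv
      have hmem := h.lie_mem _ _ v hv f hf
      by_cases hdm : d ≤ m
      · refine ih (m - d) (by omega) _ ?_ c' hc' ?_
        · convert hmem using 2; push_cast [hdm]; ring
        · rw [lie_lie_of_eigen hJv hJf, hac]; push_cast [hdm]; rfl
      · exact h.eq_zero _ (by omega) _ hmem
    rcases Nat.eq_zero_or_pos m with rfl | hm
    · have h0 : ⁅J, f⁆ = 0 := h.lie_neg_two f (by simpa using hf)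
      rw [h0] at hJf
      refine (smul_eq_zero.1 hJf.symm).resolve_left ?_
      have : (c : ℂ) ≠ 0 := by exact_mod_cast hc.ne'
      simp [this]
    · refine h.eq_zero_of_eigen_lie (by omega) hf ?_ ?_ ?_
      · exact fun v hv => hlow 1 _ c hc le_rfl (by push_cast; ring) v hv
      · exact fun v hv => hlow 1 _ (c + 2) (by linarith) le_rfl (by push_cast; ring) v hv
      · exact fun v hv => hlow 2 _ (c + 2) (by linarith) (by norm_num) (by push_cast; ring) v hv

theorem aeval_ad_mem (h : IsTransitiveGraded W J) (q : Polynomial ℂ) {p : ℤ} {f : L}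
    (hf : f ∈ W p) : Polynomial.aeval (LieAlgebra.ad ℂ L J) q f ∈ W p := by
  induction q using Polynomial.induction_on generalizing f with
  | C z => simpa using Submodule.smul_mem _ z hf
  | add q r hq hr => rw [map_add]; exact add_mem (hq hf) (hr hf)
  | monomial n z ih =>
    rw [pow_succ, ← mul_assoc, map_mul, Module.End.mul_apply, Polynomial.aeval_X,
      LieAlgebra.ad_apply]
    exact ih (by simpa using h.lie_mem 0 p J h.mem_zero f hf)

/-- The polynomial with the simple roots `i(2k - m)`, `0 ≤ k ≤ m`. -/
noncomputable def weightPoly (m : ℕ) : Polynomial ℂ :=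
  ∏ k ∈ Finset.range (m + 1), (Polynomial.X - Polynomial.C ((2 * (k : ℂ) - m) * Complex.I))

theorem weightPoly_comp (m : ℕ) (a : ℂ) :
    (weightPoly m).comp (Polynomial.X - Polynomial.C a) = ∏ k ∈ Finset.range (m + 1),
      (Polynomial.X - Polynomial.C ((2 * (k : ℂ) - m) * Complex.I + a)) := by
  rw [weightPoly, Polynomial.prod_comp]
  refine Finset.prod_congr rfl fun k _ => ?_
  simp only [Polynomial.sub_comp, Polynomial.X_comp, Polynomial.C_comp, Polynomial.C_add]
  ring

/-- Every element of degree `m - 2` is annihilated by the polynomial with roots `i(2k - m)` in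
`ad J`: bracketing with an eigenvector of negative degree shifts the roots, and the shifted
polynomial is divisible by the one for the lower degree. -/
theorem aeval_weightPoly (h : IsTransitiveGraded W J) (m : ℕ) :
    ∀ f ∈ W ((m : ℤ) - 2), Polynomial.aeval (LieAlgebra.ad ℂ L J) (weightPoly m) f = 0 := by
  induction m using Nat.strong_induction_on with
  | _ m ih =>
    intro f hf
    have hstep : ∀ d : ℕ, ∀ a : ℂ, (∀ m', m = m' + d →
        weightPoly m' ∣ (weightPoly m).comp (Polynomial.X - Polynomial.C a)) → 1 ≤ d →
        ∀ v ∈ W (-(d : ℤ)), ⁅J, v⁆ = a • v →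
          ⁅v, Polynomial.aeval (LieAlgebra.ad ℂ L J) (weightPoly m) f⁆ = 0 := by
      intro d a hdvd hd v hv hJv
      have hmem := h.lie_mem _ _ v hv f hf
      rw [lie_aeval_ad hJv]
      by_cases hdm : d ≤ m
      · obtain ⟨m', rfl⟩ := Nat.exists_eq_add_of_le' hdm
        obtain ⟨q, hq⟩ := hdvd m' rfl
        rw [hq, mul_comm, map_mul, Module.End.mul_apply, ih m' (by omega), map_zero]
        convert hmem using 2; push_cast; ring
      · rw [h.eq_zero _ (by omega) _ hmem, map_zero]
    rcases Nat.eq_zero_or_pos m with rfl | hm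
    · have h0 : ⁅J, f⁆ = 0 := h.lie_neg_two f (by simpa using hf)
      simp [weightPoly, h0]
    · refine h.eq_zero_of_eigen_lie (by omega) (h.aeval_ad_mem _ hf)
        (hstep 1 _ ?_ le_rfl) (hstep 1 _ ?_ le_rfl) (hstep 2 _ ?_ (by norm_num))
      · rintro m' rfl
        rw [weightPoly_comp, Finset.prod_range_succ]
        refine Dvd.intro _ (congrArg (· * _) (Finset.prod_congr rfl fun k _ => ?_))
        push_cast; congr 2; ring
      · rintro m' rfl
        rw [weightPoly_comp, Finset.prod_range_succ']
        refine Dvd.intro _ (congrArg (· * _) (Finset.prod_congr rfl fun k _ => ?_))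
        push_cast; congr 2; ring
      · rintro m' rfl
        rw [weightPoly_comp, Finset.prod_range_succ', Finset.prod_range_succ, mul_assoc]
        refine Dvd.intro _ (congrArg (· * _) (Finset.prod_congr rfl fun k _ => ?_))
        push_cast; congr 2; ring

/-- The homogeneous components are spanned by eigenvectors of `ad J`. -/
theorem le_iSup_eigenspace (h : IsTransitiveGraded W J) {p : ℤ} :
    W p ≤ ⨆ μ : ℂ, Module.End.eigenspace (LieAlgebra.ad ℂ L J) μ ⊓ W p := by
  classical
  intro f hf
  by_cases hp : p < -2
  · rw [h.eq_zero p hp f hf]; exact zero_mem _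
  obtain ⟨m, hm⟩ := Int.eq_ofNat_of_zero_le (show 0 ≤ p + 2 by omega)
  obtain rfl : p = (m : ℤ) - 2 := by omega
  set A := LieAlgebra.ad ℂ L J with hA
  -- `f` is the sum of the values at `f` of the Lagrange basis polynomials in `ad J`
  let r : ℕ → ℂ := fun k => (2 * (k : ℂ) - m) * Complex.I
  have hr : Set.InjOn r (Finset.range (m + 1)) := by
    intro a _ b _ hab
    have := mul_right_cancel₀ Complex.I_ne_zero hab
    have h2 : (a : ℂ) = b := by linear_combination this / 2
    exact_mod_cast h2
  have hsum : f = ∑ k ∈ Finset.range (m + 1),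
      Polynomial.aeval A (Lagrange.basis (Finset.range (m + 1)) r k) f := by
    rw [← LinearMap.sum_apply, ← map_sum, Lagrange.sum_basis hr (by simp), map_one,
      Module.End.one_apply]
  rw [hsum]
  refine Submodule.sum_mem _ fun k hk => (le_iSup (fun μ => Module.End.eigenspace A μ ⊓ W _) (r k))
    ⟨?_, h.aeval_ad_mem _ hf⟩
  refine Module.End.mem_eigenspace_iff.2 (sub_eq_zero.1 ?_)
  have hdvd : weightPoly m ∣ (Polynomial.X - Polynomial.C (r k)) *
      (Lagrange.basis (Finset.range (m + 1)) r k * Polynomial.C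
        (∏ j ∈ (Finset.range (m + 1)).erase k, (r k - r j))) := by
    refine dvd_of_eq ?_
    rw [weightPoly, ← Finset.mul_prod_erase _ _ hk, Lagrange.basis, map_prod,
      ← Finset.prod_mul_distrib]
    congr 1
    refine Finset.prod_congr rfl fun j hj => ?_
    have hkj : r k - r j ≠ 0 := by
      rw [sub_ne_zero]
      exact fun e => (Finset.mem_erase.1 hj).1 (hr hk (Finset.mem_erase.1 hj).2 e).symm
    rw [Lagrange.basisDivisor, mul_right_comm, ← Polynomial.C_mul, inv_mul_cancel₀ hkj,
      Polynomial.C_1, one_mul]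
  have hne : (∏ j ∈ (Finset.range (m + 1)).erase k, (r k - r j)) ≠ 0 := by
    refine Finset.prod_ne_zero_iff.2 fun j hj => ?_
    rw [sub_ne_zero]
    exact fun e => (Finset.mem_erase.1 hj).1 (hr hk (Finset.mem_erase.1 hj).2 e).symm
  obtain ⟨q, hq⟩ := hdvd
  have h0 := congrArg (fun g => Polynomial.aeval A g f) hq
  simp only [mul_comm (weightPoly m), map_mul, Module.End.mul_apply] at h0
  rw [h.aeval_weightPoly m f hf, map_zero, Polynomial.aeval_C, Module.algebraMap_end_apply,
    map_smul, map_smul] at h0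
  have h1 := (smul_eq_zero.1 h0).resolve_left hne
  simpa using h1

theorem exists_nonMinimal_add (h : IsTransitiveGraded W J) {p : ℤ} {f : L} (hf : f ∈ W p) :
    ∃ g ∈ nonMinimal W J p, ∃ b ∈ W p, f = g + b ∧
      ⁅J, b⁆ = (-((p : ℂ) + 2) * Complex.I) • b := by
  have hle : (⨆ μ : ℂ, Module.End.eigenspace (LieAlgebra.ad ℂ L J) μ ⊓ W p) ≤ nonMinimal W J p ⊔
      (Module.End.eigenspace (LieAlgebra.ad ℂ L J) (-((p : ℂ) + 2) * Complex.I) ⊓ W p) := by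
    refine iSup_le fun μ => ?_
    by_cases hμ : μ = -((p : ℂ) + 2) * Complex.I
    · rw [hμ]; exact le_sup_right
    · exact le_sup_of_le_left (le_iSup₂_of_le μ hμ le_rfl)
  obtain ⟨g, hg, b, hb, rfl⟩ := Submodule.mem_sup.1 (hle (h.le_iSup_eigenspace hf))
  exact ⟨g, hg, b, hb.2, rfl, Module.End.mem_eigenspace_iff.1 hb.1⟩

theorem nonMinimal_le (p : ℤ) : nonMinimal W J p ≤ W p := iSup₂_le fun _ _ => inf_le_right

/-- The minimal eigenspace meets the sum of the others trivially. -/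
theorem eq_zero_of_mem_nonMinimal {p : ℤ} {f : L} (hf : f ∈ nonMinimal W J p)
    (hJf : ⁅J, f⁆ = (-((p : ℂ) + 2) * Complex.I) • f) : f = 0 := by
  have hd := (Module.End.eigenspaces_iSupIndep (LieAlgebra.ad ℂ L J)) (-((p : ℂ) + 2) * Complex.I)
  refine (Submodule.disjoint_def.1 hd) f (Module.End.mem_eigenspace_iff.2 hJf) ?_
  have hle : nonMinimal W J p ≤ ⨆ (μ : ℂ) (_ : μ ≠ -((p : ℂ) + 2) * Complex.I),
      Module.End.eigenspace (LieAlgebra.ad ℂ L J) μ := iSup₂_mono fun _ _ => inf_le_left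
  exact hle hf

theorem nonMinimal_eq_bot (h : IsTransitiveGraded W J) {p : ℤ} (hp : p ≤ -2) :
    nonMinimal W J p = ⊥ := by
  rw [eq_bot_iff]
  intro f hf
  rcases hp.lt_or_eq with hp | rfl
  · exact h.eq_zero p hp f (nonMinimal_le p hf)
  · refine eq_zero_of_mem_nonMinimal hf ?_
    rw [h.lie_neg_two f (nonMinimal_le _ hf)]; simp

theorem mem_nonMinimal_neg_one_iff (h : IsTransitiveGraded W J) {f : L} :
    f ∈ nonMinimal W J (-1) ↔ f ∈ W (-1) ∧ ⁅J, f⁆ = Complex.I • f := by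
  have hne : Complex.I ≠ -(((-1 : ℤ) : ℂ) + 2) * Complex.I := by
    intro e
    have := congrArg Complex.im e
    norm_num at this
  constructor
  · intro hf
    refine ⟨nonMinimal_le _ hf, ?_⟩
    obtain ⟨v₁, hv₁, v₂, hv₂, rfl, e₁, e₂⟩ := h.exists_eq_add (nonMinimal_le _ hf)
    have h1 : v₁ ∈ nonMinimal W J (-1) :=
      (le_iSup₂_of_le (f := fun (μ : ℂ) (_ : μ ≠ -(((-1 : ℤ) : ℂ) + 2) * Complex.I) =>
        Module.End.eigenspace (LieAlgebra.ad ℂ L J) μ ⊓ W (-1)) Complex.I hne le_rfl)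
        ⟨Module.End.mem_eigenspace_iff.2 e₁, hv₁⟩
    have h2 : v₂ = 0 := by
      refine eq_zero_of_mem_nonMinimal (p := -1) (W := W) (J := J)
        (by simpa using sub_mem hf h1) ?_
      rw [e₂]; congr 1; push_cast; ring
    rw [h2, add_zero, e₁]
  · rintro ⟨hf, e⟩
    exact (le_iSup₂_of_le (f := fun (μ : ℂ) (_ : μ ≠ -(((-1 : ℤ) : ℂ) + 2) * Complex.I) =>
        Module.End.eigenspace (LieAlgebra.ad ℂ L J) μ ⊓ W (-1)) Complex.I hne le_rfl)
        ⟨Module.End.mem_eigenspace_iff.2 e, hf⟩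

theorem lie_mem_nonMinimal (h : IsTransitiveGraded W J) {p : ℤ} {v f : L}
    (hv : v ∈ nonMinimal W J (-1)) (hf : f ∈ nonMinimal W J p) :
    ⁅v, f⁆ ∈ nonMinimal W J (p - 1) := by
  obtain ⟨hv, hJv⟩ := h.mem_nonMinimal_neg_one_iff.1 hv
  have hle : nonMinimal W J p ≤
      (nonMinimal W J (p - 1)).comap (LieAlgebra.ad ℂ L v : L →ₗ[ℂ] L) := by
    refine iSup₂_le fun μ hμ g hg => ?_
    have hJg := Module.End.mem_eigenspace_iff.1 hg.1
    refine (le_iSup₂_of_le (f := fun (μ : ℂ) (_ : μ ≠ -(((p - 1 : ℤ) : ℂ) + 2) * Complex.I) =>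
        Module.End.eigenspace (LieAlgebra.ad ℂ L J) μ ⊓ W (p - 1)) (Complex.I + μ) ?_ le_rfl)
        ⟨Module.End.mem_eigenspace_iff.2 (lie_lie_of_eigen hJv hJg), ?_⟩
    · intro e
      apply hμ
      push_cast at e
      linear_combination e
    · have := h.lie_mem _ _ v hv g hg.2
      rwa [neg_add_eq_sub] at this
  exact hle hf

/-- In degree `p ≥ -1`, the sum of the non-minimal eigenspaces consists of the elements which
bracket the holomorphic part of degree `-1` into the corresponding sum in degree `p - 1`. -/
theorem mem_nonMinimal_iff (h : IsTransitiveGraded W J) {p : ℤ} (hp : -1 ≤ p) {f : L}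
    (hf : f ∈ W p) :
    f ∈ nonMinimal W J p ↔ ∀ v ∈ nonMinimal W J (-1), ⁅v, f⁆ ∈ nonMinimal W J (p - 1) := by
  refine ⟨fun hf' v hv => h.lie_mem_nonMinimal hv hf', fun hlie => ?_⟩
  obtain ⟨g, hg, b, hb, rfl, hJb⟩ := h.exists_nonMinimal_add hf
  obtain ⟨m, hm⟩ := Int.eq_ofNat_of_zero_le (show 0 ≤ p + 1 by omega)
  -- it remains to see that the component `b` in the minimal eigenspace is zero
  suffices hb0 : b = 0 by rwa [hb0, add_zero]
  refine h.eq_zero_of_eigen_lie hp hb (fun v hv hJv => ?_) (fun v hv hJv => ?_)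
    (fun v hv hJv => ?_)
  · have hv' := h.mem_nonMinimal_neg_one_iff.2 ⟨hv, hJv⟩
    refine eq_zero_of_mem_nonMinimal (p := p - 1) (W := W) (J := J) ?_ ?_
    · have := sub_mem (hlie v hv') (h.lie_mem_nonMinimal hv' hg)
      rwa [lie_add, add_sub_cancel_left] at this
    · rw [lie_lie_of_eigen hJv hJb]; congr 1; push_cast; ring
  · refine h.eq_zero_of_eigen_lt m _ ?_ 2 (by norm_num) ?_
    · convert h.lie_mem _ _ v hv b hb using 2; omega
    · rw [lie_lie_of_eigen hJv hJb]
      obtain rfl : p = (m : ℤ) - 1 := by omega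
      congr 1; push_cast; ring
  · rcases Nat.eq_zero_or_pos m with rfl | hm0
    · exact h.eq_zero _ (by omega) _ (h.lie_mem _ _ v hv b hb)
    · refine h.eq_zero_of_eigen_lt (m - 1) _ ?_ 2 (by norm_num) ?_
      · convert h.lie_mem _ _ v hv b hb using 2; push_cast [hm0] at hm ⊢; omega
      · rw [lie_lie_of_eigen hJv hJb]
        obtain rfl : p = (m : ℤ) - 1 := by omega
        congr 1; push_cast [hm0]; ring

end IsTransitiveGraded

end Eigenspaces

/-! ### The contact algebra as a transitive graded Lie algebra -/

namespace ContactAlgebra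

open MvPolynomial

variable {n : ℕ}

/-- The weights of the variables: `2` for `t` and `1` for `x_i`, `y_i`. -/
def varWeight (n : ℕ) : Vars n → ℤ := fun v => Option.elim v (2 : ℤ) (fun _ => 1)

theorem mem_component_iff {f : MvPolynomial (Vars n) ℝ} {p : ℤ} :
    (f : ContactAlgebra n) ∈ component n p ↔ IsWeightedHomogeneous (varWeight n) f (p + 2) :=
  Iff.rfl

theorem weight_nonneg (d : Vars n →₀ ℕ) : 0 ≤ Finsupp.weight (varWeight n) d := by
  rw [Finsupp.weight_apply]
  refine Finset.sum_nonneg fun v _ => ?_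
  rcases v with _ | v <;> simp [varWeight]

theorem eq_zero_of_weight_neg {f : MvPolynomial (Vars n) ℝ} {m : ℤ} (hm : m < 0)
    (hf : IsWeightedHomogeneous (varWeight n) f m) : f = 0 := by
  ext d
  by_contra h
  have := hf h
  have := weight_nonneg d
  omega

/-- Euler's identity for the weighted homogeneous polynomials of the contact algebra. -/
theorem euler_identity {f : MvPolynomial (Vars n) ℝ} {m : ℤ}
    (hf : IsWeightedHomogeneous (varWeight n) f m) :
    2 * (X none * pderiv none f) + ∑ v : Fin n ⊕ Fin n, X (some v) * pderiv (some v) f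
      = (m : ℝ) • f := by
  by_cases hm : m < 0
  · simp [eq_zero_of_weight_neg hm hf]
  obtain ⟨k, rfl⟩ := Int.eq_ofNat_of_zero_le (not_lt.1 hm)
  have hf' : IsWeightedHomogeneous (fun v : Vars n => Option.elim v 2 (fun _ => 1)) f k := by
    intro d hd
    have h1 := hf hd
    rw [Finsupp.weight_apply, Finsupp.sum] at h1 ⊢
    have : ((∑ a ∈ d.support, d a • (Option.elim a 2 (fun _ => 1) : ℕ) : ℕ) : ℤ) = k := by
      rw [← h1, Nat.cast_sum]
      refine Finset.sum_congr rfl fun v _ => ?_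
      rcases v with _ | v <;> simp [varWeight]
    exact_mod_cast this
  have h2 := hf'.sum_weight_X_mul_pderiv
  rw [Fintype.sum_option] at h2
  simp only [Option.elim_none, Option.elim_some, one_smul, ← Nat.cast_smul_eq_nsmul ℝ k] at h2
  rw [← Nat.cast_smul_eq_nsmul (MvPolynomial (Vars n) ℝ) 2, smul_eq_mul] at h2
  simpa using h2

theorem isWeightedHomogeneous_pderiv_none {f : MvPolynomial (Vars n) ℝ} {m : ℤ}
    (hf : IsWeightedHomogeneous (varWeight n) f m) :
    IsWeightedHomogeneous (varWeight n) (pderiv none f) (m - 2) :=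
  hf.pderiv (by simp [varWeight])

theorem isWeightedHomogeneous_pderiv_some {f : MvPolynomial (Vars n) ℝ} {m : ℤ}
    (hf : IsWeightedHomogeneous (varWeight n) f m) (v : Fin n ⊕ Fin n) :
    IsWeightedHomogeneous (varWeight n) (pderiv (some v) f) (m - 1) :=
  hf.pderiv (by simp [varWeight])

theorem isWeightedHomogeneous_X_none :
    IsWeightedHomogeneous (varWeight n) (X none : MvPolynomial (Vars n) ℝ) 2 :=
  isWeightedHomogeneous_X ℝ (varWeight n) none

theorem isWeightedHomogeneous_X_some (v : Fin n ⊕ Fin n) :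
    IsWeightedHomogeneous (varWeight n) (X (some v) : MvPolynomial (Vars n) ℝ) 1 :=
  isWeightedHomogeneous_X ℝ (varWeight n) (some v)

theorem isWeightedHomogeneous_smul {f : MvPolynomial (Vars n) ℝ} {m : ℤ}
    (hf : IsWeightedHomogeneous (varWeight n) f m) (r : ℝ) :
    IsWeightedHomogeneous (varWeight n) (r • f) m :=
  Submodule.smul_mem (weightedHomogeneousSubmodule ℝ (varWeight n) m) r hf

theorem isWeightedHomogeneous_of_eq {f : MvPolynomial (Vars n) ℝ} {a b : ℤ}
    (hf : IsWeightedHomogeneous (varWeight n) f a) (h : a = b) :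
    IsWeightedHomogeneous (varWeight n) f b := h ▸ hf

theorem isWeightedHomogeneous_lap {f : MvPolynomial (Vars n) ℝ} {m : ℤ}
    (hf : IsWeightedHomogeneous (varWeight n) f m) :
    IsWeightedHomogeneous (varWeight n) (lap f) m := by
  have h2 : (2 : MvPolynomial (Vars n) ℝ) * f = (2 : ℝ) • f := by
    rw [two_mul, two_smul]
  rw [lap, h2]
  refine (isWeightedHomogeneous_smul hf 2).sub (IsWeightedHomogeneous.sum _ _ _ fun v _ => ?_)
  simpa using (isWeightedHomogeneous_X_some v).mul (isWeightedHomogeneous_pderiv_some hf v)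

theorem isWeightedHomogeneous_lagrange {f g : MvPolynomial (Vars n) ℝ} {k m : ℤ}
    (hf : IsWeightedHomogeneous (varWeight n) f k) (hg : IsWeightedHomogeneous (varWeight n) g m) :
    IsWeightedHomogeneous (varWeight n) (lagrange f g) (k + m - 2) := by
  refine ((isWeightedHomogeneous_of_eq ((isWeightedHomogeneous_lap hf).mul
    (isWeightedHomogeneous_pderiv_none hg)) (by ring)).sub
    (isWeightedHomogeneous_of_eq ((isWeightedHomogeneous_pderiv_none hf).mul
      (isWeightedHomogeneous_lap hg)) (by ring))).add
    (IsWeightedHomogeneous.sum _ _ _ fun i _ => ?_)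
  exact (isWeightedHomogeneous_of_eq ((isWeightedHomogeneous_pderiv_some hf _).mul
    (isWeightedHomogeneous_pderiv_some hg _)) (by ring)).sub
    (isWeightedHomogeneous_of_eq ((isWeightedHomogeneous_pderiv_some hf _).mul
      (isWeightedHomogeneous_pderiv_some hg _)) (by ring))

theorem lie_mem_component (p q : ℤ) : ∀ f ∈ component n p, ∀ g ∈ component n q,
    ⁅f, g⁆ ∈ component n (p + q) := by
  intro f hf g hg
  have := isWeightedHomogeneous_lagrange (mem_component_iff.1 hf) (mem_component_iff.1 hg)
  rw [show p + 2 + (q + 2) - 2 = p + q + 2 by ring] at this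
  exact this

theorem isInternal_component : DirectSum.IsInternal (component n) := by
  have h1 := (weightedDecomposition ℝ (varWeight n)).isInternal
  rw [DirectSum.isInternal_submodule_iff_iSupIndep_and_iSup_eq_top] at h1 ⊢
  refine ⟨h1.1.comp (f := fun p : ℤ => p + 2) (add_left_injective 2), ?_⟩
  rw [eq_top_iff]
  refine le_trans h1.2.ge (iSup_le fun m => ?_)
  refine le_trans (le_of_eq ?_) (le_iSup (component n) (m - 2))
  simp only [component, sub_add_cancel]
  rfl

/-- The generating function dual to a variable: `y_i` for `x_i` and `-x_i` for `y_i`. -/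
noncomputable def dualVar : Fin n ⊕ Fin n → MvPolynomial (Vars n) ℝ
  | Sum.inl i => X (some (Sum.inr i))
  | Sum.inr i => -X (some (Sum.inl i))

/-- The matrix of the standard symplectic form. -/
def stdForm : Fin n ⊕ Fin n → Fin n ⊕ Fin n → ℝ
  | Sum.inl i, Sum.inr j => if i = j then 1 else 0
  | Sum.inr i, Sum.inl j => if i = j then -1 else 0
  | _, _ => 0

theorem lagrange_dualVar (f : MvPolynomial (Vars n) ℝ) (v : Fin n ⊕ Fin n) :
    lagrange f (dualVar v) = pderiv (some v) f - dualVar v * pderiv none f := by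
  rcases v with i | i
  · rw [dualVar, lagrange_X_inr]; ring
  · rw [dualVar, ← neg_one_smul ℝ, lagrange_smul, lagrange_X_inl]
    simp only [neg_smul, one_smul]; ring

theorem lagrange_one (f : MvPolynomial (Vars n) ℝ) : lagrange f 1 = -2 * pderiv none f := by
  have h2 : lap (1 : MvPolynomial (Vars n) ℝ) = 2 := by simp [lap]
  simp [lagrange, poisson, h2]; ring

theorem pderiv_none_dualVar (v : Fin n ⊕ Fin n) : pderiv none (dualVar v) = 0 := by
  classical
  rcases v with i | i <;> simp [dualVar, pderiv_X]

theorem pderiv_some_dualVar (u v : Fin n ⊕ Fin n) :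
    pderiv (some u) (dualVar v) = C (-stdForm u v) := by
  classical
  rcases u with i | i <;> rcases v with j | j <;>
    simp [dualVar, stdForm, pderiv_X, Pi.single_apply] <;> split_ifs <;> simp_all

theorem isWeightedHomogeneous_dualVar (v : Fin n ⊕ Fin n) :
    IsWeightedHomogeneous (varWeight n) (dualVar v) 1 := by
  rcases v with i | i
  · exact isWeightedHomogeneous_X_some _
  · exact (isWeightedHomogeneous_X_some _).neg

theorem sum_X_mul_dualVar : ∑ v : Fin n ⊕ Fin n, X (some v) * dualVar v = 0 := by
  rw [Fintype.sum_sum_type, ← Finset.sum_add_distrib]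
  refine Finset.sum_eq_zero fun i _ => ?_
  simp only [dualVar]; ring

theorem one_mem_component : (1 : MvPolynomial (Vars n) ℝ) ∈ component n (-2) :=
  mem_component_iff.2 (isWeightedHomogeneous_one ℝ (varWeight n))

theorem dualVar_mem_component (v : Fin n ⊕ Fin n) : dualVar v ∈ component n (-1) :=
  mem_component_iff.2 (isWeightedHomogeneous_dualVar v)

/-- A polynomial of positive weight whose brackets with `1`, `x_i`, `y_i` vanish is zero. -/
theorem eq_zero_of_lagrange_eq_zero {f : MvPolynomial (Vars n) ℝ} {m : ℤ} (hm : m ≠ 0)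
    (hf : IsWeightedHomogeneous (varWeight n) f m) (h1 : lagrange 1 f = 0)
    (hd : ∀ v, lagrange (dualVar v) f = 0) : f = 0 := by
  have ht : pderiv none f = 0 := by
    rw [lagrange_skew, lagrange_one] at h1
    simpa using h1
  have hv : ∀ v, pderiv (some v) f = 0 := by
    intro v
    have := hd v
    rwa [lagrange_skew, lagrange_dualVar, ht, mul_zero, sub_zero, neg_eq_zero] at this
  have := euler_identity hf
  simp only [ht, hv, mul_zero, Finset.sum_const_zero, add_zero] at this
  exact (smul_eq_zero.1 this.symm).resolve_left (by exact_mod_cast hm)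

theorem component_eq_zero {p : ℤ} (hp : p < -2) {f : ContactAlgebra n} (hf : f ∈ component n p) :
    f = 0 :=
  eq_zero_of_weight_neg (by omega) (mem_component_iff.1 hf)

theorem component_transitive {p : ℤ} (hp : -1 ≤ p) {f : ContactAlgebra n}
    (hf : f ∈ component n p) (h1 : ∀ v ∈ component n (-1), ⁅v, f⁆ = 0)
    (h2 : ∀ v ∈ component n (-2), ⁅v, f⁆ = 0) : f = 0 := by
  exact eq_zero_of_lagrange_eq_zero (m := p + 2) (by omega) (mem_component_iff.1 hf)
    (h2 _ one_mem_component) fun v => h1 _ (dualVar_mem_component v)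

end ContactAlgebra

section

-- brackets on `ℂ ⊗ L` are those of its Lie ring structure, not of `ℂ ⊗ L` as a module over itself
attribute [-instance] LieAlgebra.ExtendScalars.instBracketTensorProduct
  LieAlgebra.ExtendScalars.instLieRingModule

/-- The complexification of the contact algebra, with a complex structure. -/
theorem ContactAlgebra.isTransitiveGraded {n : ℕ} {J : ContactAlgebra n}
    (hJ : ContactAlgebra.IsComplexStructure J) :
    IsTransitiveGraded (fun p => (ContactAlgebra.component n p).baseChange ℂ)
      ((1 : ℂ) ⊗ₜ[ℝ] J) where
  lie_mem p q := lie_mem_baseChange (ContactAlgebra.lie_mem_component p q)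
  eq_zero p hp ξ hξ := by
    obtain ⟨h1, h2⟩ := mem_baseChange_iff.1 hξ
    exact eq_zero_iff_rePart_imPart.2
      ⟨ContactAlgebra.component_eq_zero hp h1, ContactAlgebra.component_eq_zero hp h2⟩
  transitive p hp ξ hξ hv1 hv2 := by
    have key : ∀ v : ContactAlgebra n, ⁅(1 : ℂ) ⊗ₜ[ℝ] v, ξ⁆ = 0 →
        ⁅v, rePart _ ξ⁆ = 0 ∧ ⁅v, imPart _ ξ⁆ = 0 := by
      intro v hv
      rw [eq_rePart_add_imPart ξ, lie_add, lie_smul, LieAlgebra.ExtendScalars.bracket_tmul,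
        LieAlgebra.ExtendScalars.bracket_tmul, one_mul] at hv
      have h1 := congrArg (rePart _) hv
      have h2 := congrArg (imPart _) hv
      simp only [map_add, rePart_smul, imPart_smul, rePart_tmul, imPart_tmul] at h1 h2
      simpa using And.intro h1 h2
    obtain ⟨h1, h2⟩ := mem_baseChange_iff.1 hξ
    have hm : ∀ {q : ℤ} {v : ContactAlgebra n}, v ∈ ContactAlgebra.component n q →
        (1 : ℂ) ⊗ₜ[ℝ] v ∈ (ContactAlgebra.component n q).baseChange ℂ :=
      fun hv => Submodule.tmul_mem_baseChange_of_mem 1 hv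
    exact eq_zero_iff_rePart_imPart.2
      ⟨ContactAlgebra.component_transitive hp h1 (fun v hv => (key v (hv1 _ (hm hv))).1)
        (fun v hv => (key v (hv2 _ (hm hv))).1),
      ContactAlgebra.component_transitive hp h2 (fun v hv => (key v (hv1 _ (hm hv))).2)
        (fun v hv => (key v (hv2 _ (hm hv))).2)⟩
  mem_zero := Submodule.tmul_mem_baseChange_of_mem 1 hJ.mem_component
  lie_neg_two v hv := by
    obtain ⟨h1, h2⟩ := mem_baseChange_iff.1 hv
    rw [eq_rePart_add_imPart v, lie_add, lie_smul, LieAlgebra.ExtendScalars.bracket_tmul,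
      LieAlgebra.ExtendScalars.bracket_tmul, hJ.lie_eq_zero _ h1, hJ.lie_eq_zero _ h2]
    simp
  lie_lie_neg_one v hv := by
    obtain ⟨h1, h2⟩ := mem_baseChange_iff.1 hv
    conv_lhs => rw [eq_rePart_add_imPart v]
    conv_rhs => rw [eq_rePart_add_imPart v]
    rw [lie_add, lie_smul, lie_add, lie_smul]
    simp only [LieAlgebra.ExtendScalars.bracket_tmul, hJ.lie_lie_eq_neg _ h1,
      hJ.lie_lie_eq_neg _ h2, one_mul, TensorProduct.tmul_neg, smul_neg, neg_add]

end

/-! ### The Freeman sequence in terms of an adapted graded family -/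

section Freeman

-- brackets on `ℂ ⊗ L` are those of its Lie ring structure, not of `ℂ ⊗ L` as a module over itself
attribute [-instance] LieAlgebra.ExtendScalars.instBracketTensorProduct
  LieAlgebra.ExtendScalars.instLieRingModule

variable {𝔤 : Type*} [LieRing 𝔤] [LieAlgebra ℝ 𝔤] {𝔮 : LieSubalgebra ℂ (ℂ ⊗[ℝ] 𝔤)}
  {𝒢 : ℤ → Submodule ℝ 𝔤}

theorem mem_freemanAux_succ {m : ℕ} {ξ : ℂ ⊗[ℝ] 𝔤} :
    ξ ∈ freemanAux 𝔮 (m + 1) ↔ ξ ∈ freemanAux 𝔮 m ∧ ∀ η ∈ conjSubmodule 𝔮.toSubmodule,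
      ⁅ξ, η⁆ ∈ freemanAux 𝔮 m ⊔ conjSubmodule 𝔮.toSubmodule := Iff.rfl

theorem lie_mem_conjSubmodule {ξ η : ℂ ⊗[ℝ] 𝔤} (hξ : ξ ∈ conjSubmodule 𝔮.toSubmodule)
    (hη : η ∈ conjSubmodule 𝔮.toSubmodule) : ⁅ξ, η⁆ ∈ conjSubmodule 𝔮.toSubmodule := by
  rw [mem_conjSubmodule_iff] at *
  rw [conj_lie]
  exact 𝔮.lie_mem hξ hη

theorem baseChange_filtration_neg_one :
    (filtration 𝔮 (-1)).baseChange ℂ = qAddConj 𝔮 := by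
  have : filtration 𝔮 (-1) = realPoints (qAddConj 𝔮) := by simp [filtration, filtrationUp]
  rw [this]
  exact baseChange_realPoints _ fun x hx => conj_mem_sup_conjSubmodule hx

namespace IsTrivialFilteredDeformation

theorem isInternal_baseChange (h𝒢 : IsTrivialFilteredDeformation 𝔮 𝒢) :
    DirectSum.IsInternal fun p => (𝒢 p).baseChange ℂ :=
  DirectSum.IsInternal.baseChange (S := ℂ) 𝒢 h𝒢.isInternal

/-- The projection of `ℂ ⊗ 𝔤` onto the component of degree `p`. -/
noncomputable def cproj (h𝒢 : IsTrivialFilteredDeformation 𝔮 𝒢) (p : ℤ) :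
    (ℂ ⊗[ℝ] 𝔤) →ₗ[ℂ] (ℂ ⊗[ℝ] 𝔤) :=
  gradedProj h𝒢.isInternal_baseChange p

theorem cproj_mem (h𝒢 : IsTrivialFilteredDeformation 𝔮 𝒢) (p : ℤ) (x : ℂ ⊗[ℝ] 𝔤) :
    h𝒢.cproj p x ∈ (𝒢 p).baseChange ℂ :=
  gradedProj_mem h𝒢.isInternal_baseChange p x

theorem cproj_of_mem (h𝒢 : IsTrivialFilteredDeformation 𝔮 𝒢) {p : ℤ} {x : ℂ ⊗[ℝ] 𝔤}
    (hx : x ∈ (𝒢 p).baseChange ℂ) (q : ℤ) : h𝒢.cproj q x = if p = q then x else 0 :=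
  gradedProj_of_mem h𝒢.isInternal_baseChange hx q

theorem mem_of_cproj_mem (h𝒢 : IsTrivialFilteredDeformation 𝔮 𝒢) (W : Submodule ℂ (ℂ ⊗[ℝ] 𝔤))
    {x : ℂ ⊗[ℝ] 𝔤} (hx : ∀ p, h𝒢.cproj p x ∈ W) : x ∈ W :=
  mem_of_gradedProj_mem h𝒢.isInternal_baseChange W hx

theorem lie_mem_baseChange (h𝒢 : IsTrivialFilteredDeformation 𝔮 𝒢) (p q : ℤ) :
    ∀ ξ ∈ (𝒢 p).baseChange ℂ, ∀ η ∈ (𝒢 q).baseChange ℂ, ⁅ξ, η⁆ ∈ (𝒢 (p + q)).baseChange ℂ :=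
  CR.lie_mem_baseChange (h𝒢.lie_mem p q)

theorem cproj_lie (h𝒢 : IsTrivialFilteredDeformation 𝔮 𝒢) {r : ℤ} {y : ℂ ⊗[ℝ] 𝔤}
    (hy : y ∈ (𝒢 r).baseChange ℂ) (x : ℂ ⊗[ℝ] 𝔤) (p q : ℤ) (hpq : r + p = q) :
    h𝒢.cproj q ⁅y, x⁆ = ⁅y, h𝒢.cproj p x⁆ :=
  gradedProj_lie h𝒢.isInternal_baseChange h𝒢.lie_mem_baseChange hy x p q hpq

theorem cproj_conj (h𝒢 : IsTrivialFilteredDeformation 𝔮 𝒢) (p : ℤ) (x : ℂ ⊗[ℝ] 𝔤) :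
    h𝒢.cproj p (conj 𝔤 x) = conj 𝔤 (h𝒢.cproj p x) := by
  obtain ⟨s, hs⟩ := exists_sum_gradedProj h𝒢.isInternal_baseChange x
  rw [hs]
  simp only [map_sum]
  refine Finset.sum_congr rfl fun q _ => ?_
  have hq := h𝒢.cproj_mem q x
  rw [cproj] at hq
  rw [h𝒢.cproj_of_mem (conj_mem_baseChange hq), h𝒢.cproj_of_mem hq]
  split_ifs <;> simp

theorem mem_baseChange_filtration_iff (h𝒢 : IsTrivialFilteredDeformation 𝔮 𝒢) {p : ℤ}
    {x : ℂ ⊗[ℝ] 𝔤} :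
    x ∈ (filtration 𝔮 p).baseChange ℂ ↔ ∀ j, j < p → h𝒢.cproj j x = 0 := by
  rw [h𝒢.filtration_eq p]
  exact mem_baseChange_iSup_ge_iff h𝒢.isInternal

theorem mem_qAddConj_iff (h𝒢 : IsTrivialFilteredDeformation 𝔮 𝒢) {x : ℂ ⊗[ℝ] 𝔤} :
    x ∈ qAddConj 𝔮 ↔ ∀ j, j < -1 → h𝒢.cproj j x = 0 := by
  rw [← baseChange_filtration_neg_one, h𝒢.mem_baseChange_filtration_iff]

end IsTrivialFilteredDeformation

/-- A family `U p` of subspaces of the components `ℂ ⊗ 𝔤_p` with the properties of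
`(ℂ ⊗ 𝔤_p) ∩ 𝔲_p` from which the Freeman sequence of an aligned `𝔮` can be determined. -/
structure IsAdaptedFamily (𝔮 : LieSubalgebra ℂ (ℂ ⊗[ℝ] 𝔤)) (𝒢 : ℤ → Submodule ℝ 𝔤)
    (U : ℤ → Submodule ℂ (ℂ ⊗[ℝ] 𝔤)) : Prop where
  le : ∀ p, U p ≤ (𝒢 p).baseChange ℂ
  eq_bot : ∀ p ≤ -2, U p = ⊥
  mem_iff : ∀ p ≥ -1, ∀ ξ ∈ (𝒢 p).baseChange ℂ, ξ ∈ U p ↔ ∀ v ∈ U (-1), ⁅v, ξ⁆ ∈ U (p - 1)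
  eq_zero : ∀ ξ ∈ U (-1), conj 𝔤 ξ ∈ U (-1) → ξ = 0
  aligned : U (-1) ≤ 𝔮.toSubmodule

namespace IsAdaptedFamily

variable {U : ℤ → Submodule ℂ (ℂ ⊗[ℝ] 𝔤)}

/-- The family is closed under brackets, by the criterion `mem_iff` and the Jacobi identity. -/
theorem lie_mem (hU : IsAdaptedFamily 𝔮 𝒢 U) (h𝒢 : IsTrivialFilteredDeformation 𝔮 𝒢) {p q : ℤ}
    {ξ η : ℂ ⊗[ℝ] 𝔤} (hξ : ξ ∈ U p) (hη : η ∈ U q) : ⁅ξ, η⁆ ∈ U (p + q) := by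
  obtain ⟨N, hN⟩ : ∃ N : ℕ, p + q ≤ N - 3 := ⟨(p + q + 3).toNat, by omega⟩
  induction N generalizing p q ξ η with
  | zero =>
    rcases le_or_gt p (-2) with hp | hp
    · rw [hU.eq_bot p hp, Submodule.mem_bot] at hξ
      rw [hξ, zero_lie]; exact zero_mem _
    · rw [hU.eq_bot q (by push_cast at hN; omega), Submodule.mem_bot] at hη
      rw [hη, lie_zero]; exact zero_mem _
  | succ N ih =>
    rcases le_or_gt p (-2) with hp | hp
    · rw [hU.eq_bot p hp, Submodule.mem_bot] at hξ
      rw [hξ, zero_lie]; exact zero_mem _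
    rcases le_or_gt q (-2) with hq | hq
    · rw [hU.eq_bot q hq, Submodule.mem_bot] at hη
      rw [hη, lie_zero]; exact zero_mem _
    obtain rfl | hp' : p = -1 ∨ 0 ≤ p := by omega
    · have := (hU.mem_iff q (by omega) η (hU.le q hη)).1 hη ξ hξ
      rwa [sub_eq_neg_add] at this
    obtain rfl | hq' : q = -1 ∨ 0 ≤ q := by omega
    · have := (hU.mem_iff p (by omega) ξ (hU.le p hξ)).1 hξ η hη
      rw [← lie_skew]
      exact neg_mem (by rwa [sub_eq_add_neg] at this)
    rw [hU.mem_iff (p + q) (by omega) _ (h𝒢.lie_mem_baseChange p q _ (hU.le p hξ) _ (hU.le q hη))]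
    intro v hv
    have h1 := (hU.mem_iff p (by omega) ξ (hU.le p hξ)).1 hξ v hv
    have h2 := (hU.mem_iff q (by omega) η (hU.le q hη)).1 hη v hv
    have h3 := ih h1 hη (by push_cast at hN; omega)
    have h4 := ih hξ h2 (by push_cast at hN; omega)
    rw [leibniz_lie]
    refine add_mem ?_ ?_
    · convert h3 using 2; ring
    · convert h4 using 2; ring

theorem mem_iSup_iff (hU : IsAdaptedFamily 𝔮 𝒢 U) (h𝒢 : IsTrivialFilteredDeformation 𝔮 𝒢)
    {ξ : ℂ ⊗[ℝ] 𝔤} : ξ ∈ ⨆ p, U p ↔ ∀ p, h𝒢.cproj p ξ ∈ U p :=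
  mem_iSup_iff_gradedProj_mem h𝒢.isInternal_baseChange hU.le

theorem lie_mem_iSup (hU : IsAdaptedFamily 𝔮 𝒢 U) (h𝒢 : IsTrivialFilteredDeformation 𝔮 𝒢)
    {ξ η : ℂ ⊗[ℝ] 𝔤} (hξ : ξ ∈ ⨆ p, U p) (hη : η ∈ ⨆ p, U p) : ⁅ξ, η⁆ ∈ ⨆ p, U p := by
  induction hξ using Submodule.iSup_induction' with
  | zero => rw [zero_lie]; exact zero_mem _
  | add x y _ _ hx hy => rw [add_lie]; exact add_mem hx hy
  | mem p x hx =>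
    induction hη using Submodule.iSup_induction' with
    | zero => rw [lie_zero]; exact zero_mem _
    | add y z _ _ hy hz => rw [lie_add]; exact add_mem hy hz
    | mem q y hy => exact (le_iSup U (p + q)) (hU.lie_mem h𝒢 hx hy)

/-- Bracketing repeatedly with `U (-1) ⊆ 𝔮` shows that the homogeneous components of the elements
of `𝔮` belong to the family. -/
theorem cproj_mem (hU : IsAdaptedFamily 𝔮 𝒢 U) (h𝒢 : IsTrivialFilteredDeformation 𝔮 𝒢)
    {ξ : ℂ ⊗[ℝ] 𝔤} (hξ : ξ ∈ 𝔮) (p : ℤ) : h𝒢.cproj p ξ ∈ U p := by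
  have hlow : ∀ j < -1, ∀ η ∈ 𝔮, h𝒢.cproj j η ∈ U j := by
    intro j hj η hη
    have : η ∈ qAddConj 𝔮 := Submodule.mem_sup_left hη
    rw [h𝒢.mem_qAddConj_iff.1 this j hj]
    exact zero_mem _
  rcases lt_or_ge p (-1) with hp | hp
  · exact hlow p hp ξ hξ
  obtain ⟨m, hm⟩ := Int.eq_ofNat_of_zero_le (show 0 ≤ p + 2 by omega)
  obtain rfl : p = (m : ℤ) - 2 := by omega
  clear hm hp
  induction m generalizing ξ with
  | zero => exact hlow _ (by norm_num) ξ hξ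
  | succ m ih =>
    rw [hU.mem_iff _ (by push_cast; omega) _ (h𝒢.cproj_mem _ _)]
    intro v hv
    rw [← h𝒢.cproj_lie (hU.le _ hv) ξ _ (((m + 1 : ℕ) : ℤ) - 2 - 1) (by ring)]
    have := ih (𝔮.lie_mem (hU.aligned hv) hξ)
    convert this using 2 <;> (push_cast; ring_nf)

/-- By finite nondegeneracy, `𝔮` is the sum of the whole family. The elements of `𝔮` that lie in
the conjugate of this sum belong to every term of the Freeman sequence, hence to the stabilizer. -/
theorem toSubmodule_eq (hU : IsAdaptedFamily 𝔮 𝒢 U) (h𝒢 : IsTrivialFilteredDeformation 𝔮 𝒢)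
    {k : ℕ} (hk : IsNondegenerate 𝔮 k) : 𝔮.toSubmodule = ⨆ p, U p := by
  have hle : 𝔮.toSubmodule ≤ ⨆ p, U p := fun ξ hξ =>
    (hU.mem_iSup_iff h𝒢).2 (hU.cproj_mem h𝒢 hξ)
  refine le_antisymm hle ?_
  have hcle : conjSubmodule 𝔮.toSubmodule ≤ conjSubmodule (⨆ p, U p) := fun x hx =>
    mem_conjSubmodule_iff.2 (hle (mem_conjSubmodule_iff.1 hx))
  -- `conj (⨁ U p)` lies in `𝔮 + conj 𝔮`, and it contains `conj 𝔮`
  have hsum : conjSubmodule (⨆ p, U p) ≤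
      (𝔮.toSubmodule ⊓ conjSubmodule (⨆ p, U p)) ⊔ conjSubmodule 𝔮.toSubmodule := by
    intro y hy
    have hy' : y ∈ qAddConj 𝔮 := by
      rw [← conj_conj y]
      refine conj_mem_sup_conjSubmodule (h𝒢.mem_qAddConj_iff.2 fun j hj => ?_)
      have := (hU.mem_iSup_iff h𝒢).1 (mem_conjSubmodule_iff.1 hy) j
      rwa [hU.eq_bot j (by omega), Submodule.mem_bot] at this
    obtain ⟨a, ha, b, hb, rfl⟩ := Submodule.mem_sup.1 hy'
    refine Submodule.add_mem_sup ⟨ha, ?_⟩ hb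
    simpa using sub_mem hy (hcle hb)
  have hfreeman : ∀ m, 𝔮.toSubmodule ⊓ conjSubmodule (⨆ p, U p) ≤ freemanAux 𝔮 m := by
    intro m
    induction m with
    | zero => exact inf_le_left
    | succ m ih =>
      intro ξ hξ
      refine mem_freemanAux_succ.2 ⟨ih hξ, fun η hη => ?_⟩
      refine sup_le_sup_right ih _ (hsum ?_)
      rw [mem_conjSubmodule_iff, conj_lie]
      exact hU.lie_mem_iSup h𝒢 (mem_conjSubmodule_iff.1 hξ.2)
        (mem_conjSubmodule_iff.1 (hcle hη))
  have hstab : 𝔮.toSubmodule ⊓ conjSubmodule (⨆ p, U p) ≤ cstab 𝔮 := by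
    rw [← hk.freeman_eq]
    exact hfreeman _
  intro ξ hξ
  have h1 := hsum (conj_mem_conjSubmodule_iff.2 hξ)
  have h2 := (sup_le (hstab.trans inf_le_right) le_rfl :
    _ ≤ conjSubmodule 𝔮.toSubmodule) h1
  exact conj_mem_conjSubmodule_iff.1 h2

variable {k : ℕ}

theorem mem_iff_cproj_mem (hU : IsAdaptedFamily 𝔮 𝒢 U) (h𝒢 : IsTrivialFilteredDeformation 𝔮 𝒢)
    (hk : IsNondegenerate 𝔮 k) {ξ : ℂ ⊗[ℝ] 𝔤} : ξ ∈ 𝔮.toSubmodule ↔ ∀ p, h𝒢.cproj p ξ ∈ U p := by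
  rw [hU.toSubmodule_eq h𝒢 hk, hU.mem_iSup_iff h𝒢]

theorem mem_conj_iff_cproj_mem (hU : IsAdaptedFamily 𝔮 𝒢 U)
    (h𝒢 : IsTrivialFilteredDeformation 𝔮 𝒢) (hk : IsNondegenerate 𝔮 k) {ξ : ℂ ⊗[ℝ] 𝔤} :
    ξ ∈ conjSubmodule 𝔮.toSubmodule ↔ ∀ p, conj 𝔤 (h𝒢.cproj p ξ) ∈ U p := by
  rw [mem_conjSubmodule_iff, hU.mem_iff_cproj_mem h𝒢 hk]
  simp only [h𝒢.cproj_conj]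

theorem mem_cstab_iff (hU : IsAdaptedFamily 𝔮 𝒢 U) (h𝒢 : IsTrivialFilteredDeformation 𝔮 𝒢)
    (hk : IsNondegenerate 𝔮 k) {ξ : ℂ ⊗[ℝ] 𝔤} :
    ξ ∈ cstab 𝔮 ↔ ∀ p, h𝒢.cproj p ξ ∈ U p ∧ conj 𝔤 (h𝒢.cproj p ξ) ∈ U p := by
  rw [forall_and, ← hU.mem_iff_cproj_mem h𝒢 hk, ← hU.mem_conj_iff_cproj_mem h𝒢 hk]
  rfl

/-- A property of the components of `x` that holds for zero may be tested on homogeneous `x` in one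
degree only. -/
theorem _root_.CR.IsTrivialFilteredDeformation.forall_cproj_iff
    (h𝒢 : IsTrivialFilteredDeformation 𝔮 𝒢) {P : ℤ → (ℂ ⊗[ℝ] 𝔤) → Prop} (hP : ∀ p, P p 0)
    {j : ℤ} {x : ℂ ⊗[ℝ] 𝔤} (hx : x ∈ (𝒢 j).baseChange ℂ) :
    (∀ p, P p (h𝒢.cproj p x)) ↔ P j x := by
  constructor
  · intro h
    have := h j
    rwa [h𝒢.cproj_of_mem hx, if_pos rfl] at this
  · intro h p
    rw [h𝒢.cproj_of_mem hx]
    split_ifs with hjp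
    · exact hjp ▸ h
    · exact hP p

/-- In degrees `≥ -1`, the component `ℂ ⊗ 𝔤_j` is the sum of `U j` and its conjugate. -/
theorem exists_eq_add_of_mem_baseChange (hU : IsAdaptedFamily 𝔮 𝒢 U)
    (h𝒢 : IsTrivialFilteredDeformation 𝔮 𝒢) (hk : IsNondegenerate 𝔮 k) {j : ℤ} (hj : -1 ≤ j)
    {y : ℂ ⊗[ℝ] 𝔤} (hy : y ∈ (𝒢 j).baseChange ℂ) :
    ∃ a ∈ U j, ∃ b, conj 𝔤 b ∈ U j ∧ y = a + b := by
  have hy' : y ∈ qAddConj 𝔮 := by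
    refine h𝒢.mem_qAddConj_iff.2 fun i hi => ?_
    rw [h𝒢.cproj_of_mem hy, if_neg (by omega)]
  obtain ⟨a, ha, b, hb, hab⟩ := Submodule.mem_sup.1 hy'
  refine ⟨h𝒢.cproj j a, (hU.mem_iff_cproj_mem h𝒢 hk).1 ha j, h𝒢.cproj j b,
    (hU.mem_conj_iff_cproj_mem h𝒢 hk).1 hb j, ?_⟩
  rw [← map_add, hab, h𝒢.cproj_of_mem hy, if_pos rfl]

/-- The Freeman sequence: `𝔮^q` consists of the elements of `𝔮` whose components of degree `< q`
belong to the stabilizer. -/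
theorem mem_freemanAux_iff (hU : IsAdaptedFamily 𝔮 𝒢 U) (h𝒢 : IsTrivialFilteredDeformation 𝔮 𝒢)
    (hk : IsNondegenerate 𝔮 k) (m : ℕ) {ξ : ℂ ⊗[ℝ] 𝔤} :
    ξ ∈ freemanAux 𝔮 m ↔ ∀ p, h𝒢.cproj p ξ ∈ U p ∧
      (p < (m : ℤ) - 1 → conj 𝔤 (h𝒢.cproj p ξ) ∈ U p) := by
  induction m generalizing ξ with
  | zero =>
    change ξ ∈ 𝔮.toSubmodule ↔ _
    rw [hU.mem_iff_cproj_mem h𝒢 hk]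
    refine forall_congr' fun p => ⟨fun h => ⟨h, fun hp => ?_⟩, fun h => h.1⟩
    rw [hU.eq_bot p (by push_cast at hp; omega), Submodule.mem_bot] at h ⊢
    rw [h, map_zero]
  | succ m ih =>
    constructor
    · intro hξ p
      obtain ⟨hξm, hlie⟩ := mem_freemanAux_succ.1 hξ
      refine ⟨(ih.1 hξm p).1, fun hp => ?_⟩
      rcases lt_or_ge p ((m : ℤ) - 1) with hp' | hp'
      · exact (ih.1 hξm p).2 hp'
      rw [hU.mem_iff p (by omega) _ (conj_mem_baseChange (h𝒢.cproj_mem _ _))]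
      intro v hv
      have hv' : conj 𝔤 v ∈ conjSubmodule 𝔮.toSubmodule :=
        conj_mem_conjSubmodule_iff.2 (hU.aligned hv)
      obtain ⟨a, ha, b, hb, hab⟩ := Submodule.mem_sup.1 (hlie _ hv')
      have hcomp : ⁅v, conj 𝔤 (h𝒢.cproj p ξ)⁆
          = -(conj 𝔤 (h𝒢.cproj (p - 1) a) + conj 𝔤 (h𝒢.cproj (p - 1) b)) := by
        rw [← map_add, ← map_add, hab, ← lie_skew ξ, map_neg,
          h𝒢.cproj_lie (conj_mem_baseChange (hU.le _ hv)) ξ p (p - 1) (by ring), map_neg, neg_neg,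
          conj_lie, conj_conj]
      rw [hcomp]
      exact neg_mem (add_mem ((ih.1 ha (p - 1)).2 (by push_cast at hp; omega))
        ((hU.mem_conj_iff_cproj_mem h𝒢 hk).1 hb (p - 1)))
    · intro hξ
      refine mem_freemanAux_succ.2 ⟨ih.2 fun p => ⟨(hξ p).1, fun hp => (hξ p).2 (by
        push_cast; omega)⟩, fun η hη => ?_⟩
      -- the sum contains all components of degree at least `m - 1`
      have hhigh : ∀ j : ℤ, (m : ℤ) - 1 ≤ j → ∀ y ∈ (𝒢 j).baseChange ℂ,
          y ∈ freemanAux 𝔮 m ⊔ conjSubmodule 𝔮.toSubmodule := by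
        intro j hj y hy
        obtain ⟨a, ha, b, hb, rfl⟩ := hU.exists_eq_add_of_mem_baseChange h𝒢 hk (by omega) hy
        refine Submodule.add_mem_sup ?_ ?_
        · refine ih.2 ((h𝒢.forall_cproj_iff (P := fun p z => z ∈ U p ∧
            (p < (m : ℤ) - 1 → conj 𝔤 z ∈ U p)) (fun p => by simp) (hU.le _ ha)).2
            ⟨ha, fun h => by omega⟩)
        · rw [mem_conjSubmodule_iff, hU.toSubmodule_eq h𝒢 hk]
          exact (le_iSup U j) hb
      rw [← lie_skew]
      refine neg_mem (h𝒢.mem_of_cproj_mem ((freemanAux 𝔮 m ⊔ conjSubmodule 𝔮.toSubmodule).comap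
        (LieAlgebra.ad ℂ (ℂ ⊗[ℝ] 𝔤) η)) (x := ξ) fun p => ?_)
      rw [Submodule.mem_comap, LieAlgebra.ad_apply, ← lie_skew]
      refine neg_mem ?_
      -- components of `ξ` of degree less than `m` belong to `conj 𝔮`, the others are bracketed with
      -- elements of degree at least `-1`
      rcases lt_or_ge p (m : ℤ) with hp | hp
      · refine Submodule.mem_sup_right (lie_mem_conjSubmodule ?_ hη)
        rw [mem_conjSubmodule_iff, hU.toSubmodule_eq h𝒢 hk]
        exact (le_iSup U p) ((hξ p).2 (by push_cast; omega))
      · refine h𝒢.mem_of_cproj_mem ((freemanAux 𝔮 m ⊔ conjSubmodule 𝔮.toSubmodule).comap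
          (LieAlgebra.ad ℂ (ℂ ⊗[ℝ] 𝔤) (h𝒢.cproj p ξ))) (x := η) fun r => ?_
        rw [Submodule.mem_comap, LieAlgebra.ad_apply]
        rcases lt_or_ge r (-1) with hr | hr
        · have : η ∈ qAddConj 𝔮 := Submodule.mem_sup_right hη
          rw [h𝒢.mem_qAddConj_iff.1 this r hr, lie_zero]
          exact zero_mem _
        · exact hhigh (p + r) (by omega) _
            (h𝒢.lie_mem_baseChange p r _ (h𝒢.cproj_mem _ _) _ (h𝒢.cproj_mem _ _))

theorem mem_freeman_iff (hU : IsAdaptedFamily 𝔮 𝒢 U) (h𝒢 : IsTrivialFilteredDeformation 𝔮 𝒢)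
    (hk : IsNondegenerate 𝔮 k) {q : ℤ} (hq : -1 ≤ q) {ξ : ℂ ⊗[ℝ] 𝔤} :
    ξ ∈ freeman 𝔮 q ↔ ∀ p, h𝒢.cproj p ξ ∈ U p ∧
      (p < q → conj 𝔤 (h𝒢.cproj p ξ) ∈ U p) := by
  rw [freeman, hU.mem_freemanAux_iff h𝒢 hk, Int.toNat_of_nonneg (by omega), add_sub_cancel_right]

theorem cstab_le_freeman (hU : IsAdaptedFamily 𝔮 𝒢 U) (h𝒢 : IsTrivialFilteredDeformation 𝔮 𝒢)
    (hk : IsNondegenerate 𝔮 k) {q : ℤ} (hq : -1 ≤ q) : cstab 𝔮 ≤ freeman 𝔮 q := fun _ hξ =>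
  (hU.mem_freeman_iff h𝒢 hk hq).2 fun p =>
    ⟨((hU.mem_cstab_iff h𝒢 hk).1 hξ p).1, fun _ => ((hU.mem_cstab_iff h𝒢 hk).1 hξ p).2⟩

theorem mem_cstab_of_mem (hU : IsAdaptedFamily 𝔮 𝒢 U) (h𝒢 : IsTrivialFilteredDeformation 𝔮 𝒢)
    (hk : IsNondegenerate 𝔮 k) {p : ℤ} {ξ : ℂ ⊗[ℝ] 𝔤} (hξ : ξ ∈ (𝒢 p).baseChange ℂ) :
    ξ ∈ cstab 𝔮 ↔ ξ ∈ U p ∧ conj 𝔤 ξ ∈ U p := by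
  rw [hU.mem_cstab_iff h𝒢 hk]
  exact h𝒢.forall_cproj_iff (P := fun p z => z ∈ U p ∧ conj 𝔤 z ∈ U p) (fun p => by simp) hξ

theorem isDirectSumOf_cstab (hU : IsAdaptedFamily 𝔮 𝒢 U)
    (h𝒢 : IsTrivialFilteredDeformation 𝔮 𝒢) (hk : IsNondegenerate 𝔮 k) :
    IsDirectSumOf (cstab 𝔮) (fun p => (𝒢 p).baseChange ℂ ⊓ cstab 𝔮) := by
  refine ⟨h𝒢.isInternal_baseChange.submodule_iSupIndep.mono fun _ => inf_le_left, ?_⟩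
  ext ξ
  rw [mem_iSup_iff_gradedProj_mem h𝒢.isInternal_baseChange (fun _ => inf_le_left),
    hU.mem_cstab_iff h𝒢 hk]
  refine forall_congr' fun p => ?_
  rw [← hU.mem_cstab_of_mem h𝒢 hk (h𝒢.cproj_mem p ξ)]
  exact ⟨fun h => ⟨h𝒢.cproj_mem p ξ, h⟩, fun h => h.2⟩

theorem freeman_sup_conjSubmodule (hU : IsAdaptedFamily 𝔮 𝒢 U)
    (h𝒢 : IsTrivialFilteredDeformation 𝔮 𝒢) (hk : IsNondegenerate 𝔮 k) {p : ℤ} (hp : -1 ≤ p) :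
    freeman 𝔮 p ⊔ conjSubmodule (freeman 𝔮 p) =
      (filtration 𝔮 p).baseChange ℂ ⊔ cstab 𝔮 := by
  have hstab : ∀ x ∈ cstab 𝔮, conj 𝔤 x ∈ cstab 𝔮 := fun x hx =>
    ⟨mem_conjSubmodule_iff.1 hx.2, conj_mem_conjSubmodule_iff.2 hx.1⟩
  have hle : freeman 𝔮 p ≤ (filtration 𝔮 p).baseChange ℂ ⊔ cstab 𝔮 := by
    intro ξ hξ
    refine h𝒢.mem_of_cproj_mem _ fun j => ?_
    have hj := (hU.mem_freeman_iff h𝒢 hk hp).1 hξ j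
    rcases lt_or_ge j p with hjp | hjp
    · exact Submodule.mem_sup_right
        ((hU.mem_cstab_of_mem h𝒢 hk (h𝒢.cproj_mem j ξ)).2 ⟨hj.1, hj.2 hjp⟩)
    · refine Submodule.mem_sup_left (h𝒢.mem_baseChange_filtration_iff.2 fun i hi => ?_)
      rw [h𝒢.cproj_of_mem (h𝒢.cproj_mem j ξ), if_neg (by omega)]
  apply le_antisymm
  · refine sup_le hle fun ξ hξ => ?_
    obtain ⟨a, ha, b, hb, hab⟩ := Submodule.mem_sup.1 (hle (mem_conjSubmodule_iff.1 hξ))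
    rw [← conj_conj ξ, ← hab, map_add]
    exact Submodule.add_mem_sup (conj_mem_baseChange ha) (hstab b hb)
  · refine sup_le (fun ξ hξ => h𝒢.mem_of_cproj_mem _ fun j => ?_)
      ((hU.cstab_le_freeman h𝒢 hk hp).trans le_sup_left)
    rcases lt_or_ge j p with hjp | hjp
    · rw [h𝒢.mem_baseChange_filtration_iff.1 hξ j hjp]; exact zero_mem _
    · have hmem : ∀ a ∈ U j, a ∈ freeman 𝔮 p := fun a ha => (hU.mem_freeman_iff h𝒢 hk hp).2
        ((h𝒢.forall_cproj_iff (P := fun i z => z ∈ U i ∧ (i < p → conj 𝔤 z ∈ U i))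
          (fun i => by simp) (hU.le _ ha)).2 ⟨ha, fun h => by omega⟩)
      obtain ⟨a, ha, b, hb, hab⟩ := hU.exists_eq_add_of_mem_baseChange h𝒢 hk (by omega)
        (h𝒢.cproj_mem j ξ)
      rw [hab]
      exact Submodule.add_mem_sup (hmem a ha) (mem_conjSubmodule_iff.2 (hmem _ hb))

theorem isDirectSumOf_freeman (hU : IsAdaptedFamily 𝔮 𝒢 U)
    (h𝒢 : IsTrivialFilteredDeformation 𝔮 𝒢) (hk : IsNondegenerate 𝔮 k) {q : ℤ} (hq : 0 ≤ q) :
    IsDirectSumOf (freeman 𝔮 q) (fun p => if q ≤ p then U p else if 0 ≤ p then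
      (𝒢 p).baseChange ℂ ⊓ cstab 𝔮 else ⊥) := by
  have hle : ∀ p, (if q ≤ p then U p else if 0 ≤ p then
      (𝒢 p).baseChange ℂ ⊓ cstab 𝔮 else ⊥) ≤ (𝒢 p).baseChange ℂ := by
    intro p
    split_ifs
    · exact hU.le p
    · exact inf_le_left
    · exact bot_le
  refine ⟨h𝒢.isInternal_baseChange.submodule_iSupIndep.mono hle, ?_⟩
  ext ξ
  rw [mem_iSup_iff_gradedProj_mem h𝒢.isInternal_baseChange hle,
    hU.mem_freeman_iff h𝒢 hk (by omega)]
  refine forall_congr' fun p => ?_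
  change _ ↔ h𝒢.cproj p ξ ∈ _
  have hp := h𝒢.cproj_mem p ξ
  split_ifs with h1 h2
  · exact ⟨fun h => h.1, fun h => ⟨h, fun h' => by omega⟩⟩
  · rw [Submodule.mem_inf, hU.mem_cstab_of_mem h𝒢 hk hp]
    exact ⟨fun h => ⟨hp, h.1, h.2 (by omega)⟩, fun h => ⟨h.2.1, fun _ => h.2.2⟩⟩
  · rw [Submodule.mem_bot]
    refine ⟨fun h => ?_, fun h => by simp [h]⟩
    obtain rfl | hp' : p = -1 ∨ p ≤ -2 := by omega
    · exact hU.eq_zero _ h.1 (h.2 (by omega))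
    · simpa [hU.eq_bot p hp'] using h.1

end IsAdaptedFamily

end Freeman

/-! ### Aligned realizations in the contact algebra -/

section Realization

-- brackets on `ℂ ⊗ L` are those of its Lie ring structure, not of `ℂ ⊗ L` as a module over itself
attribute [-instance] LieAlgebra.ExtendScalars.instBracketTensorProduct
  LieAlgebra.ExtendScalars.instLieRingModule

variable {𝔤 : Type*} [LieRing 𝔤] [LieAlgebra ℝ 𝔤] {𝔮 : LieSubalgebra ℂ (ℂ ⊗[ℝ] 𝔤)}
  {𝒢 : ℤ → Submodule ℝ 𝔤} {n : ℕ} {J : ContactAlgebra n} {ι : 𝔤 →ₗ⁅ℝ⁆ ContactAlgebra n}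

theorem ContactAlgebra.univComponent_eq_nonMinimal (J : ContactAlgebra n) (p : ℤ) :
    ContactAlgebra.univComponent J p = nonMinimal
      (fun p => (ContactAlgebra.component n p).baseChange ℂ) ((1 : ℂ) ⊗ₜ[ℝ] J) p := rfl

/-- The complexified component `ℂ ⊗ 𝔤_p` intersected with `𝔲_p`. -/
noncomputable def adaptedFamily (𝒢 : ℤ → Submodule ℝ 𝔤) (J : ContactAlgebra n)
    (ι : 𝔤 →ₗ⁅ℝ⁆ ContactAlgebra n) (p : ℤ) : Submodule ℂ (ℂ ⊗[ℝ] 𝔤) :=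
  (𝒢 p).baseChange ℂ ⊓ hatInter ι (ContactAlgebra.univComponent J p)

theorem mem_adaptedFamily_iff {p : ℤ} {ξ : ℂ ⊗[ℝ] 𝔤} (hξ : ξ ∈ (𝒢 p).baseChange ℂ) :
    ξ ∈ adaptedFamily 𝒢 J ι p ↔
      (ι : 𝔤 →ₗ[ℝ] ContactAlgebra n).baseChange ℂ ξ ∈ ContactAlgebra.univComponent J p :=
  ⟨fun h => h.2, fun h => ⟨hξ, h⟩⟩

/-- Conjugation exchanges the eigenspaces `±i` of a complex structure. -/
theorem eq_zero_of_conj_eigen {L : Type*} [LieRing L] [LieAlgebra ℝ L] {J : L} {x : ℂ ⊗[ℝ] L}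
    (h1 : ⁅(1 : ℂ) ⊗ₜ[ℝ] J, x⁆ = Complex.I • x)
    (h2 : ⁅(1 : ℂ) ⊗ₜ[ℝ] J, conj L x⁆ = Complex.I • conj L x) : x = 0 := by
  have h3 := congrArg (conj L) h2
  rw [conj_lie, conj_conj, conj_tmul, map_one, h1, map_smulₛₗ, conj_conj, Complex.conj_I] at h3
  have h4 : (2 * Complex.I) • x = 0 := by
    rw [two_mul, add_smul]
    nth_rewrite 1 [h3]
    rw [neg_smul, neg_add_cancel]
  exact (smul_eq_zero.1 h4).resolve_left (by simp)

namespace IsContactRealization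

theorem baseChange_mem (hR : IsContactRealization 𝔮 𝒢 J ι) {p : ℤ} {ξ : ℂ ⊗[ℝ] 𝔤}
    (hξ : ξ ∈ (𝒢 p).baseChange ℂ) : (ι : 𝔤 →ₗ[ℝ] ContactAlgebra n).baseChange ℂ ξ ∈
      (ContactAlgebra.component n p).baseChange ℂ := by
  rw [mem_baseChange_iff, rePart_baseChange, imPart_baseChange]
  obtain ⟨h1, h2⟩ := mem_baseChange_iff.1 hξ
  exact ⟨hR.map_le p ⟨_, h1, rfl⟩, hR.map_le p ⟨_, h2, rfl⟩⟩

theorem exists_baseChange_eq (hR : IsContactRealization 𝔮 𝒢 J ι)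
    {w : ℂ ⊗[ℝ] ContactAlgebra n} (hw : w ∈ (ContactAlgebra.component n (-1)).baseChange ℂ) :
    ∃ ξ ∈ (𝒢 (-1)).baseChange ℂ, (ι : 𝔤 →ₗ[ℝ] ContactAlgebra n).baseChange ℂ ξ = w := by
  obtain ⟨h1, h2⟩ := mem_baseChange_iff.1 hw
  rw [← hR.map_neg_one] at h1 h2
  obtain ⟨a, ha, ha'⟩ := h1
  obtain ⟨b, hb, hb'⟩ := h2
  refine ⟨(1 : ℂ) ⊗ₜ[ℝ] a + Complex.I • ((1 : ℂ) ⊗ₜ[ℝ] b),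
    add_mem (Submodule.tmul_mem_baseChange_of_mem 1 ha)
      (Submodule.smul_mem _ _ (Submodule.tmul_mem_baseChange_of_mem 1 hb)), ?_⟩
  rw [map_add, map_smul, LinearMap.baseChange_tmul, LinearMap.baseChange_tmul, ha', hb',
    ← eq_rePart_add_imPart]

theorem isAdaptedFamily (hR : IsContactRealization 𝔮 𝒢 J ι) (hA : IsAligned 𝔮 J ι)
    (h𝒢 : IsTrivialFilteredDeformation 𝔮 𝒢) :
    IsAdaptedFamily 𝔮 𝒢 (adaptedFamily 𝒢 J ι) where
  le p := inf_le_left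
  eq_bot p hp := by
    rw [eq_bot_iff]
    intro ξ hξ
    have h1 := (mem_adaptedFamily_iff hξ.1).1 hξ
    rw [ContactAlgebra.univComponent_eq_nonMinimal,
      (ContactAlgebra.isTransitiveGraded hR.isComplexStructure).nonMinimal_eq_bot hp,
      Submodule.mem_bot] at h1
    exact (injective_iff_map_eq_zero _).1 (baseChange_injective hR.injective) ξ h1
  mem_iff p hp ξ hξ := by
    have hT := ContactAlgebra.isTransitiveGraded hR.isComplexStructure
    rw [mem_adaptedFamily_iff hξ, ContactAlgebra.univComponent_eq_nonMinimal,
      hT.mem_nonMinimal_iff hp (hR.baseChange_mem hξ)]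
    have hv : ∀ v ∈ (𝒢 (-1)).baseChange ℂ, ⁅v, ξ⁆ ∈ adaptedFamily 𝒢 J ι (p - 1) ↔
        ⁅(ι : 𝔤 →ₗ[ℝ] ContactAlgebra n).baseChange ℂ v,
          (ι : 𝔤 →ₗ[ℝ] ContactAlgebra n).baseChange ℂ ξ⁆ ∈
            ContactAlgebra.univComponent J (p - 1) := by
      intro v hv
      have := h𝒢.lie_mem_baseChange (-1) p v hv ξ hξ
      rw [neg_add_eq_sub] at this
      rw [mem_adaptedFamily_iff this, baseChange_lie]
    constructor
    · intro h v hv'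
      exact (hv v hv'.1).2 (h _ hv'.2)
    · intro h w hw
      obtain ⟨v, hv', rfl⟩ := hR.exists_baseChange_eq (IsTransitiveGraded.nonMinimal_le _ hw)
      exact (hv v hv').1 (h v ⟨hv', hw⟩)
  eq_zero ξ h1 h2 := by
    have hT := ContactAlgebra.isTransitiveGraded hR.isComplexStructure
    have e1 := (hT.mem_nonMinimal_neg_one_iff.1 h1.2).2
    have e2 := (hT.mem_nonMinimal_neg_one_iff.1 h2.2).2
    rw [← conj_baseChange] at e2
    exact (injective_iff_map_eq_zero _).1 (baseChange_injective hR.injective) ξ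
      (eq_zero_of_conj_eigen e1 e2)
  aligned := inf_le_right.trans hA

theorem mem_hatInter_univ_iff (hR : IsContactRealization 𝔮 𝒢 J ι)
    (h𝒢 : IsTrivialFilteredDeformation 𝔮 𝒢) {ξ : ℂ ⊗[ℝ] 𝔤} :
    ξ ∈ hatInter ι (ContactAlgebra.univ J) ↔ ∀ p, h𝒢.cproj p ξ ∈ adaptedFamily 𝒢 J ι p := by
  have hT := ContactAlgebra.isTransitiveGraded hR.isComplexStructure
  have hint := DirectSum.IsInternal.baseChange (S := ℂ) _
    (ContactAlgebra.isInternal_component (n := n))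
  have huniv : ContactAlgebra.univ J = ⨆ p, ContactAlgebra.univComponent J p := by
    refine le_antisymm (iSup_mono fun p => iSup_le fun _ => le_rfl) (iSup_le fun p => ?_)
    by_cases hp : -1 ≤ p
    · exact le_iSup₂_of_le p hp le_rfl
    · rw [ContactAlgebra.univComponent_eq_nonMinimal, hT.nonMinimal_eq_bot (by omega)]
      exact bot_le
  change (ι : 𝔤 →ₗ[ℝ] ContactAlgebra n).baseChange ℂ ξ ∈ ContactAlgebra.univ J ↔ _
  rw [huniv, mem_iSup_iff_gradedProj_mem hint
    (S := fun p => ContactAlgebra.univComponent J p) IsTransitiveGraded.nonMinimal_le]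
  refine forall_congr' fun p => ?_
  rw [gradedProj_map h𝒢.isInternal_baseChange hint fun p x hx => hR.baseChange_mem hx,
    mem_adaptedFamily_iff (h𝒢.cproj_mem p ξ)]
  rfl

theorem cstab_eq (hR : IsContactRealization 𝔮 𝒢 J ι) (hA : IsAligned 𝔮 J ι)
    (h𝒢 : IsTrivialFilteredDeformation 𝔮 𝒢) {k : ℕ} (hk : IsNondegenerate 𝔮 k) :
    cstab 𝔮 = hatInter ι (ContactAlgebra.univ J ⊓ conjSubmodule (ContactAlgebra.univ J)) := by
  have hU := hR.isAdaptedFamily hA h𝒢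
  ext ξ
  have h1 : ξ ∈ hatInter ι (ContactAlgebra.univ J ⊓ conjSubmodule (ContactAlgebra.univ J)) ↔
      ξ ∈ hatInter ι (ContactAlgebra.univ J) ∧ conj 𝔤 ξ ∈ hatInter ι (ContactAlgebra.univ J) := by
    change _ ∧ _ ↔ _ ∧ (ι : 𝔤 →ₗ[ℝ] ContactAlgebra n).baseChange ℂ (conj 𝔤 ξ) ∈
      ContactAlgebra.univ J
    rw [← conj_baseChange]
    exact and_congr_right fun _ => mem_conjSubmodule_iff
  rw [h1, hR.mem_hatInter_univ_iff h𝒢, hR.mem_hatInter_univ_iff h𝒢, hU.mem_cstab_iff h𝒢 hk,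
    forall_and]
  simp only [h𝒢.cproj_conj]

end IsContactRealization

end Realization

/-! ### Embedding a graded Lie algebra into the contact algebra -/

namespace ContactAlgebra

open MvPolynomial

variable {n : ℕ}

/-- Poincaré lemma for weighted homogeneous polynomials: a closed system of prescribed partial
derivatives of nonzero total weight `m` has the primitive given by Euler's identity. -/
theorem pderiv_primitive {m : ℤ} (hm : m ≠ 0) {T : MvPolynomial (Vars n) ℝ}
    {F : Fin n ⊕ Fin n → MvPolynomial (Vars n) ℝ}
    (hT : IsWeightedHomogeneous (varWeight n) T (m - 2))
    (hF : ∀ v, IsWeightedHomogeneous (varWeight n) (F v) (m - 1))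
    (hTF : ∀ v, pderiv none (F v) = pderiv (some v) T)
    (hFF : ∀ u v, pderiv (some u) (F v) = pderiv (some v) (F u)) :
    pderiv none ((m : ℝ)⁻¹ • (2 * (X none * T) + ∑ v, X (some v) * F v)) = T ∧
    ∀ u, pderiv (some u) ((m : ℝ)⁻¹ • (2 * (X none * T) + ∑ v, X (some v) * F v)) = F u := by
  classical
  have hm' : (m : ℝ) ≠ 0 := by exact_mod_cast hm
  have h2 : ∀ i : Vars n, pderiv i (2 : MvPolynomial (Vars n) ℝ) = 0 := fun i => by
    simpa using Derivation.map_natCast (pderiv (R := ℝ) i) 2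
  have hXt : ∀ v, pderiv none (X (some v) : MvPolynomial (Vars n) ℝ) = 0 := fun v =>
    pderiv_X_of_ne (by simp)
  have hXn : ∀ u, pderiv (some u) (X none : MvPolynomial (Vars n) ℝ) = 0 := fun u =>
    pderiv_X_of_ne (by simp)
  have hX : ∀ u v, pderiv (some u) (X (some v) : MvPolynomial (Vars n) ℝ)
      = if v = u then 1 else 0 := fun u v => by
    simp [pderiv_X, Pi.single_apply]
  constructor
  · have e := euler_identity hT
    rw [Derivation.map_smul, inv_smul_eq_iff₀ hm', map_add, map_sum]
    simp only [Derivation.leibniz, smul_eq_mul, h2, mul_zero, add_zero, pderiv_X_self, mul_one,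
      hTF, hXt]
    push_cast at e
    rw [sub_smul, two_smul] at e
    linear_combination e
  · intro u
    have e := euler_identity (hF u)
    rw [Derivation.map_smul, inv_smul_eq_iff₀ hm', map_add, map_sum]
    simp only [Derivation.leibniz, smul_eq_mul, h2, mul_zero, add_zero, hFF u, ← hTF u,
      hXn, hX, Finset.sum_add_distrib, mul_ite, mul_one, Finset.sum_ite_eq',
      Finset.mem_univ, if_true]
    push_cast at e
    rw [sub_smul, one_smul] at e
    linear_combination e

end ContactAlgebra

section Embedding

open MvPolynomial ContactAlgebra

variable {n : ℕ} {𝔤 : Type*} [LieRing 𝔤] [LieAlgebra ℝ 𝔤]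

/-- The generating functions of the elements of a graded Lie algebra with negative part spanned by
`e` (degree `-2`) and the `c v` (degree `-1`): `genFun ε e c m ξ` has weight `m - 1` and is meant
for `ξ` of degree `m - 3`. The functional `ε` gives the constant term in degree `-2`, and the
other weights are determined recursively by Euler's identity, since the brackets with `1` and the
linear functions have to correspond to the brackets with `e` and the `c v`. -/
noncomputable def genFun (ε : 𝔤 →ₗ[ℝ] ℝ) (e : 𝔤) (c : Fin n ⊕ Fin n → 𝔤) :
    ℕ → (𝔤 →ₗ[ℝ] MvPolynomial (Vars n) ℝ)
  | 0 => 0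
  | 1 => Algebra.linearMap ℝ (MvPolynomial (Vars n) ℝ) ∘ₗ ε
  | m + 2 => ((m : ℝ) + 1)⁻¹ •
      (LinearMap.mulLeft ℝ (X none) ∘ₗ genFun ε e c m ∘ₗ (LieAlgebra.ad ℝ 𝔤 e : 𝔤 →ₗ[ℝ] 𝔤)
        - ∑ v, LinearMap.mulLeft ℝ (X (some v)) ∘ₗ genFun ε e c (m + 1) ∘ₗ
          (LieAlgebra.ad ℝ 𝔤 (c v) : 𝔤 →ₗ[ℝ] 𝔤))

variable {ε : 𝔤 →ₗ[ℝ] ℝ} {e : 𝔤} {c : Fin n ⊕ Fin n → 𝔤}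

@[simp] theorem genFun_zero (ξ : 𝔤) : genFun ε e c 0 ξ = 0 := by simp [genFun]

theorem genFun_one (ξ : 𝔤) : genFun ε e c 1 ξ = C (ε ξ) := by
  simp [genFun, algebraMap_eq]

theorem genFun_add_two (m : ℕ) (ξ : 𝔤) : genFun ε e c (m + 2) ξ = ((m : ℝ) + 1)⁻¹ •
    (X none * genFun ε e c m ⁅e, ξ⁆ - ∑ v, X (some v) * genFun ε e c (m + 1) ⁅c v, ξ⁆) := by
  simp [genFun, LinearMap.sum_apply]

theorem isWeightedHomogeneous_genFun (m : ℕ) (ξ : 𝔤) :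
    IsWeightedHomogeneous (varWeight n) (genFun ε e c m ξ) ((m : ℤ) - 1) := by
  induction m using Nat.strong_induction_on generalizing ξ with
  | _ m ih =>
    match m with
    | 0 => rw [genFun_zero]; exact isWeightedHomogeneous_zero _ _ _
    | 1 => rw [genFun_one]; exact isWeightedHomogeneous_C _ _
    | m + 2 =>
      rw [genFun_add_two]
      refine isWeightedHomogeneous_smul (IsWeightedHomogeneous.sub ?_
        (IsWeightedHomogeneous.sum _ _ _ fun v _ => ?_)) _
      · have := isWeightedHomogeneous_X_none.mul (ih m (by omega) ⁅e, ξ⁆)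
        exact isWeightedHomogeneous_of_eq this (by push_cast; ring)
      · have := (isWeightedHomogeneous_X_some v).mul (ih (m + 1) (by omega) ⁅c v, ξ⁆)
        exact isWeightedHomogeneous_of_eq this (by push_cast; ring)

/-- The prescribed partial derivatives of the generating functions. For `m < 2` the truncated
indices refer to `genFun ε e c 0 = 0`, as they should. -/
theorem pderiv_genFun (hce : ∀ v, ⁅c v, e⁆ = 0) (hcc : ∀ u v, ⁅c u, c v⁆ = stdForm u v • e)
    (m : ℕ) : ∀ ξ, pderiv none (genFun ε e c m ξ) = (1 / 2 : ℝ) • genFun ε e c (m - 2) ⁅e, ξ⁆ ∧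
      ∀ v, pderiv (some v) (genFun ε e c m ξ) = -genFun ε e c (m - 1) ⁅c v, ξ⁆
        + (1 / 2 : ℝ) • (dualVar v * genFun ε e c (m - 2) ⁅e, ξ⁆) := by
  induction m using Nat.strong_induction_on with
  | _ m ih =>
    intro ξ
    match m with
    | 0 => simp
    | 1 => simp [genFun_one]
    | m + 2 =>
      have hjac : ∀ (v : Fin n ⊕ Fin n) (ζ : 𝔤), ⁅e, ⁅c v, ζ⁆⁆ = ⁅c v, ⁅e, ζ⁆⁆ := by
        intro v ζ
        rw [leibniz_lie (c v), hce v, zero_lie, zero_add]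
      have h0 := ih m (by omega)
      have h1 := ih (m + 1) (by omega)
      simp only [Nat.add_sub_cancel, show m + 1 - 2 = m - 1 by omega] at h1
      have key := pderiv_primitive (n := n) (m := (m : ℤ) + 1) (by omega)
        (T := (1 / 2 : ℝ) • genFun ε e c m ⁅e, ξ⁆)
        (F := fun v => -genFun ε e c (m + 1) ⁅c v, ξ⁆
          + (1 / 2 : ℝ) • (dualVar v * genFun ε e c m ⁅e, ξ⁆)) ?_ ?_ ?_ ?_
      · have hsum : 2 * (X none * ((1 / 2 : ℝ) • genFun ε e c m ⁅e, ξ⁆))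
            + ∑ v, X (some v) * (-genFun ε e c (m + 1) ⁅c v, ξ⁆
              + (1 / 2 : ℝ) • (dualVar v * genFun ε e c m ⁅e, ξ⁆))
            = X none * genFun ε e c m ⁅e, ξ⁆
              - ∑ v, X (some v) * genFun ε e c (m + 1) ⁅c v, ξ⁆ := by
          have hz : ∑ v : Fin n ⊕ Fin n,
              X (some v) * ((1 / 2 : ℝ) • (dualVar v * genFun ε e c m ⁅e, ξ⁆)) = 0 := by
            simp only [mul_smul_comm, ← mul_assoc, ← Finset.smul_sum, ← Finset.sum_mul,
              sum_X_mul_dualVar, zero_mul, smul_zero]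
          simp only [mul_add, Finset.sum_add_distrib, hz, mul_neg, Finset.sum_neg_distrib]
          rw [mul_smul_comm, mul_smul_comm, two_mul, ← two_smul ℝ, smul_smul]
          norm_num [sub_eq_add_neg]
        rw [hsum] at key
        push_cast at key
        rw [← genFun_add_two] at key
        simpa using key
      · exact isWeightedHomogeneous_of_eq
          (isWeightedHomogeneous_smul (isWeightedHomogeneous_genFun m ⁅e, ξ⁆) _) (by ring)
      · intro v
        refine IsWeightedHomogeneous.add ?_ (isWeightedHomogeneous_smul ?_ _)
        · exact isWeightedHomogeneous_of_eq
            (isWeightedHomogeneous_genFun (m + 1) ⁅c v, ξ⁆).neg (by push_cast; ring)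
        · exact isWeightedHomogeneous_of_eq ((isWeightedHomogeneous_dualVar v).mul
            (isWeightedHomogeneous_genFun m ⁅e, ξ⁆)) (by ring)
      · intro v
        simp only [map_add, map_neg, Derivation.map_smul, Derivation.leibniz, smul_eq_mul,
          (h1 _).1, (h0 _).1, (h0 _).2, pderiv_none_dualVar, hjac, mul_zero, add_zero,
          mul_smul_comm, smul_add, smul_neg]
      · intro u v
        have hlie : genFun ε e c m ⁅c u, ⁅c v, ξ⁆⁆ = genFun ε e c m ⁅c v, ⁅c u, ξ⁆⁆
            + stdForm u v • genFun ε e c m ⁅e, ξ⁆ := by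
          rw [leibniz_lie, hcc, smul_lie, map_add, map_smul, add_comm]
        have hskew : stdForm v u = -stdForm u v := by
          rcases u with i | i <;> rcases v with j | j <;>
            simp [stdForm, eq_comm] <;> split_ifs <;> simp
        have hC : (C (1 / 2 : ℝ) : MvPolynomial (Vars n) ℝ) * 2 = 1 := by
          rw [← map_ofNat C 2, ← C_mul]; norm_num
        simp only [map_add, map_neg, Derivation.leibniz, smul_eq_mul, pderiv_C,
          (h1 _).2, (h0 _).2, pderiv_some_dualVar, hjac, hlie, hskew, neg_neg,
          MvPolynomial.smul_eq_C_mul]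
        linear_combination -(C (stdForm u v) * genFun ε e c m ⁅e, ξ⁆) * hC

theorem lagrange_one_genFun (hce : ∀ v, ⁅c v, e⁆ = 0)
    (hcc : ∀ u v, ⁅c u, c v⁆ = stdForm u v • e) (m : ℕ) (ξ : 𝔤) :
    lagrange 1 (genFun ε e c m ξ) = genFun ε e c (m - 2) ⁅e, ξ⁆ := by
  rw [lagrange_skew, lagrange_one, (pderiv_genFun hce hcc m ξ).1, mul_smul_comm, neg_mul, smul_neg,
    neg_neg, two_mul, ← two_smul ℝ, smul_smul]
  norm_num

theorem lagrange_dualVar_genFun (hce : ∀ v, ⁅c v, e⁆ = 0)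
    (hcc : ∀ u v, ⁅c u, c v⁆ = stdForm u v • e) (v : Fin n ⊕ Fin n) (m : ℕ) (ξ : 𝔤) :
    lagrange (dualVar v) (genFun ε e c m ξ) = genFun ε e c (m - 1) ⁅c v, ξ⁆ := by
  rw [lagrange_skew, lagrange_dualVar, (pderiv_genFun hce hcc m ξ).1,
    (pderiv_genFun hce hcc m ξ).2 v, mul_smul_comm]
  abel

theorem genFun_one_self (hε : ε e = 1) : genFun ε e c 1 e = 1 := by
  rw [genFun_one, hε, C_1]

theorem genFun_two_self (hε : ε e = 1) (hcc : ∀ u v, ⁅c u, c v⁆ = stdForm u v • e)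
    (v : Fin n ⊕ Fin n) : genFun ε e c 2 (c v) = dualVar v := by
  rw [genFun_add_two 0]
  simp only [genFun_zero, zero_add, hcc, map_smul, genFun_one_self hε]
  rcases v with i | i <;> simp [stdForm, dualVar, Fintype.sum_sum_type]

theorem lagrange_smul_left (r : ℝ) (f g : MvPolynomial (Vars n) ℝ) :
    lagrange (r • f) g = r • lagrange f g := by
  rw [lagrange_skew, lagrange_smul, ← smul_neg, ← lagrange_skew]

theorem lagrange_zero_left (g : MvPolynomial (Vars n) ℝ) : lagrange 0 g = 0 := by
  simp [lagrange, lap, poisson]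

/-- The generating functions respect the bracket with elements of the negative part. -/
theorem lagrange_genFun_of_neg {𝒢 : ℤ → Submodule ℝ 𝔤} (hε : ε e = 1) (hce : ∀ v, ⁅c v, e⁆ = 0)
    (hcc : ∀ u v, ⁅c u, c v⁆ = stdForm u v • e) (he : 𝒢 (-2) ≤ Submodule.span ℝ {e})
    (hc : 𝒢 (-1) ≤ Submodule.span ℝ (Set.range c)) {a : ℕ} (ha : a = 1 ∨ a = 2) {ξ : 𝔤}
    (hξ : ξ ∈ 𝒢 ((a : ℤ) - 3)) (b : ℕ) (η : 𝔤) :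
    lagrange (genFun ε e c a ξ) (genFun ε e c b η) = genFun ε e c (a + b - 3) ⁅ξ, η⁆ := by
  rcases ha with rfl | rfl
  · obtain ⟨r, rfl⟩ := Submodule.mem_span_singleton.1 (he (by simpa using hξ))
    rw [map_smul, genFun_one_self hε, lagrange_smul_left, lagrange_one_genFun hce hcc, smul_lie,
      map_smul, show 1 + b - 3 = b - 2 by omega]
  · have h1 := hc (by simpa using hξ)
    clear hξ
    induction h1 using Submodule.span_induction with
    | mem x hx =>
      obtain ⟨v, rfl⟩ := hx
      rw [genFun_two_self hε hcc, lagrange_dualVar_genFun hce hcc,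
        show 2 + b - 3 = b - 1 by omega]
    | zero => rw [map_zero, zero_lie, map_zero, lagrange_zero_left]
    | add x y _ _ hx hy => rw [map_add, lagrange_add_left, hx, hy, add_lie, map_add]
    | smul r x _ hx => rw [map_smul, lagrange_smul_left, hx, smul_lie, map_smul]

/-- The generating functions respect the bracket of homogeneous elements. In nonnegative degrees,
the difference of the two sides has positive weight and commutes with the negative part. -/
theorem lagrange_genFun {𝒢 : ℤ → Submodule ℝ 𝔤}
    (hlie : ∀ p q : ℤ, ∀ ξ ∈ 𝒢 p, ∀ η ∈ 𝒢 q, ⁅ξ, η⁆ ∈ 𝒢 (p + q))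
    (h𝒢 : ∀ p < -2, ∀ ξ ∈ 𝒢 p, ξ = 0) (hε : ε e = 1) (hce : ∀ v, ⁅c v, e⁆ = 0)
    (hcc : ∀ u v, ⁅c u, c v⁆ = stdForm u v • e) (he : 𝒢 (-2) = Submodule.span ℝ {e})
    (hc : 𝒢 (-1) = Submodule.span ℝ (Set.range c)) (a b : ℕ) {ξ η : 𝔤}
    (hξ : ξ ∈ 𝒢 ((a : ℤ) - 3)) (hη : η ∈ 𝒢 ((b : ℤ) - 3)) :
    lagrange (genFun ε e c a ξ) (genFun ε e c b η) = genFun ε e c (a + b - 3) ⁅ξ, η⁆ := by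
  induction hN : a + b using Nat.strong_induction_on generalizing a b ξ η with
  | _ N ih =>
    subst hN
    obtain rfl | ha | ha : a = 0 ∨ (a = 1 ∨ a = 2) ∨ 3 ≤ a := by omega
    · rw [h𝒢 _ (by norm_num) ξ hξ, map_zero, zero_lie, map_zero, lagrange_zero_left]
    · exact lagrange_genFun_of_neg hε hce hcc he.le hc.le ha hξ b η
    obtain rfl | hb | hb : b = 0 ∨ (b = 1 ∨ b = 2) ∨ 3 ≤ b := by omega
    · rw [h𝒢 _ (by norm_num) η hη, map_zero, lie_zero, map_zero, lagrange_skew, lagrange_zero_left,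
        neg_zero]
    · rw [lagrange_skew, lagrange_genFun_of_neg hε hce hcc he.le hc.le hb hη a ξ, ← lie_skew,
        map_neg, neg_neg, add_comm]
    rw [← sub_eq_zero]
    have hsub : ∀ f g h : MvPolynomial (Vars n) ℝ,
        lagrange f (g - h) = lagrange f g - lagrange f h := fun f g h => by
      rw [sub_eq_add_neg, lagrange_add, ← neg_one_smul ℝ h, lagrange_smul, neg_one_smul,
        sub_eq_add_neg]
    -- `s ≤ 3 ≤ a, b`, so that the subtraction of `s` does not truncate
    have hstep : ∀ s : ℕ, 1 ≤ s → s ≤ 3 → ∀ z ∈ 𝒢 (-(s : ℤ)), ∀ Z : MvPolynomial (Vars n) ℝ,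
        (∀ m ζ, lagrange Z (genFun ε e c m ζ) = genFun ε e c (m - s) ⁅z, ζ⁆) →
        lagrange Z (lagrange (genFun ε e c a ξ) (genFun ε e c b η)
          - genFun ε e c (a + b - 3) ⁅ξ, η⁆) = 0 := by
      intro s hs hs3 z hz Z hZ
      rw [hsub, lagrange_jacobi, hZ, hZ, hZ, leibniz_lie, map_add,
        ih _ (by omega) (a - s) b (ξ := ⁅z, ξ⁆) ?_ hη rfl,
        ih _ (by omega) a (b - s) (η := ⁅z, η⁆) hξ ?_ rfl]
      · rw [show a - s + b - 3 = a + b - 3 - s by omega,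
          show a + (b - s) - 3 = a + b - 3 - s by omega, sub_self]
      · have := hlie _ _ z hz η hη
        convert this using 2; omega
      · have := hlie _ _ z hz ξ hξ
        convert this using 2; omega
    refine eq_zero_of_lagrange_eq_zero (m := (a : ℤ) + b - 4) (by omega) ?_
      (hstep 2 (by norm_num) (by norm_num) e ?_ 1 (lagrange_one_genFun hce hcc))
      fun v => hstep 1 le_rfl (by norm_num) (c v) ?_ _ (lagrange_dualVar_genFun hce hcc v)
    · refine IsWeightedHomogeneous.sub ?_ ?_
      · exact isWeightedHomogeneous_of_eq (isWeightedHomogeneous_lagrange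
          (isWeightedHomogeneous_genFun a ξ) (isWeightedHomogeneous_genFun b η)) (by ring)
      · exact isWeightedHomogeneous_of_eq (isWeightedHomogeneous_genFun (a + b - 3) _) (by omega)
    · exact he ▸ Submodule.mem_span_singleton_self e
    · exact hc ▸ Submodule.subset_span ⟨v, rfl⟩

theorem exists_linearMap_of_isInternal {V W : Type*} [AddCommGroup V] [Module ℝ V] [AddCommGroup W]
    [Module ℝ W] {A : ℤ → Submodule ℝ V} (h : DirectSum.IsInternal A) (F : ℤ → (V →ₗ[ℝ] W)) :
    ∃ f : V →ₗ[ℝ] W, ∀ p, ∀ x ∈ A p, f x = F p x := by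
  refine ⟨DirectSum.toModule ℝ ℤ W (fun p => F p ∘ₗ (A p).subtype) ∘ₗ
    (LinearEquiv.ofBijective (DirectSum.coeLinearMap A) h).symm.toLinearMap, fun p x hx => ?_⟩
  have : (LinearEquiv.ofBijective (DirectSum.coeLinearMap A) h).symm x
      = DirectSum.lof ℝ ℤ (fun i => A i) p ⟨x, hx⟩ := by
    rw [LinearEquiv.symm_apply_eq]
    exact (DirectSum.coeLinearMap_lof A p ⟨x, hx⟩).symm
  rw [LinearMap.comp_apply, LinearEquiv.coe_coe, this, DirectSum.toModule_lof]
  rfl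

theorem exists_lieHom_genFun {𝒢 : ℤ → Submodule ℝ 𝔤} (hint : DirectSum.IsInternal 𝒢)
    (hlie : ∀ p q : ℤ, ∀ ξ ∈ 𝒢 p, ∀ η ∈ 𝒢 q, ⁅ξ, η⁆ ∈ 𝒢 (p + q))
    (h𝒢 : ∀ p < -2, ∀ ξ ∈ 𝒢 p, ξ = 0) (hε : ε e = 1) (hce : ∀ v, ⁅c v, e⁆ = 0)
    (hcc : ∀ u v, ⁅c u, c v⁆ = stdForm u v • e) (he : 𝒢 (-2) = Submodule.span ℝ {e})
    (hc : 𝒢 (-1) = Submodule.span ℝ (Set.range c)) :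
    ∃ ι : 𝔤 →ₗ⁅ℝ⁆ ContactAlgebra n, ∀ p, ∀ ξ ∈ 𝒢 p, ι ξ = genFun ε e c (p + 3).toNat ξ := by
  let F : ℤ → (𝔤 →ₗ[ℝ] ContactAlgebra n) := fun p => genFun ε e c (p + 3).toNat
  obtain ⟨f, hf⟩ := exists_linearMap_of_isInternal hint F
  have hhom : ∀ p q, ∀ ξ ∈ 𝒢 p, ∀ η ∈ 𝒢 q, f ⁅ξ, η⁆ = ⁅f ξ, f η⁆ := by
    intro p q ξ hξ η hη
    rcases lt_or_ge p (-2) with hp | hp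
    · rw [h𝒢 p hp ξ hξ, zero_lie, map_zero, zero_lie]
    rcases lt_or_ge q (-2) with hq | hq
    · rw [h𝒢 q hq η hη, lie_zero, map_zero, lie_zero]
    rw [hf _ _ (hlie p q ξ hξ η hη), hf p ξ hξ, hf q η hη]
    exact Eq.trans (congrArg (fun m => genFun ε e c m ⁅ξ, η⁆) (by omega))
      (lagrange_genFun hlie h𝒢 hε hce hcc he hc (p + 3).toNat (q + 3).toNat
      (by rwa [Int.toNat_of_nonneg (by omega), add_sub_cancel_right])
      (by rwa [Int.toNat_of_nonneg (by omega), add_sub_cancel_right])).symm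
  have h1 : ∀ p, ∀ ξ ∈ 𝒢 p, ∀ η, f ⁅ξ, η⁆ = ⁅f ξ, f η⁆ := by
    intro p ξ hξ η
    exact LinearMap.congr_fun (f := f ∘ₗ (LieAlgebra.ad ℝ 𝔤 ξ : 𝔤 →ₗ[ℝ] 𝔤))
      (g := (LieAlgebra.ad ℝ (ContactAlgebra n) (f ξ) : _ →ₗ[ℝ] ContactAlgebra n) ∘ₗ f)
      (linearMap_ext_of_isInternal hint fun q x hx => hhom p q ξ hξ x hx) η
  have h2 : ∀ η ξ, f ⁅η, ξ⁆ = ⁅f η, f ξ⁆ := by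
    intro η ξ
    refine LinearMap.congr_fun (f := f ∘ₗ (LieAlgebra.ad ℝ 𝔤 η : 𝔤 →ₗ[ℝ] 𝔤))
      (g := (LieAlgebra.ad ℝ (ContactAlgebra n) (f η) : _ →ₗ[ℝ] ContactAlgebra n) ∘ₗ f)
      (linearMap_ext_of_isInternal hint fun p x hx => ?_) ξ
    change f ⁅η, x⁆ = ⁅f η, f x⁆
    rw [← lie_skew, map_neg, h1 p x hx, lie_skew]
  exact ⟨{ f with map_lie' := fun {x y} => h2 x y }, hf⟩

end Embedding

/-! ### The negative part of the graded algebra -/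

/-- Darboux basis: a finite-dimensional subspace on which an alternating form is nondegenerate is
spanned by vectors on which the form takes the standard values. -/
theorem exists_darboux {V : Type*} [AddCommGroup V] [Module ℝ V] (ω : V →ₗ[ℝ] V →ₗ[ℝ] ℝ)
    (halt : ∀ x, ω x x = 0) (N : ℕ) : ∀ W : Submodule ℝ V, FiniteDimensional ℝ W →
      Module.finrank ℝ W ≤ N → (∀ x ∈ W, (∀ y ∈ W, ω x y = 0) → x = 0) →
      ∃ (n : ℕ) (c : Fin n ⊕ Fin n → V), W = Submodule.span ℝ (Set.range c) ∧
        ∀ u v, ω (c u) (c v) = ContactAlgebra.stdForm u v := by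
  have hskew : ∀ x y, ω y x = -ω x y := by
    intro x y
    have := halt (x + y)
    simp only [map_add, LinearMap.add_apply, halt, zero_add, add_zero] at this
    linarith
  induction N with
  | zero =>
    intro W hW hN _
    refine ⟨0, fun u => 0, ?_, fun u => by rcases u with i | i <;> exact i.elim0⟩
    rw [Set.range_eq_empty, Submodule.span_empty]
    exact Submodule.finrank_eq_zero.1 (Nat.le_zero.1 hN)
  | succ N ih =>
    intro W hW hN hnd
    by_cases hbot : W = ⊥
    · refine ⟨0, fun u => 0, ?_, fun u => by rcases u with i | i <;> exact i.elim0⟩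
      rw [Set.range_eq_empty, Submodule.span_empty, hbot]
    obtain ⟨x, hx, hx0⟩ := Submodule.exists_mem_ne_zero_of_ne_bot hbot
    obtain ⟨y, hy, hxy⟩ : ∃ y ∈ W, ω x y = 1 := by
      by_contra hcon
      refine hx0 (hnd x hx fun y hy => ?_)
      by_contra hne
      exact hcon ⟨(ω x y)⁻¹ • y, W.smul_mem _ hy, by simp [hne]⟩
    have hyx : ω y x = -1 := by rw [hskew x y, hxy]
    -- split off the hyperbolic plane spanned by `x` and `y`
    let W' : Submodule ℝ V := W ⊓ (LinearMap.ker (ω x) ⊓ LinearMap.ker (ω y))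
    have hmem : ∀ z ∈ W, z - ω z y • x + ω z x • y ∈ W' := by
      intro z hz
      refine ⟨add_mem (sub_mem hz (W.smul_mem _ hx)) (W.smul_mem _ hy), ?_, ?_⟩
      · change ω x _ = 0
        simp [halt, hxy, hskew x z]
      · change ω y _ = 0
        simp [halt, hyx, hskew y z]
    have hlt : W' < W := by
      refine lt_of_le_of_ne inf_le_left fun he => ?_
      have hxW : x ∈ W' := he ▸ hx
      have : ω y x = 0 := hxW.2.2
      rw [hyx] at this
      norm_num at this
    have hfin : FiniteDimensional ℝ W' := Submodule.finiteDimensional_of_le inf_le_left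
    obtain ⟨n, c, hc, hω⟩ := ih W' hfin
      (by have := Submodule.finrank_lt_finrank_of_lt hlt; omega) (by
        intro w hw hw0
        refine hnd w hw.1 fun z hz => ?_
        have h1 := hw0 _ (hmem z hz)
        have hxw : ω x w = 0 := hw.2.1
        have hyw : ω y w = 0 := hw.2.2
        simpa [hskew x w, hskew y w, hxw, hyw] using h1)
    have hcW : ∀ u, c u ∈ W' := fun u => hc ▸ Submodule.subset_span ⟨u, rfl⟩
    have hxc : ∀ u, ω x (c u) = 0 := fun u => (hcW u).2.1
    have hyc : ∀ u, ω y (c u) = 0 := fun u => (hcW u).2.2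
    have hcx : ∀ u, ω (c u) x = 0 := fun u => by rw [hskew x, hxc, neg_zero]
    have hcy : ∀ u, ω (c u) y = 0 := fun u => by rw [hskew y, hyc, neg_zero]
    refine ⟨n + 1, Sum.elim (Fin.cons x (c ∘ Sum.inl)) (Fin.cons y (c ∘ Sum.inr)), ?_, ?_⟩
    · apply le_antisymm
      · intro z hz
        have hx' : x ∈ Submodule.span ℝ (Set.range
            (Sum.elim (Fin.cons x (c ∘ Sum.inl)) (Fin.cons y (c ∘ Sum.inr)))) :=
          Submodule.subset_span ⟨Sum.inl 0, rfl⟩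
        have hy' : y ∈ Submodule.span ℝ (Set.range
            (Sum.elim (Fin.cons x (c ∘ Sum.inl)) (Fin.cons y (c ∘ Sum.inr)))) :=
          Submodule.subset_span ⟨Sum.inr 0, rfl⟩
        have hw := hmem z hz
        rw [hc] at hw
        have hw' := Submodule.span_mono (R := ℝ) (t := Set.range
            (Sum.elim (Fin.cons x (c ∘ Sum.inl)) (Fin.cons y (c ∘ Sum.inr)))) (by
          rintro _ ⟨u | u, rfl⟩
          · exact ⟨Sum.inl u.succ, rfl⟩
          · exact ⟨Sum.inr u.succ, rfl⟩) hw
        have hz' : z = (z - ω z y • x + ω z x • y) + ω z y • x - ω z x • y := by abel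
        rw [hz']
        exact sub_mem (add_mem hw' (Submodule.smul_mem _ _ hx')) (Submodule.smul_mem _ _ hy')
      · rw [Submodule.span_le]
        rintro _ ⟨u | u, rfl⟩
        · refine Fin.cases hx (fun i => (hcW (Sum.inl i)).1) u
        · refine Fin.cases hy (fun i => (hcW (Sum.inr i)).1) u
    · rintro (u | u) (v | v) <;> refine Fin.cases ?_ (fun i => ?_) u <;>
        refine Fin.cases ?_ (fun j => ?_) v <;>
        simp [ContactAlgebra.stdForm, halt, hxy, hyx, hxc, hyc, hcx, hcy, hω,
          Fin.succ_ne_zero, (Fin.succ_ne_zero _).symm]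

section NegativePart

-- brackets on `ℂ ⊗ L` are those of its Lie ring structure, not of `ℂ ⊗ L` as a module over itself
attribute [-instance] LieAlgebra.ExtendScalars.instBracketTensorProduct
  LieAlgebra.ExtendScalars.instLieRingModule

variable {𝔤 : Type*} [LieRing 𝔤] [LieAlgebra ℝ 𝔤] {𝔮 : LieSubalgebra ℂ (ℂ ⊗[ℝ] 𝔤)}
  {𝒢 : ℤ → Submodule ℝ 𝔤}

theorem mem_filtration_succ {p : ℤ} (hp : -1 ≤ p) {ξ : 𝔤} :
    ξ ∈ filtration 𝔮 (p + 1) ↔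
      ξ ∈ filtration 𝔮 p ∧ ∀ η ∈ filtration 𝔮 (-1), ⁅ξ, η⁆ ∈ filtration 𝔮 p := by
  have h1 : filtration 𝔮 (-1) = realPoints (qAddConj 𝔮) := by simp [filtration, filtrationUp]
  have h2 : (p + 1 + 1).toNat = (p + 1).toNat + 1 := by omega
  rw [h1, filtration, filtration, if_pos (by omega), if_pos hp, h2]
  exact Iff.rfl

/-- As `𝔮 + conj 𝔮` has codimension one, so has `𝔤^{-1}`. -/
theorem IsHypersurfaceCRAlgebra.exists_sub_smul_mem (h𝔮 : IsHypersurfaceCRAlgebra 𝔮) {u : 𝔤}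
    (hu : u ∉ filtration 𝔮 (-1)) (v : 𝔤) : ∃ r : ℝ, v - r • u ∈ filtration 𝔮 (-1) := by
  have hmem : ∀ x, x ∈ qAddConj 𝔮 ↔
      rePart 𝔤 x ∈ filtration 𝔮 (-1) ∧ imPart 𝔤 x ∈ filtration 𝔮 (-1) := by
    intro x
    rw [← baseChange_filtration_neg_one, mem_baseChange_iff]
  have hne : (qAddConj 𝔮).mkQ ((1 : ℂ) ⊗ₜ[ℝ] u) ≠ 0 := by
    intro h0
    rw [Submodule.mkQ_apply, Submodule.Quotient.mk_eq_zero, hmem] at h0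
    exact hu (by simpa using h0.1)
  obtain ⟨z, hz⟩ := (finrank_eq_one_iff_of_nonzero' _ hne).1 h𝔮.codim_one
    ((qAddConj 𝔮).mkQ ((1 : ℂ) ⊗ₜ[ℝ] v))
  rw [← map_smul, Submodule.mkQ_apply, Submodule.mkQ_apply, eq_comm, Submodule.Quotient.eq,
    hmem] at hz
  refine ⟨z.re, ?_⟩
  have := hz.1
  simpa [rePart_smul] using this

namespace IsTrivialFilteredDeformation

theorem mem_filtration_of_mem (h𝒢 : IsTrivialFilteredDeformation 𝔮 𝒢) {p q : ℤ} (hpq : q ≤ p)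
    {ξ : 𝔤} (hξ : ξ ∈ 𝒢 p) : ξ ∈ filtration 𝔮 q := by
  rw [h𝒢.filtration_eq]
  exact (le_iSup₂_of_le (f := fun (j : ℤ) (_ : q ≤ j) => 𝒢 j) p hpq le_rfl) hξ

theorem eq_zero_of_mem_filtration (h𝒢 : IsTrivialFilteredDeformation 𝔮 𝒢) {p q : ℤ} (hpq : p < q)
    {ξ : 𝔤} (hξ : ξ ∈ 𝒢 p) (hξ' : ξ ∈ filtration 𝔮 q) : ξ = 0 := by
  rw [h𝒢.filtration_eq] at hξ'
  exact eq_zero_of_mem_iSup_ge h𝒢.isInternal hpq hξ hξ'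

/-- The graded algebra is transitive, by the definition of the contact filtration. -/
theorem transitive (h𝒢 : IsTrivialFilteredDeformation 𝔮 𝒢) {p : ℤ} (hp : -1 ≤ p) {ξ : 𝔤}
    (hξ : ξ ∈ 𝒢 p) (h : ∀ η ∈ 𝒢 (-1), ⁅ξ, η⁆ = 0) : ξ = 0 := by
  refine h𝒢.eq_zero_of_mem_filtration (lt_add_one p) hξ ((mem_filtration_succ hp).2
    ⟨h𝒢.mem_filtration_of_mem le_rfl hξ, fun η hη => ?_⟩)
  rw [h𝒢.filtration_eq (-1), mem_iSup_ge_iff h𝒢.isInternal] at hη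
  refine mem_of_gradedProj_mem h𝒢.isInternal ((filtration 𝔮 p).comap
    (LieAlgebra.ad ℝ 𝔤 ξ : 𝔤 →ₗ[ℝ] 𝔤)) (x := η) fun j => ?_
  have hj := gradedProj_mem h𝒢.isInternal j η
  change ⁅ξ, gradedProj h𝒢.isInternal j η⁆ ∈ filtration 𝔮 p
  rcases lt_trichotomy j (-1) with hj1 | rfl | hj1
  · rw [hη j hj1, lie_zero]; exact zero_mem _
  · rw [h _ hj]; exact zero_mem _
  · exact h𝒢.mem_filtration_of_mem (by omega) (h𝒢.lie_mem p j ξ hξ _ hj)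

theorem filtration_neg_one_ne_top (h𝔮 : IsHypersurfaceCRAlgebra 𝔮) :
    filtration 𝔮 (-1) ≠ ⊤ := by
  intro h
  have h1 : qAddConj 𝔮 = ⊤ := by
    rw [← baseChange_filtration_neg_one, h, Submodule.baseChange_top]
  have h2 := h𝔮.codim_one
  rw [h1, Module.finrank_zero_of_subsingleton] at h2
  exact zero_ne_one h2

theorem exists_mem_neg_two (h𝔮 : IsHypersurfaceCRAlgebra 𝔮)
    (h𝒢 : IsTrivialFilteredDeformation 𝔮 𝒢) : ∃ e ∈ 𝒢 (-2), e ∉ filtration 𝔮 (-1) := by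
  by_contra hcon
  push Not at hcon
  -- otherwise the filtration is stationary from degree `-1` downwards
  have h2 : filtration 𝔮 (-2) ≤ filtration 𝔮 (-1) := by
    rw [h𝒢.filtration_eq (-2)]
    refine iSup₂_le fun j hj => ?_
    obtain rfl | hj' := hj.eq_or_lt
    · exact hcon
    · exact fun x hx => h𝒢.mem_filtration_of_mem (by omega) hx
  have h1 : filtration 𝔮 (-1) = realPoints (qAddConj 𝔮) := by simp [filtration, filtrationUp]
  have h3 : filtration 𝔮 (-2) = filtrationDown 𝔮 1 := by simp [filtration]
  have hdown : ∀ m, filtrationDown 𝔮 m ≤ filtration 𝔮 (-1) := by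
    intro m
    induction m with
    | zero => exact h1.ge
    | succ m ih =>
      refine sup_le ih (Submodule.span_le.2 ?_)
      rintro _ ⟨ξ, hξ, η, hη, rfl⟩
      refine h2 (h3 ▸ Submodule.mem_sup_right (Submodule.subset_span ⟨ξ, hξ, η, ?_, rfl⟩))
      change η ∈ realPoints (qAddConj 𝔮)
      rw [← h1]
      exact ih hη
  refine filtration_neg_one_ne_top h𝔮 (eq_top_iff.2 ?_)
  rw [← h𝒢.isInternal.submodule_iSup_eq_top]
  refine iSup_le fun p x hx => ?_
  rcases lt_or_ge p (-1) with hp | hp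
  · have := h𝒢.mem_filtration_of_mem le_rfl hx
    rw [filtration, if_neg (by omega)] at this
    exact hdown _ this
  · exact h𝒢.mem_filtration_of_mem hp hx

/-- Real stabilizer elements of degree `-1` vanish, since the stabilizer is contained in `𝔤^0`. -/
theorem finiteDimensional_neg_one (h𝔮 : IsHypersurfaceCRAlgebra 𝔮)
    (h𝒢 : IsTrivialFilteredDeformation 𝔮 𝒢) : FiniteDimensional ℝ (𝒢 (-1)) := by
  have := h𝔮.finite_quotient
  refine FiniteDimensional.of_injective
    ((realPoints 𝔮.toSubmodule).mkQ ∘ₗ (𝒢 (-1)).subtype) ?_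
  rw [injective_iff_map_eq_zero]
  rintro ⟨ξ, hξ⟩ h0
  have hq : ξ ∈ realPoints 𝔮.toSubmodule := by simpa using h0
  have hq1 : (1 : ℂ) ⊗ₜ[ℝ] ξ ∈ 𝔮.toSubmodule := hq
  have hq2 : (1 : ℂ) ⊗ₜ[ℝ] ξ ∈ conjSubmodule 𝔮.toSubmodule := by
    rw [mem_conjSubmodule_iff, conj_tmul, map_one]; exact hq1
  have h1 : filtration 𝔮 (-1) = realPoints (qAddConj 𝔮) := by simp [filtration, filtrationUp]
  refine Subtype.ext (h𝒢.eq_zero_of_mem_filtration (q := -1 + 1) (by norm_num) hξ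
    ((mem_filtration_succ le_rfl).2 ⟨h𝒢.mem_filtration_of_mem le_rfl hξ, fun η hη => ?_⟩))
  rw [h1] at hη ⊢
  have hη' : (1 : ℂ) ⊗ₜ[ℝ] η ∈ qAddConj 𝔮 := hη
  obtain ⟨a, ha, b, hb, hab⟩ := Submodule.mem_sup.1 hη'
  have : ⁅(1 : ℂ) ⊗ₜ[ℝ] ξ, (1 : ℂ) ⊗ₜ[ℝ] η⁆ ∈ qAddConj 𝔮 := by
    rw [← hab, lie_add]
    exact Submodule.add_mem_sup (𝔮.lie_mem hq1 ha) (lie_mem_conjSubmodule hq2 hb)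
  rwa [LieAlgebra.ExtendScalars.bracket_tmul, one_mul] at this

/-- The negative part of the graded algebra is a Heisenberg algebra: there are a basis vector `e` in
degree `-2`, a functional `ε` giving the coordinate with respect to `e`, and a Darboux basis `c` in
degree `-1`. -/
theorem exists_heisenberg (h𝔮 : IsHypersurfaceCRAlgebra 𝔮)
    (h𝒢 : IsTrivialFilteredDeformation 𝔮 𝒢) :
    ∃ (n : ℕ) (ε : 𝔤 →ₗ[ℝ] ℝ) (e : 𝔤) (c : Fin n ⊕ Fin n → 𝔤), ε e = 1 ∧
      𝒢 (-2) = Submodule.span ℝ {e} ∧ 𝒢 (-1) = Submodule.span ℝ (Set.range c) ∧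
      (∀ p < -2, ∀ ξ ∈ 𝒢 p, ξ = 0) ∧ (∀ v, ⁅c v, e⁆ = 0) ∧
      ∀ u v, ⁅c u, c v⁆ = ContactAlgebra.stdForm u v • e := by
  obtain ⟨e, he, heF⟩ := exists_mem_neg_two h𝔮 h𝒢
  have he0 : e ≠ 0 := fun h => heF (h ▸ zero_mem _)
  have hlow : ∀ p < -2, ∀ ξ ∈ 𝒢 p, ξ = 0 := by
    intro p hp ξ hξ
    refine h𝒢.eq_zero_of_mem_filtration hp hξ ?_
    obtain ⟨r, hr⟩ := h𝔮.exists_sub_smul_mem heF ξ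
    have h2 : filtration 𝔮 (-1) ≤ filtration 𝔮 (-2) := by
      rw [h𝒢.filtration_eq (-1)]
      exact iSup₂_le fun j hj x hx => h𝒢.mem_filtration_of_mem (by omega) hx
    have := add_mem (h2 hr) ((filtration 𝔮 (-2)).smul_mem r (h𝒢.mem_filtration_of_mem le_rfl he))
    rwa [sub_add_cancel] at this
  have hspan : 𝒢 (-2) = Submodule.span ℝ {e} := by
    refine le_antisymm (fun ξ hξ => ?_) (Submodule.span_le.2 (by simpa using he))
    obtain ⟨r, hr⟩ := h𝔮.exists_sub_smul_mem heF ξ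
    have := h𝒢.eq_zero_of_mem_filtration (q := -1) (by norm_num)
      (sub_mem hξ ((𝒢 (-2)).smul_mem r he)) hr
    exact Submodule.mem_span_singleton.2 ⟨r, (sub_eq_zero.1 this).symm⟩
  obtain ⟨ε, hε⟩ : ∃ ε : 𝔤 →ₗ[ℝ] ℝ, ε e = 1 := by
    by_contra hcon
    refine he0 ((Module.forall_dual_apply_eq_zero_iff ℝ e).1 fun φ => ?_)
    by_contra hφ
    exact hcon ⟨(φ e)⁻¹ • φ, by simp [hφ]⟩
  have hεe : ∀ ξ ∈ 𝒢 (-2), ξ = ε ξ • e := by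
    intro ξ hξ
    rw [hspan] at hξ
    obtain ⟨r, rfl⟩ := Submodule.mem_span_singleton.1 hξ
    rw [map_smul, hε, smul_eq_mul, mul_one]
  obtain ⟨n, c, hc, hω⟩ := exists_darboux
    (LinearMap.mk₂ ℝ (fun ξ η : 𝔤 => ε ⁅ξ, η⁆) (by simp) (by simp) (by simp) (by simp))
    (by simp) _ (𝒢 (-1)) (finiteDimensional_neg_one h𝔮 h𝒢) le_rfl (by
      intro ξ hξ h0
      refine h𝒢.transitive le_rfl hξ fun η hη => ?_
      have h1 : ε ⁅ξ, η⁆ = 0 := h0 η hη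
      rw [hεe _ (h𝒢.lie_mem (-1) (-1) ξ hξ η hη), h1, zero_smul])
  have hcm : ∀ v, c v ∈ 𝒢 (-1) := fun v => hc ▸ Submodule.subset_span ⟨v, rfl⟩
  refine ⟨n, ε, e, c, hε, hspan, hc, hlow, fun v => ?_, fun u v => ?_⟩
  · exact hlow (-1 + -2) (by norm_num) _ (h𝒢.lie_mem _ _ _ (hcm v) _ he)
  · have h1 : ε ⁅c u, c v⁆ = ContactAlgebra.stdForm u v := hω u v
    rw [hεe _ (h𝒢.lie_mem (-1) (-1) _ (hcm u) _ (hcm v)), h1]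

end IsTrivialFilteredDeformation

end NegativePart

/-! ### The complex structure in degree `-1` -/

section Holomorphic

-- brackets on `ℂ ⊗ L` are those of its Lie ring structure, not of `ℂ ⊗ L` as a module over itself
attribute [-instance] LieAlgebra.ExtendScalars.instBracketTensorProduct
  LieAlgebra.ExtendScalars.instLieRingModule

variable {𝔤 : Type*} [LieRing 𝔤] [LieAlgebra ℝ 𝔤] {𝔮 : LieSubalgebra ℂ (ℂ ⊗[ℝ] 𝔤)}
  {𝒢 : ℤ → Submodule ℝ 𝔤}

theorem one_tmul_lie {L : Type*} [LieRing L] [LieAlgebra ℝ L] (ξ η : L) :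
    ⁅(1 : ℂ) ⊗ₜ[ℝ] ξ, (1 : ℂ) ⊗ₜ[ℝ] η⁆ = (1 : ℂ) ⊗ₜ[ℝ] ⁅ξ, η⁆ := by
  rw [LieAlgebra.ExtendScalars.bracket_tmul, one_mul]

/-- The vector `a + i b` of the complexification. -/
noncomputable def complexVec (a b : 𝔤) : ℂ ⊗[ℝ] 𝔤 :=
  (1 : ℂ) ⊗ₜ[ℝ] a + Complex.I • ((1 : ℂ) ⊗ₜ[ℝ] b)

theorem complexVec_add (a b a' b' : 𝔤) :
    complexVec (a + a') (b + b') = complexVec a b + complexVec a' b' := by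
  simp only [complexVec, TensorProduct.tmul_add, smul_add]; abel

theorem complexVec_smul (r : ℝ) (a b : 𝔤) :
    complexVec (r • a) (r • b) = (r : ℂ) • complexVec a b := by
  simp only [complexVec, TensorProduct.tmul_smul, smul_add, smul_comm _ Complex.I]
  rfl

theorem I_smul_complexVec (a b : 𝔤) : Complex.I • complexVec a b = complexVec (-b) a := by
  rw [complexVec, complexVec, smul_add, smul_smul, Complex.I_mul_I, neg_one_smul,
    TensorProduct.tmul_neg, add_comm]

theorem conj_complexVec (a b : 𝔤) : conj 𝔤 (complexVec a b) = complexVec a (-b) := by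
  simp only [complexVec, map_add, map_smulₛₗ, conj_tmul, map_one, Complex.conj_I,
    TensorProduct.tmul_neg, neg_smul, smul_neg]

@[simp] theorem rePart_complexVec (a b : 𝔤) : rePart 𝔤 (complexVec a b) = a := by
  simp [complexVec, rePart_smul]

@[simp] theorem imPart_complexVec (a b : 𝔤) : imPart 𝔤 (complexVec a b) = b := by
  simp [complexVec, imPart_smul]

theorem complexVec_rePart_imPart (x : ℂ ⊗[ℝ] 𝔤) : complexVec (rePart 𝔤 x) (imPart 𝔤 x) = x :=
  (eq_rePart_add_imPart x).symm

theorem complexVec_lie (a b a' b' : 𝔤) : ⁅complexVec a b, complexVec a' b'⁆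
    = complexVec (⁅a, a'⁆ - ⁅b, b'⁆) (⁅a, b'⁆ + ⁅b, a'⁆) := by
  have hs : ∀ (z : ℂ) (x y : ℂ ⊗[ℝ] 𝔤), ⁅z • x, y⁆ = z • ⁅x, y⁆ := fun z x y => smul_lie z x y
  have hs' : ∀ (z : ℂ) (x y : ℂ ⊗[ℝ] 𝔤), ⁅x, z • y⁆ = z • ⁅x, y⁆ := fun z x y => lie_smul z x y
  simp only [complexVec, add_lie, lie_add, hs, hs', one_tmul_lie, smul_add, smul_smul,
    Complex.I_mul_I, neg_one_smul, TensorProduct.tmul_add, TensorProduct.tmul_sub]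
  abel

theorem one_tmul_eq_complexVec (a : 𝔤) : (1 : ℂ) ⊗ₜ[ℝ] a = complexVec a 0 := by
  rw [complexVec, TensorProduct.tmul_zero, smul_zero, add_zero]

namespace IsTrivialFilteredDeformation

/-- The image of `𝔮` in `ℂ ⊗ 𝔤_{-1} = (ℂ ⊗ 𝔤^{-1}) / (ℂ ⊗ 𝔤^0)`. -/
noncomputable def holPart (h𝒢 : IsTrivialFilteredDeformation 𝔮 𝒢) : Submodule ℂ (ℂ ⊗[ℝ] 𝔤) :=
  𝔮.toSubmodule.map (h𝒢.cproj (-1))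

theorem holPart_le (h𝒢 : IsTrivialFilteredDeformation 𝔮 𝒢) :
    h𝒢.holPart ≤ (𝒢 (-1)).baseChange ℂ := by
  rintro _ ⟨x, -, rfl⟩
  exact h𝒢.cproj_mem _ x

theorem cproj_eq_zero_of_mem (h𝒢 : IsTrivialFilteredDeformation 𝔮 𝒢) {η : ℂ ⊗[ℝ] 𝔤}
    (hη : η ∈ 𝔮) {j : ℤ} (hj : j < -1) : h𝒢.cproj j η = 0 :=
  h𝒢.mem_qAddConj_iff.1 (Submodule.mem_sup_left hη) j hj

theorem exists_sub_mem_filtration_iff (h𝒢 : IsTrivialFilteredDeformation 𝔮 𝒢) {v : ℂ ⊗[ℝ] 𝔤}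
    (hv : v ∈ (𝒢 (-1)).baseChange ℂ) :
    (∃ η ∈ 𝔮, v - η ∈ (filtration 𝔮 0).baseChange ℂ) ↔ v ∈ h𝒢.holPart := by
  have hvp : h𝒢.cproj (-1) v = v := by rw [h𝒢.cproj_of_mem hv, if_pos rfl]
  constructor
  · rintro ⟨η, hη, h⟩
    have h1 := h𝒢.mem_baseChange_filtration_iff.1 h (-1) (by norm_num)
    rw [map_sub, hvp, sub_eq_zero] at h1
    exact ⟨η, hη, h1.symm⟩
  · rintro ⟨η, hη, h⟩
    refine ⟨η, hη, h𝒢.mem_baseChange_filtration_iff.2 fun j hj => ?_⟩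
    rcases (show j ≤ -1 by omega).eq_or_lt with rfl | hj'
    · rw [map_sub, hvp, h, sub_self]
    · rw [map_sub, h𝒢.cproj_of_mem hv, if_neg (by omega), h𝒢.cproj_eq_zero_of_mem hη hj', sub_zero]

/-- The image of `𝔮` is isotropic, because brackets of elements of `𝔮` have no component of degree
`-2`. -/
theorem lie_eq_zero_of_mem_holPart (h𝒢 : IsTrivialFilteredDeformation 𝔮 𝒢) {x y : ℂ ⊗[ℝ] 𝔤}
    (hx : x ∈ h𝒢.holPart) (hy : y ∈ h𝒢.holPart) : ⁅x, y⁆ = 0 := by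
  obtain ⟨a, ha, rfl⟩ := hx
  obtain ⟨b, hb, rfl⟩ := hy
  -- the part of `a` of nonnegative degree does not contribute in degree `-2`
  have key : h𝒢.cproj (-2) ⁅a - h𝒢.cproj (-1) a, b⁆ = 0 := by
    rw [← lie_skew, map_neg, neg_eq_zero]
    refine mem_of_gradedProj_mem h𝒢.isInternal_baseChange ((LinearMap.ker (h𝒢.cproj (-2))).comap
      (LieAlgebra.ad ℂ (ℂ ⊗[ℝ] 𝔤) b : (ℂ ⊗[ℝ] 𝔤) →ₗ[ℂ] (ℂ ⊗[ℝ] 𝔤)))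
      (x := a - h𝒢.cproj (-1) a) fun j => ?_
    change h𝒢.cproj (-2) ⁅b, h𝒢.cproj j (a - h𝒢.cproj (-1) a)⁆ = 0
    rw [map_sub, h𝒢.cproj_of_mem (h𝒢.cproj_mem (-1) a)]
    rcases lt_trichotomy j (-1) with hj | rfl | hj
    · rw [h𝒢.cproj_eq_zero_of_mem ha hj, if_neg (by omega), sub_zero, lie_zero, map_zero]
    · rw [if_pos rfl, sub_self, lie_zero, map_zero]
    · rw [if_neg (by omega), sub_zero, ← lie_skew, map_neg,
        h𝒢.cproj_lie (h𝒢.cproj_mem j a) b (-2 - j) (-2) (by ring),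
        h𝒢.cproj_eq_zero_of_mem hb (by omega), lie_zero, neg_zero]
  rw [← h𝒢.cproj_lie (h𝒢.cproj_mem (-1) a) b (-1) (-2) (by norm_num)]
  rw [sub_lie, map_sub, sub_eq_zero] at key
  rw [← key, h𝒢.cproj_eq_zero_of_mem (𝔮.lie_mem ha hb) (by norm_num)]

theorem exists_add_of_mem_neg_one (h𝒢 : IsTrivialFilteredDeformation 𝔮 𝒢) {x : ℂ ⊗[ℝ] 𝔤}
    (hx : x ∈ (𝒢 (-1)).baseChange ℂ) :
    ∃ a ∈ h𝒢.holPart, ∃ b ∈ h𝒢.holPart, x = a + conj 𝔤 b := by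
  have hx' : x ∈ qAddConj 𝔮 := by
    refine h𝒢.mem_qAddConj_iff.2 fun j hj => ?_
    rw [h𝒢.cproj_of_mem hx, if_neg (by omega)]
  obtain ⟨a, ha, _, ⟨b, hb, rfl⟩, hab⟩ := Submodule.mem_sup.1 hx'
  refine ⟨_, ⟨a, ha, rfl⟩, _, ⟨b, hb, rfl⟩, ?_⟩
  rw [← h𝒢.cproj_conj, ← map_add, hab, h𝒢.cproj_of_mem hx, if_pos rfl]

/-- The image of `𝔮` in degree `-1` meets its conjugate trivially, since elements of the
intersection commute with both of them and these span the component. -/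
theorem eq_zero_of_mem_holPart (h𝒢 : IsTrivialFilteredDeformation 𝔮 𝒢) {x : ℂ ⊗[ℝ] 𝔤}
    (hx : x ∈ h𝒢.holPart) (hx' : conj 𝔤 x ∈ h𝒢.holPart) : x = 0 := by
  have hcomm : ∀ η ∈ 𝒢 (-1), ⁅x, (1 : ℂ) ⊗ₜ[ℝ] η⁆ = 0 := by
    intro η hη
    obtain ⟨a, ha, b, hb, hab⟩ := h𝒢.exists_add_of_mem_neg_one
      (Submodule.tmul_mem_baseChange_of_mem (1 : ℂ) hη)
    have h1 : ⁅x, conj 𝔤 b⁆ = 0 := by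
      rw [← conj_conj x, ← conj_lie, h𝒢.lie_eq_zero_of_mem_holPart hx' hb, map_zero]
    rw [hab, lie_add, h𝒢.lie_eq_zero_of_mem_holPart hx ha, h1, add_zero]
  obtain ⟨hre, him⟩ := mem_baseChange_iff.1 (h𝒢.holPart_le hx)
  have hlie : ∀ η : 𝔤, ⁅x, (1 : ℂ) ⊗ₜ[ℝ] η⁆ = complexVec ⁅rePart 𝔤 x, η⁆ ⁅imPart 𝔤 x, η⁆ := by
    intro η
    conv_lhs => rw [← complexVec_rePart_imPart x]
    rw [one_tmul_eq_complexVec, complexVec_lie]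
    simp only [lie_zero, sub_zero, zero_add]
  refine eq_zero_iff_rePart_imPart.2 ⟨h𝒢.transitive le_rfl hre fun η hη => ?_,
    h𝒢.transitive le_rfl him fun η hη => ?_⟩
  · have := congrArg (rePart 𝔤) ((hlie η).symm.trans (hcomm η hη))
    rwa [rePart_complexVec, map_zero] at this
  · have := congrArg (imPart 𝔤) ((hlie η).symm.trans (hcomm η hη))
    rwa [imPart_complexVec, map_zero] at this

/-- Every real vector of degree `-1` is the real part of a vector in the image of `𝔮`. -/
theorem exists_complexVec_mem_holPart (h𝒢 : IsTrivialFilteredDeformation 𝔮 𝒢) {ξ : 𝔤}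
    (hξ : ξ ∈ 𝒢 (-1)) : ∃ j ∈ 𝒢 (-1), complexVec ξ (-j) ∈ h𝒢.holPart := by
  obtain ⟨a, ha, b, hb, hab⟩ := h𝒢.exists_add_of_mem_neg_one
    (Submodule.tmul_mem_baseChange_of_mem (1 : ℂ) hξ)
  have hab' : a + conj 𝔤 b = b + conj 𝔤 a := by
    have := congrArg (conj 𝔤) hab
    rw [map_add, conj_conj, conj_tmul, map_one, hab] at this
    rw [this, add_comm]
  have h0 : a - b = 0 := by
    refine h𝒢.eq_zero_of_mem_holPart (sub_mem ha hb) ?_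
    have : conj 𝔤 (a - b) = a - b := by
      rw [map_sub, sub_eq_sub_iff_add_eq_add, add_comm, ← hab', add_comm]
    rw [this]
    exact sub_mem ha hb
  obtain rfl := sub_eq_zero.1 h0
  have h2a := h𝒢.holPart.smul_mem 2 ha
  have hre : rePart 𝔤 ((2 : ℂ) • a) = ξ := by
    have := congrArg (rePart 𝔤) (hab.trans (add_conj a))
    rw [rePart_tmul, Complex.one_re, one_smul] at this
    rw [this, rePart_smul, rePart_smul, rePart_tmul, imPart_tmul]
    simp
  refine ⟨-imPart 𝔤 ((2 : ℂ) • a), neg_mem (mem_baseChange_iff.1 (h𝒢.holPart_le h2a)).2, ?_⟩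
  rw [neg_neg]
  nth_rewrite 1 [← hre]
  rwa [complexVec_rePart_imPart]

theorem eq_of_complexVec_mem_holPart (h𝒢 : IsTrivialFilteredDeformation 𝔮 𝒢) {ξ j j' : 𝔤}
    (hj : complexVec ξ j ∈ h𝒢.holPart) (hj' : complexVec ξ j' ∈ h𝒢.holPart) : j = j' := by
  have h1 := sub_mem hj hj'
  have h2 : complexVec ξ j - complexVec ξ j' = complexVec 0 (j - j') := by
    rw [sub_eq_iff_eq_add, ← complexVec_add, zero_add, sub_add_cancel]
  rw [h2] at h1
  have h3 : complexVec 0 (j - j') = 0 := by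
    refine h𝒢.eq_zero_of_mem_holPart h1 ?_
    have : conj 𝔤 (complexVec 0 (j - j')) = -complexVec 0 (j - j') := by
      rw [conj_complexVec, complexVec, complexVec, TensorProduct.tmul_zero, zero_add, zero_add,
        TensorProduct.tmul_neg, smul_neg]
    rw [this]
    exact neg_mem h1
  have := congrArg (imPart 𝔤) h3
  rwa [imPart_complexVec, map_zero, sub_eq_zero] at this

/-- With `a - i j` and `b - i k` in the image of `𝔮`, `j` and `k` are the values at `a` and `b` of
the complex structure. It is skew with respect to the bracket, since the image of `𝔮` is isotropic. -/
theorem lie_eq_lie_of_complexVec_mem (h𝒢 : IsTrivialFilteredDeformation 𝔮 𝒢) {a b j k : 𝔤}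
    (ha : complexVec a (-j) ∈ h𝒢.holPart) (hb : complexVec b (-k) ∈ h𝒢.holPart) :
    ⁅a, k⁆ = ⁅b, j⁆ := by
  have h := h𝒢.lie_eq_zero_of_mem_holPart ha hb
  rw [complexVec_lie] at h
  have h2 := congrArg (imPart 𝔤) h
  rw [imPart_complexVec, map_zero, lie_neg, neg_lie] at h2
  rw [← lie_skew b j, ← sub_eq_zero, ← neg_eq_zero]
  rw [← h2]; abel

end IsTrivialFilteredDeformation

end Holomorphic

/-! ### Existence of a realization -/

namespace ContactAlgebra

open MvPolynomial

section Components

variable {n : ℕ}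

theorem exists_eq_C_of_weight_zero {f : MvPolynomial (Vars n) ℝ}
    (hf : IsWeightedHomogeneous (varWeight n) f 0) : ∃ r, f = C r := by
  refine ⟨f.coeff 0, ?_⟩
  ext d
  rw [coeff_C]
  split_ifs with hd
  · rw [hd]
  · by_contra hne
    have hw := hf hne
    rw [Finsupp.weight_apply, Finsupp.sum,
      Finset.sum_eq_zero_iff_of_nonneg fun v _ => by
        rcases v with _ | v <;> simp [varWeight]] at hw
    refine hd (Finsupp.ext fun v => ?_).symm
    by_contra hv
    have := hw v (Finsupp.mem_support_iff.2 hv)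
    rcases v with _ | v <;> simp [varWeight] at this hv <;> exact hv this

theorem mem_of_weight_zero {M : Submodule ℝ (MvPolynomial (Vars n) ℝ)} (h : 1 ∈ M)
    {f : MvPolynomial (Vars n) ℝ} (hf : IsWeightedHomogeneous (varWeight n) f 0) : f ∈ M := by
  obtain ⟨r, rfl⟩ := exists_eq_C_of_weight_zero hf
  rw [← mul_one (C r), ← smul_eq_C_mul]
  exact M.smul_mem r h

theorem mem_of_weight_one {M : Submodule ℝ (MvPolynomial (Vars n) ℝ)} (h : ∀ v, dualVar v ∈ M)
    {f : MvPolynomial (Vars n) ℝ} (hf : IsWeightedHomogeneous (varWeight n) f 1) : f ∈ M := by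
  have hX : ∀ v : Fin n ⊕ Fin n, (X (some v) : MvPolynomial (Vars n) ℝ) ∈ M := by
    rintro (i | i)
    · have := M.neg_mem (h (Sum.inr i))
      rwa [dualVar, neg_neg] at this
    · exact h (Sum.inl i)
  have he := euler_identity hf
  rw [eq_zero_of_weight_neg (by norm_num) (isWeightedHomogeneous_pderiv_none hf), mul_zero,
    mul_zero, zero_add, Int.cast_one, one_smul] at he
  rw [← he]
  refine M.sum_mem fun v _ => ?_
  obtain ⟨r, hr⟩ := exists_eq_C_of_weight_zero
    (isWeightedHomogeneous_of_eq (isWeightedHomogeneous_pderiv_some hf v) (sub_self 1))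
  rw [hr, mul_comm, ← smul_eq_C_mul]
  exact M.smul_mem r (hX v)

theorem component_neg_two_le {M : Submodule ℝ (ContactAlgebra n)}
    (h : (1 : MvPolynomial (Vars n) ℝ) ∈ M) : component n (-2) ≤ M :=
  fun _ hf => mem_of_weight_zero (M := M) h (mem_component_iff.1 hf)

theorem component_neg_one_le {M : Submodule ℝ (ContactAlgebra n)}
    (h : ∀ v : Fin n ⊕ Fin n, dualVar v ∈ M) : component n (-1) ≤ M :=
  fun _ hf => mem_of_weight_one (M := M) h
    (isWeightedHomogeneous_of_eq (mem_component_iff.1 hf) (by norm_num))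

end Components

section

variable {n : ℕ} {𝔤 : Type*} [LieRing 𝔤] [LieAlgebra ℝ 𝔤] {ε : 𝔤 →ₗ[ℝ] ℝ} {e : 𝔤}
  {c : Fin n ⊕ Fin n → 𝔤}

/-- A generating function of a homogeneous element vanishes only if the element does: its brackets
with the linear functions vanish, and transitivity applies. -/
theorem eq_zero_of_genFun_eq_zero {𝒢 : ℤ → Submodule ℝ 𝔤}
    (hlie : ∀ p q : ℤ, ∀ ξ ∈ 𝒢 p, ∀ η ∈ 𝒢 q, ⁅ξ, η⁆ ∈ 𝒢 (p + q))
    (htrans : ∀ p : ℤ, -1 ≤ p → ∀ ξ ∈ 𝒢 p, (∀ η ∈ 𝒢 (-1), ⁅ξ, η⁆ = 0) → ξ = 0)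
    (hlow : ∀ p < -2, ∀ ξ ∈ 𝒢 p, ξ = 0) (hε : ε e = 1) (hce : ∀ v, ⁅c v, e⁆ = 0)
    (hcc : ∀ u v, ⁅c u, c v⁆ = stdForm u v • e) (he : 𝒢 (-2) = Submodule.span ℝ {e})
    (hc : 𝒢 (-1) = Submodule.span ℝ (Set.range c)) (m : ℕ) {ξ : 𝔤} (hξ : ξ ∈ 𝒢 ((m : ℤ) - 3))
    (h : genFun ε e c m ξ = 0) : ξ = 0 := by
  induction m generalizing ξ with
  | zero => exact hlow _ (by norm_num) ξ hξ
  | succ m ih =>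
    rcases m with _ | m
    · obtain ⟨r, rfl⟩ := Submodule.mem_span_singleton.1 (he ▸ hξ : ξ ∈ Submodule.span ℝ {e})
      rw [zero_add, map_smul, genFun_one_self hε, smul_eq_zero] at h
      rw [h.resolve_right one_ne_zero, zero_smul]
    · have hv : ∀ v, ⁅c v, ξ⁆ = 0 := by
        intro v
        have hcv : c v ∈ 𝒢 (-1) := hc ▸ Submodule.subset_span ⟨v, rfl⟩
        refine ih ?_ ?_
        · have := hlie _ _ _ hcv _ hξ
          rwa [show (-1 : ℤ) + (((m + 1 + 1 : ℕ) : ℤ) - 3) = ((m + 1 : ℕ) : ℤ) - 3 by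
            push_cast; ring] at this
        · have := lagrange_dualVar_genFun (ε := ε) hce hcc v (m + 1 + 1) ξ
          rw [h, ← zero_smul ℝ (0 : MvPolynomial (Vars n) ℝ), lagrange_smul, zero_smul] at this
          exact this.symm
      refine htrans _ (by push_cast; omega) ξ hξ fun η hη => ?_
      rw [hc] at hη
      induction hη using Submodule.span_induction with
      | mem x hx => obtain ⟨v, rfl⟩ := hx; rw [← lie_skew, hv, neg_zero]
      | zero => rw [lie_zero]
      | add x y _ _ hx hy => rw [lie_add, hx, hy, add_zero]
      | smul r x _ hx => rw [lie_smul, hx, smul_zero]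

/-- An endomorphism of `𝔤_{-1}` that is skew with respect to the bracket is the adjoint action of a
quadratic polynomial in the `x_i` and `y_i`. -/
theorem exists_lagrange_dualVar_eq (hce : ∀ v, ⁅c v, e⁆ = 0)
    (hcc : ∀ u v, ⁅c u, c v⁆ = stdForm u v • e) {k : Fin n ⊕ Fin n → 𝔤}
    (hk : ∀ u v, ⁅c u, k v⁆ = ⁅c v, k u⁆) :
    ∃ J : ContactAlgebra n, J ∈ component n 0 ∧ lagrange J 1 = 0 ∧
      ∀ v, lagrange J (dualVar v) = genFun ε e c 2 (k v) := by
  have hF : ∀ v, IsWeightedHomogeneous (varWeight n) (genFun ε e c 2 (k v)) (2 - 1) := fun v =>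
    isWeightedHomogeneous_genFun 2 (k v)
  have hp := pderiv_primitive (m := 2) (T := 0) (F := fun v => genFun ε e c 2 (k v)) (by norm_num)
    (isWeightedHomogeneous_zero _ _ _) hF
    (fun v => by rw [(pderiv_genFun hce hcc 2 (k v)).1, genFun_zero, smul_zero, map_zero])
    (fun u v => by
      rw [(pderiv_genFun hce hcc 2 (k v)).2 u, (pderiv_genFun hce hcc 2 (k u)).2 v, hk u v]
      simp only [Nat.sub_self, genFun_zero, mul_zero, smul_zero])
  obtain ⟨J, hJ, ht, hd⟩ : ∃ J : MvPolynomial (Vars n) ℝ, IsWeightedHomogeneous (varWeight n) J 2 ∧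
      pderiv none J = 0 ∧ ∀ v, pderiv (some v) J = genFun ε e c 2 (k v) := by
    refine ⟨_, isWeightedHomogeneous_smul ?_ _, hp⟩
    rw [mul_zero, mul_zero, zero_add]
    exact IsWeightedHomogeneous.sum _ _ _ fun v _ =>
      isWeightedHomogeneous_of_eq ((isWeightedHomogeneous_X_some v).mul (hF v)) (by ring)
  refine ⟨J, mem_component_iff.2 hJ, ?_, fun v => ?_⟩
  · rw [lagrange_one, ht, mul_zero]
  · rw [lagrange_dualVar, ht, hd v, mul_zero, sub_zero]

end

end ContactAlgebra

section Existence

-- brackets on `ℂ ⊗ L` are those of its Lie ring structure, not of `ℂ ⊗ L` as a module over itself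
attribute [-instance] LieAlgebra.ExtendScalars.instBracketTensorProduct
  LieAlgebra.ExtendScalars.instLieRingModule

variable {𝔤 : Type*} [LieRing 𝔤] [LieAlgebra ℝ 𝔤] {𝔮 : LieSubalgebra ℂ (ℂ ⊗[ℝ] 𝔤)}
  {𝒢 : ℤ → Submodule ℝ 𝔤}

open ContactAlgebra

theorem injective_of_injOn_graded {V W : Type*} [AddCommGroup V] [Module ℝ V] [AddCommGroup W]
    [Module ℝ W] {A : ℤ → Submodule ℝ V} {B : ℤ → Submodule ℝ W} (hA : DirectSum.IsInternal A)
    (hB : DirectSum.IsInternal B) {f : V →ₗ[ℝ] W} (hf : ∀ p, ∀ x ∈ A p, f x ∈ B p)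
    (h : ∀ p, ∀ x ∈ A p, f x = 0 → x = 0) : Function.Injective f := by
  rw [injective_iff_map_eq_zero]
  intro x hx
  refine eq_zero_of_gradedProj_eq_zero hA fun p => h p _ (gradedProj_mem hA p x) ?_
  rw [← gradedProj_map hA hB hf, hx, map_zero]

theorem baseChange_complexVec {L : Type*} [LieRing L] [LieAlgebra ℝ L] (f : 𝔤 →ₗ[ℝ] L) (a b : 𝔤) :
    f.baseChange ℂ (complexVec a b) = complexVec (f a) (f b) := by
  simp only [complexVec, map_add, map_smul, LinearMap.baseChange_tmul]

theorem complexVec_inj {a b a' b' : 𝔤} : complexVec a b = complexVec a' b' ↔ a = a' ∧ b = b' := by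
  refine ⟨fun h => ⟨?_, ?_⟩, fun h => by rw [h.1, h.2]⟩
  · simpa using congrArg (rePart 𝔤) h
  · simpa using congrArg (imPart 𝔤) h

/-- For a graded embedding with `𝔤_- = 𝔠_-`, an element of `𝔠_0` inducing on `𝔤_{-1}` the complex
structure with holomorphic part the image of `𝔮` completes the embedding to a realization. -/
theorem isContactRealization_of_holPart (h𝒢 : IsTrivialFilteredDeformation 𝔮 𝒢) {n : ℕ}
    {J : ContactAlgebra n} {ι : 𝔤 →ₗ⁅ℝ⁆ ContactAlgebra n} (hinj : Function.Injective ι)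
    (hle : ∀ p : ℤ, (𝒢 p).map (ι : 𝔤 →ₗ[ℝ] ContactAlgebra n) ≤ component n p)
    (h2 : component n (-2) ≤ (𝒢 (-2)).map (ι : 𝔤 →ₗ[ℝ] ContactAlgebra n))
    (h1 : component n (-1) ≤ (𝒢 (-1)).map (ι : 𝔤 →ₗ[ℝ] ContactAlgebra n))
    (hJ : J ∈ component n 0) (hJ2 : ∀ v ∈ component n (-2), ⁅J, v⁆ = 0)
    (hJ1 : ∀ ξ ∈ 𝒢 (-1), ∃ j ∈ 𝒢 (-1), complexVec ξ (-j) ∈ h𝒢.holPart ∧ ⁅J, ι ξ⁆ = ι j) :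
    IsContactRealization 𝔮 𝒢 J ι := by
  -- the complex structure is determined by its holomorphic part, and multiplication of the latter
  -- by `i` shows that its square is `-1`
  have huniq : ∀ ξ ∈ 𝒢 (-1), ∀ j, complexVec ξ (-j) ∈ h𝒢.holPart → ⁅J, ι ξ⁆ = ι j := by
    intro ξ hξ j hj
    obtain ⟨j', -, hj', hJj⟩ := hJ1 ξ hξ
    rw [hJj, neg_injective (h𝒢.eq_of_complexVec_mem_holPart hj hj')]
  have hI : ∀ a b : 𝔤, complexVec a (-b) ∈ h𝒢.holPart → complexVec b (- -a) ∈ h𝒢.holPart := by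
    intro a b h
    have := h𝒢.holPart.smul_mem Complex.I h
    rw [I_smul_complexVec, neg_neg] at this
    rwa [neg_neg]
  have hJc : IsComplexStructure J := by
    refine ⟨hJ, hJ2, fun v hv => ?_⟩
    obtain ⟨ξ, hξ, rfl⟩ := h1 hv
    obtain ⟨j, hj, hh, hJj⟩ := hJ1 ξ hξ
    change ⁅J, ⁅J, ι ξ⁆⁆ = -ι ξ
    rw [hJj, huniq j hj (-ξ) (hI _ _ hh), map_neg]
  refine ⟨hinj, hle, le_antisymm (hle _) h2, le_antisymm (hle _) h1, hJc, fun v hv => ?_⟩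
  obtain ⟨hre, him⟩ := mem_baseChange_iff.1 hv
  rw [h𝒢.exists_sub_mem_filtration_iff hv, univComponent_eq_nonMinimal,
    (isTransitiveGraded hJc).mem_nonMinimal_neg_one_iff, ← complexVec_rePart_imPart v]
  generalize rePart 𝔤 v = a at *
  generalize imPart 𝔤 v = b at *
  have hmem : (ι : 𝔤 →ₗ[ℝ] ContactAlgebra n).baseChange ℂ (complexVec a b)
      ∈ (component n (-1)).baseChange ℂ := by
    rw [baseChange_complexVec, mem_baseChange_iff, rePart_complexVec, imPart_complexVec]
    exact ⟨hle _ ⟨a, hre, rfl⟩, hle _ ⟨b, him, rfl⟩⟩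
  rw [baseChange_complexVec, one_tmul_eq_complexVec, complexVec_lie, I_smul_complexVec,
    complexVec_inj]
  rw [baseChange_complexVec] at hmem
  simp only [zero_lie, sub_zero, add_zero, hmem, true_and]
  change _ ↔ ⁅J, ι a⁆ = -ι b ∧ ⁅J, ι b⁆ = ι a
  constructor
  · intro h
    rw [← neg_neg b] at h
    refine ⟨(huniq a hre _ h).trans (map_neg ι b), huniq b him _ ?_⟩
    have := h𝒢.holPart.neg_mem (hI _ _ h)
    rwa [neg_neg, ← neg_one_smul ℂ, show (-1 : ℂ) = ((-1 : ℝ) : ℂ) by norm_num, ← complexVec_smul,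
      neg_one_smul, neg_one_smul, neg_neg] at this
  · rintro ⟨h, -⟩
    obtain ⟨j, -, hj, hJj⟩ := hJ1 a hre
    rw [hJj, ← map_neg] at h
    rwa [hinj h, neg_neg] at hj

/-- The embedding is given by the generating functions with respect to a Darboux basis `c` of degree
`-1`, and `J` has the brackets with the `ι (c v)` prescribed by the complex structure. -/
theorem exists_isContactRealization (h𝔮 : IsHypersurfaceCRAlgebra 𝔮)
    (h𝒢 : IsTrivialFilteredDeformation 𝔮 𝒢) :
    ∃ (n : ℕ) (J : ContactAlgebra n) (ι : 𝔤 →ₗ⁅ℝ⁆ ContactAlgebra n),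
      IsContactRealization 𝔮 𝒢 J ι := by
  obtain ⟨n, ε, e, c, hε, he, hc, hlow, hce, hcc⟩ := h𝒢.exists_heisenberg h𝔮
  obtain ⟨ι, hι⟩ := exists_lieHom_genFun h𝒢.isInternal h𝒢.lie_mem hlow hε hce hcc he hc
  have hcm : ∀ v, c v ∈ 𝒢 (-1) := fun v => hc ▸ Submodule.subset_span ⟨v, rfl⟩
  have hιe : ι e = (1 : MvPolynomial (Vars n) ℝ) :=
    (hι (-2) e (he ▸ Submodule.mem_span_singleton_self e)).trans (genFun_one_self hε)
  have hιc : ∀ v, ι (c v) = dualVar v := fun v =>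
    (hι (-1) (c v) (hcm v)).trans (genFun_two_self hε hcc v)
  have hmem : ∀ p, ∀ ξ ∈ 𝒢 p, ι ξ ∈ component n p := by
    intro p ξ hξ
    rcases lt_or_ge p (-2) with hp | hp
    · rw [hlow p hp ξ hξ, map_zero]; exact zero_mem _
    · rw [hι p ξ hξ]
      exact mem_component_iff.2
        (isWeightedHomogeneous_of_eq (isWeightedHomogeneous_genFun _ ξ) (by omega))
  choose k hk hkH using fun v => h𝒢.exists_complexVec_mem_holPart (hcm v)
  obtain ⟨J, hJ, hJ2, hJ1⟩ := exists_lagrange_dualVar_eq (ε := ε) hce hcc (k := k)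
    fun u v => h𝒢.lie_eq_lie_of_complexVec_mem (hkH u) (hkH v)
  refine ⟨n, J, ι, isContactRealization_of_holPart h𝒢 ?_ ?_ ?_ ?_ hJ ?_ ?_⟩
  · refine injective_of_injOn_graded (f := (ι : 𝔤 →ₗ[ℝ] ContactAlgebra n)) h𝒢.isInternal
      isInternal_component hmem fun p ξ hξ h0 => ?_
    rcases lt_or_ge p (-2) with hp | hp
    · exact hlow p hp ξ hξ
    · refine eq_zero_of_genFun_eq_zero h𝒢.lie_mem (fun p hp ξ hξ => h𝒢.transitive hp hξ) hlow hε
        hce hcc he hc (p + 3).toNat ?_ ((hι p ξ hξ).symm.trans h0)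
      rwa [show (((p + 3).toNat : ℕ) : ℤ) - 3 = p by omega]
  · rintro p _ ⟨ξ, hξ, rfl⟩
    exact hmem p ξ hξ
  · exact component_neg_two_le ⟨e, he ▸ Submodule.mem_span_singleton_self e, hιe⟩
  · exact component_neg_one_le fun v => ⟨c v, hcm v, hιc v⟩
  · intro v hv
    exact component_neg_two_le (M := LinearMap.ker
      (LieAlgebra.ad ℝ (ContactAlgebra n) J : ContactAlgebra n →ₗ[ℝ] ContactAlgebra n)) hJ2 hv
  · intro ξ hξ
    rw [hc] at hξ
    induction hξ using Submodule.span_induction with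
    | mem x hx =>
      obtain ⟨v, rfl⟩ := hx
      refine ⟨k v, hk v, hkH v, ?_⟩
      rw [hιc, hι (-1) (k v) (hk v)]
      exact hJ1 v
    | zero =>
      refine ⟨0, zero_mem _, ?_, by rw [map_zero, lie_zero]⟩
      simp [complexVec]
    | add x y _ _ hx hy =>
      obtain ⟨a, ha, haH, haJ⟩ := hx
      obtain ⟨b, hb, hbH, hbJ⟩ := hy
      refine ⟨a + b, add_mem ha hb, ?_, by rw [map_add, lie_add, haJ, hbJ, map_add]⟩
      rw [neg_add, complexVec_add]
      exact add_mem haH hbH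
    | smul r x _ hx =>
      obtain ⟨a, ha, haH, haJ⟩ := hx
      refine ⟨r • a, Submodule.smul_mem _ r ha, ?_, by rw [map_smul, lie_smul, haJ, map_smul]⟩
      rw [← smul_neg, complexVec_smul]
      exact Submodule.smul_mem _ _ haH

end Existence

end CR

theorem mainTheorem6 {𝔤 : Type*} [LieRing 𝔤] [LieAlgebra ℝ 𝔤]
    (𝔮 : LieSubalgebra ℂ (ℂ ⊗[ℝ] 𝔤)) (h𝔮 : CR.IsHypersurfaceCRAlgebra 𝔮)
    (k : ℕ) (hk : CR.IsNondegenerate 𝔮 k)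
    (𝒢 : ℤ → Submodule ℝ 𝔤) (h𝒢 : CR.IsTrivialFilteredDeformation 𝔮 𝒢) :
    (∃ (n : ℕ) (J : CR.ContactAlgebra n) (ι : 𝔤 →ₗ⁅ℝ⁆ CR.ContactAlgebra n),
      CR.IsContactRealization 𝔮 𝒢 J ι) ∧
    ∀ (n : ℕ) (J : CR.ContactAlgebra n) (ι : 𝔤 →ₗ⁅ℝ⁆ CR.ContactAlgebra n),
      CR.IsContactRealization 𝔮 𝒢 J ι → CR.IsAligned 𝔮 J ι →
        CR.cstab 𝔮 = CR.hatInter ι (CR.ContactAlgebra.univ J ⊓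
            CR.conjSubmodule (CR.ContactAlgebra.univ J)) ∧
        CR.IsDirectSumOf (CR.cstab 𝔮) (fun p => (𝒢 p).baseChange ℂ ⊓ CR.cstab 𝔮) ∧
        (∀ p : ℤ, -1 ≤ p →
          CR.freeman 𝔮 p ⊔ CR.conjSubmodule (CR.freeman 𝔮 p) =
            (CR.filtration 𝔮 p).baseChange ℂ ⊔ CR.cstab 𝔮) ∧
        (∀ q : ℤ, 0 ≤ q →
          CR.IsDirectSumOf (CR.freeman 𝔮 q) (CR.freemanSummand 𝔮 𝒢 J ι q)) := by
  refine ⟨CR.exists_isContactRealization h𝔮 h𝒢, fun n J ι hR hA => ?_⟩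
  have hU := hR.isAdaptedFamily hA h𝒢
  exact ⟨hR.cstab_eq hA h𝒢 hk, hU.isDirectSumOf_cstab h𝒢 hk,
    fun p hp => hU.freeman_sup_conjSubmodule h𝒢 hk hp,
    fun q hq => hU.isDirectSumOf_freeman h𝒢 hk hq⟩
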